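/- Let $(X,\mathcal O_X)$ be a ringed space (with $\mathcal O_X$ a sheaf of commutative rings) and let $Q$ be a finite quiver with set of vertices $Q_0$ and set of arrows $Q_1$; an arrow $a$ goes from its tail $ta$ to its head $ha$. For every $a\in Q_1$ let $M_a$ be a locally free sheaf of $\mathcal O_X$-modules (of any rank). For a path $p=a_m\cdots a_0$ put $M_p=M_{a_m}\otimes_{\mathcal O_X}\cdots\otimes_{\mathcal O_X}M_{a_0}$, and $M_{\langle i\rangle}=\mathcal O_X$ for the trivial path $\langle i\rangle$ at a vertex $i$. The $M$-twisted path algebra is the sheaf of rings $B=\bigoplus_p M_p$, the sum being over all paths, with multiplication $x_px_q=x_p\otimes x_q\in M_{pq}$ if $tp=hq$ and $x_px_q=0$ otherwise, for $x_p\in M_p$ and $x_q\in M_q$; let $e_i\in M_{\langle i\rangle}$ be the idempotent corresponding to $1$. A $B$-module is a sheaf of left $B$-modules. For a $B$-module $V$ put $V_i=e_iV$, and for $a\in Q_1$ let $\phi_a\colon M_a\otimes_{\mathcal O_X}V_{ta}\to V_{ha}$, $m\otimes v\mapsto mv$, be the structure map. Let $\mu_a\colon M_a\otimes_{\mathcal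 O_X}e_{ta}B\to e_{ha}B$ be the multiplication map. The sheaves $\mathcal Hom_{\mathcal O_X}(e_iB,L)$ and $\mathcal Hom_{\mathcal O_X}(M_a\otimes_{\mathcal O_X}e_{ta}B,L)$, for an $\mathcal O_X$-module $L$, are $B$-modules through the right action of $B$ on $e_iB$ and on $e_{ta}B$: $(b\varphi)(x)=\varphi(xb)$. Let $V$ be a $B$-module. Then injective resolutions $V_i\to V_i^\bullet$ by $\mathcal O_X$-modules, with differentials $\delta$, exist for all $i\in Q_0$; and for every choice of such resolutions there are chain maps $\phi_a^\bullet\colon M_a\otimes_{\mathcal O_X}V_{ta}^\bullet\to V_{ha}^\bullet$, $a\in Q_1$, lifting the maps $\phi_a$. For every choice of the resolutions and of the lifts, let $C(V)^{\bullet\bullet}$ be the double complex of $B$-modules with the two columns $$C(V)^{0,q}=\bigoplus_{i\in Q_0}\mathcal Hom_{\mathcal O_X}(e_iB,V_i^q),\qquad C(V)^{1,q}=\bigoplus_{a\in Q_1}\mathcal Hom_{\mathcal O_X}(M_a\otimes_{\mathcal O_X}e_{ta}B,V_{ha}^q)\qquad(q\ge 0),$$ with vertical differentials induced by $\delta$ and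 horizontal differentials $(-1)^qd$, where $$d\colon(\alpha_i)_{i\in Q_0}\longmapsto\bigl(\alpha_{ha}\circ\mu_a-\phi_a^q\circ(1\otimes\alpha_{ta})\bigr)_{a\in Q_1}.$$ Let $I(V)^\bullet$ be its total complex, and let $$\bar\epsilon\colon V\longrightarrow I(V)^0=\bigoplus_{i\in Q_0}\mathcal Hom_{\mathcal O_X}(e_iB,V_i^0)$$ be the morphism whose $i$-th component sends $v$ to the composite of $x\mapsto xv$, $e_iB\to V_i$, with $V_i\to V_i^0$. Then $I(V)^\bullet$ is an injective resolution of $V$: every $I(V)^n$ is an injective $B$-module, and the map of complexes from $V$ (in degree $0$) to $I(V)^\bullet$ given by $\bar\epsilon$ is a quasi-isomorphism, i.e. $0\to V\to I(V)^0\to I(V)^1\to\cdots$ is exact. In particular the category of $B$-modules has enough injectives, and so does the (equivalent) category of twisted $Q$-sheaves, whose objects are families of $\mathcal O_X$-modules $(W_i)_{i\in Q_0}$ with morphisms $\psi_a\colon M_a\otimes_{\mathcal O_X}W_{ta}\to W_{ha}$, $a\in Q_1$, and whose morphisms are families $f_i\colon W_i\to W_i'$ with $f_{ha}\circ\psi_a=\psi_a'\circ(1\otimes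 f_{ta})$ for all $a\in Q_1$. -/

import Mathlib

open CategoryTheory Limits Opposite TopologicalSpace AlgebraicGeometry

universe u

namespace TwistedQuiver

section PathAlgebra

open scoped TensorProduct DirectSum Classical

variable {Q : Type u} [Quiver.{u} Q]

section Algebra

variable (R : Type u) [CommRing R] (M : ∀ ⦃i j : Q⦄, (i ⟶ j) → Type u)
  [∀ i j (a : i ⟶ j), AddCommGroup (M a)] [∀ i j (a : i ⟶ j), Module R (M a)]

/-- The module `M_p` of a path `p`: `R` for a trivial path, and
`M_{a_m} ⊗ (⋯ ⊗ (M_{a_0} ⊗ R))` for the path `p = a_m ⋯ a_0`. -/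
noncomputable def PathMod {i : Q} : ∀ {j : Q}, Quiver.Path i j → ModuleCat.{u} R
  | _, .nil => ModuleCat.of R R
  | _, .cons p a => ModuleCat.of R (M a ⊗[R] PathMod p)

variable {R} in
/-- The identification of `R` with the module of a trivial path. -/
noncomputable def nilOf (i : Q) : R →ₗ[R] PathMod R M (Quiver.Path.nil : Quiver.Path i i) :=
  (LinearMap.id : R →ₗ[R] R)

variable {R} in
theorem nilOf_surjective (i : Q) : Function.Surjective (nilOf (R := R) M i) := fun x => ⟨x, rfl⟩

/-- The bilinear map `(m, x_p) ↦ m ⊗ x_p`, from `M_a` and `M_p` to `M_{ap}`. -/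
noncomputable def consOf {i j k : Q} (p : Quiver.Path i j) (a : j ⟶ k) :
    M a →ₗ[R] PathMod R M p →ₗ[R] PathMod R M (p.cons a) :=
  TensorProduct.mk R (M a) (PathMod R M p)

/-- The direct sum of the modules `M_p` over all paths `p` with head `j`; this is `e_j A`. -/
abbrev Row (j : Q) : Type u := ⨁ q : (Σ i : Q, Quiver.Path i j), PathMod R M q.2

/-- The inclusion of the summand `M_p` into `e_j A`, for a path `p` with head `j`. -/
noncomputable abbrev rowOf {i j : Q} (p : Quiver.Path i j) : PathMod R M p →ₗ[R] Row R M j :=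
  DirectSum.lof R (Σ i : Q, Quiver.Path i j) (fun q => PathMod R M q.2) ⟨i, p⟩

/-- Left multiplication by an element `m` of `M_a`: it sends `x_q` in `M_q` to `m ⊗ x_q` in
`M_{aq}`, for every path `q` whose head is the tail of `a`. -/
noncomputable def arrowAct {j k : Q} (a : j ⟶ k) : M a →ₗ[R] Row R M j →ₗ[R] Row R M k :=
  LinearMap.flip <| DirectSum.toModule R _ _ fun q =>
    LinearMap.flip <| LinearMap.compr₂ (consOf R M q.2 a) (rowOf R M (q.2.cons a))

/-- Left multiplication `x_p x_q = x_p ⊗ x_q` by an element `x_p` of `M_p`, on the sum of the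
`M_q` over the paths `q` whose head is the tail of `p`. -/
noncomputable def pathAct {i : Q} : ∀ {j : Q} (p : Quiver.Path i j),
    PathMod R M p →ₗ[R] Row R M i →ₗ[R] Row R M j
  | _, .nil => LinearMap.lsmul R (Row R M i)
  | _, .cons p a => TensorProduct.lift
      (((LinearMap.llcomp R _ _ _).comp (arrowAct R M a)).compl₂ (pathAct p))

/-- The `M`-twisted path algebra `A = ⨁_p M_p` over `R` of a quiver with finitely many vertices,
with the summands sorted by the heads of the paths. -/
def PathAlg : Type u := ∀ j : Q, Row R M j

noncomputable instance : AddCommGroup (PathAlg R M) :=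
  inferInstanceAs (AddCommGroup (∀ j, Row R M j))

noncomputable instance : Module R (PathAlg R M) := inferInstanceAs (Module R (∀ j, Row R M j))

/-- The projection of `A` onto `e_j A`. -/
def rowProj (j : Q) : PathAlg R M →ₗ[R] Row R M j where
  toFun x := x j
  map_add' _ _ := rfl
  map_smul' _ _ := rfl

/-- The product of an element of `e_j A` with an element of `A`. For a path `p` from `i` to `j`
only the component in `e_i A` of the second factor contributes to the product with `x_p`: the
product `x_p x_q` is zero unless the tail of `p` is the head of `q`. -/
noncomputable def rowMul (j : Q) : Row R M j →ₗ[R] PathAlg R M →ₗ[R] Row R M j :=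
  DirectSum.toModule R _ _ fun q =>
    (LinearMap.lcomp R (Row R M j) (rowProj R M q.1)).comp (pathAct R M q.2)

noncomputable instance : Mul (PathAlg R M) := ⟨fun x y j => rowMul R M j (x j) y⟩

noncomputable instance : One (PathAlg R M) := ⟨fun j => rowOf R M .nil (nilOf M j 1)⟩

variable {R M}

theorem arrowAct_rowOf {i j k : Q} (a : j ⟶ k) (m : M a) (p : Quiver.Path i j)
    (x : PathMod R M p) :
    arrowAct R M a m (rowOf R M p x) = rowOf R M (p.cons a) (consOf R M p a m x) := by
  simp only [arrowAct, LinearMap.flip_apply, rowOf, DirectSum.toModule_lof]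
  rfl

theorem rowMul_rowOf {i j : Q} (p : Quiver.Path i j) (x : PathMod R M p) (y : PathAlg R M) :
    rowMul R M j (rowOf R M p x) y = pathAct R M p x (y i) := by
  simp only [rowMul, rowOf, DirectSum.toModule_lof]
  rfl

theorem pathAct_consOf {i j k : Q} (p : Quiver.Path i j) (a : j ⟶ k) (m : M a)
    (x : PathMod R M p) (y : Row R M i) :
    pathAct R M (p.cons a) (consOf R M p a m x) y = arrowAct R M a m (pathAct R M p x y) := rfl

theorem pathAct_nilOf {i : Q} (r : R) (y : Row R M i) :
    pathAct R M .nil (nilOf M i r) y = r • y := rfl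

theorem pathMod_cons_induction {i j k : Q} {p : Quiver.Path i j} {a : j ⟶ k}
    {P : PathMod R M (p.cons a) → Prop} (x : PathMod R M (p.cons a)) (zero : P 0)
    (tmul : ∀ m y, P (consOf R M p a m y)) (add : ∀ x y, P x → P y → P (x + y)) : P x :=
  TensorProduct.induction_on (motive := P) x zero tmul add

theorem row_induction {j : Q} {P : Row R M j → Prop} (x : Row R M j) (zero : P 0)
    (of : ∀ (i : Q) (p : Quiver.Path i j) (y : PathMod R M p), P (rowOf R M p y))
    (add : ∀ x y, P x → P y → P (x + y)) : P x :=
  DirectSum.induction_on x zero (fun q y => of q.1 q.2 y) add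

theorem rowMul_arrowAct {j k : Q} (a : j ⟶ k) (m : M a) (x : Row R M j) (y : PathAlg R M) :
    rowMul R M k (arrowAct R M a m x) y = arrowAct R M a m (rowMul R M j x y) := by
  induction x using row_induction with
  | zero => simp
  | add x x' h h' => simp [h, h']
  | of i p x => rw [arrowAct_rowOf, rowMul_rowOf, rowMul_rowOf, pathAct_consOf]

theorem rowMul_pathAct {i j : Q} (p : Quiver.Path i j) (x : PathMod R M p) (y : Row R M i)
    (z : PathAlg R M) :
    rowMul R M j (pathAct R M p x y) z = pathAct R M p x (rowMul R M i y z) := by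
  induction p with
  | nil =>
    obtain ⟨x, rfl⟩ := nilOf_surjective M i x
    rw [pathAct_nilOf, pathAct_nilOf, map_smul, LinearMap.smul_apply]
  | cons p a ih =>
    induction x using pathMod_cons_induction with
    | zero => simp
    | tmul m x => rw [pathAct_consOf, pathAct_consOf, rowMul_arrowAct, ih]
    | add x x' h h' => simp [h, h']

theorem pathAct_one {i j : Q} (p : Quiver.Path i j) (x : PathMod R M p) :
    pathAct R M p x (rowOf R M .nil (nilOf M i 1)) = rowOf R M p x := by
  induction p with
  | nil =>
    obtain ⟨x, rfl⟩ := nilOf_surjective M i x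
    rw [pathAct_nilOf, ← map_smul, ← map_smul, smul_eq_mul, mul_one]
  | cons p a ih =>
    induction x using pathMod_cons_induction with
    | zero => simp
    | tmul m x => rw [pathAct_consOf, ih, arrowAct_rowOf]
    | add x x' h h' => rw [map_add, LinearMap.add_apply, h, h', map_add]

variable (R M) in
noncomputable instance : Ring (PathAlg R M) :=
  { (inferInstance : AddCommGroup (PathAlg R M)) with
    mul := (· * ·)
    one := 1
    zero_mul x := by
      funext j
      change rowMul R M j 0 x = 0
      simp
    mul_zero x := by
      funext j
      change rowMul R M j (x j) 0 = 0
      simp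
    left_distrib x y z := by
      funext j
      change rowMul R M j (x j) (y + z) = rowMul R M j (x j) y + rowMul R M j (x j) z
      simp
    right_distrib x y z := by
      funext j
      change rowMul R M j (x j + y j) z = rowMul R M j (x j) z + rowMul R M j (y j) z
      simp
    mul_assoc x y z := by
      funext j
      change rowMul R M j (rowMul R M j (x j) y) z = rowMul R M j (x j) (y * z)
      induction x j using row_induction with
      | zero => simp
      | add u v h h' => simp [h, h']
      | of i p w => rw [rowMul_rowOf, rowMul_rowOf, rowMul_pathAct]; rfl
    one_mul x := by
      funext j
      change rowMul R M j (rowOf R M .nil (nilOf M j 1)) x = x j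
      rw [rowMul_rowOf, pathAct_nilOf, one_smul]
    mul_one x := by
      funext j
      change rowMul R M j (x j) 1 = x j
      induction x j using row_induction with
      | zero => simp
      | add u v h h' => simp [h, h']
      | of i p w => rw [rowMul_rowOf]; exact pathAct_one p w }

noncomputable instance : Algebra R (PathAlg R M) :=
  Algebra.ofModule
    (fun r x y => by
      funext j
      change rowMul R M j (r • x j) y = r • rowMul R M j (x j) y
      rw [map_smul, LinearMap.smul_apply])
    (fun r x y => by
      funext j
      change rowMul R M j (x j) (r • y) = r • rowMul R M j (x j) y
      rw [map_smul])

variable (R M) in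
/-- The inclusion of `e_j A` into `A`. -/
noncomputable def rowSingle (j : Q) : Row R M j →ₗ[R] PathAlg R M where
  toFun x := Pi.single (M := fun j => Row R M j) j x
  map_add' := Pi.single_add (f := fun j => Row R M j) j
  map_smul' := Pi.single_smul (f := fun j => Row R M j) j

theorem rowSingle_same (j : Q) (x : Row R M j) : rowSingle R M j x j = x :=
  Pi.single_eq_same (M := fun j => Row R M j) j x

theorem rowSingle_of_ne {i j : Q} (h : j ≠ i) (x : Row R M i) : rowSingle R M i x j = 0 :=
  Pi.single_eq_of_ne (M := fun j => Row R M j) h x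

variable (R M) in
/-- The idempotent `e_i` of the twisted path algebra. -/
noncomputable def vertexElt (i : Q) : PathAlg R M :=
  rowSingle R M i (rowOf R M .nil (nilOf M i 1))

variable (R M) in
/-- The element of the twisted path algebra given by an element of `M_a`. -/
noncomputable def arrowElt {i j : Q} (a : i ⟶ j) (m : M a) : PathAlg R M :=
  rowSingle R M j (rowOf R M (Quiver.Path.nil.cons a)
    (consOf R M .nil a m (nilOf M i 1)))

theorem vertexElt_mul_single (i : Q) (y : Row R M i) :
    vertexElt R M i * rowSingle R M i y = rowSingle R M i y := by
  funext j
  change rowMul R M j (rowSingle R M i (rowOf R M .nil (nilOf M i 1)) j) _ = rowSingle R M i y j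
  by_cases h : j = i
  · subst h
    rw [rowSingle_same, rowMul_rowOf, pathAct_nilOf, one_smul]
  · rw [rowSingle_of_ne h, rowSingle_of_ne h, map_zero, LinearMap.zero_apply]

theorem vertexElt_mul_arrowElt {i j : Q} (a : i ⟶ j) (m : M a) :
    vertexElt R M j * arrowElt R M a m = arrowElt R M a m :=
  vertexElt_mul_single j _

theorem arrowElt_add {i j : Q} (a : i ⟶ j) (m m' : M a) :
    arrowElt R M a (m + m') = arrowElt R M a m + arrowElt R M a m' := by
  simp only [arrowElt, map_add, LinearMap.add_apply]

theorem arrowElt_smul {i j : Q} (a : i ⟶ j) (r : R) (m : M a) :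
    arrowElt R M a (r • m) = algebraMap R (PathAlg R M) r * arrowElt R M a m := by
  rw [← Algebra.smul_def]
  simp only [arrowElt, map_smul, LinearMap.smul_apply]

end Algebra

section Functoriality

variable {R S T : Type u} [CommRing R] [CommRing S] [CommRing T]
  {M N P : ∀ ⦃i j : Q⦄, (i ⟶ j) → Type u}
  [∀ i j (a : i ⟶ j), AddCommGroup (M a)] [∀ i j (a : i ⟶ j), Module R (M a)]
  [∀ i j (a : i ⟶ j), AddCommGroup (N a)] [∀ i j (a : i ⟶ j), Module S (N a)]
  [∀ i j (a : i ⟶ j), AddCommGroup (P a)] [∀ i j (a : i ⟶ j), Module T (P a)]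

/-- The map on the modules of a path induced by a ring homomorphism `R → S` and semilinear
maps `M_a → N_a`. -/
noncomputable def pathModMap (f : R →+* S) (g : ∀ ⦃i j : Q⦄ (a : i ⟶ j), M a →ₛₗ[f] N a) {i : Q} :
    ∀ {j : Q} (p : Quiver.Path i j), PathMod R M p →ₛₗ[f] PathMod S N p
  | _, .nil => f.toSemilinearMap
  | _, .cons p a => TensorProduct.map (g a) (pathModMap f g p)

variable (f : R →+* S) (g : ∀ ⦃i j : Q⦄ (a : i ⟶ j), M a →ₛₗ[f] N a)

theorem pathModMap_nilOf (i : Q) (r : R) :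
    pathModMap f g .nil (nilOf M i r) = nilOf N i (f r) := rfl

theorem pathModMap_consOf {i j k : Q} (p : Quiver.Path i j) (a : j ⟶ k) (m : M a)
    (x : PathMod R M p) :
    pathModMap f g (p.cons a) (consOf R M p a m x) = consOf S N p a (g a m) (pathModMap f g p x) :=
  rfl

/-- The map `e_j A → e_j A'` induced by the maps on the modules of the paths. -/
noncomputable def rowMap (j : Q) : Row R M j →+ Row S N j :=
  DirectSum.map fun q => (pathModMap f g q.2).toAddMonoidHom

theorem rowMap_rowOf {i j : Q} (p : Quiver.Path i j) (x : PathMod R M p) :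
    rowMap f g j (rowOf R M p x) = rowOf S N p (pathModMap f g p x) :=
  DirectSum.map_of _ _ _

theorem rowMap_smul (j : Q) (r : R) (x : Row R M j) :
    rowMap f g j (r • x) = f r • rowMap f g j x := by
  induction x using row_induction with
  | zero => simp
  | add u v h h' => simp [h, h']
  | of i p w => rw [← map_smul, rowMap_rowOf, map_smulₛₗ, map_smul, rowMap_rowOf]

theorem rowMap_arrowAct {j k : Q} (a : j ⟶ k) (m : M a) (x : Row R M j) :
    rowMap f g k (arrowAct R M a m x) = arrowAct S N a (g a m) (rowMap f g j x) := by
  induction x using row_induction with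
  | zero => simp
  | add u v h h' => simp [h, h']
  | of i p w => rw [arrowAct_rowOf, rowMap_rowOf, rowMap_rowOf, arrowAct_rowOf, pathModMap_consOf]

theorem rowMap_pathAct {i j : Q} (p : Quiver.Path i j) (x : PathMod R M p) (y : Row R M i) :
    rowMap f g j (pathAct R M p x y) = pathAct S N p (pathModMap f g p x) (rowMap f g i y) := by
  induction p with
  | nil =>
    obtain ⟨x, rfl⟩ := nilOf_surjective M i x
    rw [pathAct_nilOf, pathModMap_nilOf, pathAct_nilOf, rowMap_smul]
  | cons p a ih =>
    induction x using pathMod_cons_induction with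
    | zero => simp
    | tmul m x => rw [pathAct_consOf, pathModMap_consOf, pathAct_consOf, rowMap_arrowAct, ih]
    | add x x' h h' => simp [h, h']

/-- The map underlying `pathAlgMap`. -/
noncomputable def pathAlgMapFun (x : PathAlg R M) : PathAlg S N := fun j => rowMap f g j (x j)

/-- The homomorphism of twisted path algebras induced by a ring homomorphism `R → S` and
semilinear maps `M_a → N_a`. -/
noncomputable def pathAlgMap : PathAlg R M →+* PathAlg S N where
  toFun := pathAlgMapFun f g
  map_zero' := by
    funext j
    exact map_zero (rowMap f g j)
  map_add' x y := by
    funext j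
    exact map_add (rowMap f g j) (x j) (y j)
  map_one' := by
    funext j
    change rowMap f g j (rowOf R M .nil (nilOf M j 1)) = rowOf S N .nil (nilOf N j 1)
    rw [rowMap_rowOf, pathModMap_nilOf, map_one]
  map_mul' x y := by
    funext j
    change rowMap f g j (rowMul R M j (x j) y) =
      rowMul S N j (rowMap f g j (x j)) (pathAlgMapFun f g y)
    induction x j using row_induction with
    | zero => simp
    | add u v h h' => simp [h, h']
    | of i p w => rw [rowMul_rowOf, rowMap_rowOf, rowMul_rowOf, rowMap_pathAct]; rfl

theorem pathAlgMap_single (i : Q) (y : Row R M i) :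
    pathAlgMap f g (rowSingle R M i y) = rowSingle S N i (rowMap f g i y) := by
  funext j
  change rowMap f g j (rowSingle R M i y j) = rowSingle S N i (rowMap f g i y) j
  by_cases h : j = i
  · subst h
    rw [rowSingle_same, rowSingle_same]
  · rw [rowSingle_of_ne h, rowSingle_of_ne h, map_zero]

theorem pathAlgMap_vertexElt (i : Q) : pathAlgMap f g (vertexElt R M i) = vertexElt S N i := by
  rw [vertexElt, pathAlgMap_single, rowMap_rowOf, pathModMap_nilOf, map_one]
  rfl

theorem pathAlgMap_arrowElt {i j : Q} (a : i ⟶ j) (m : M a) :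
    pathAlgMap f g (arrowElt R M a m) = arrowElt S N a (g a m) := by
  rw [arrowElt, pathAlgMap_single, rowMap_rowOf, pathModMap_consOf, pathModMap_nilOf, map_one]
  rfl

theorem pathAlgMap_algebraMap (r : R) :
    pathAlgMap f g (algebraMap R _ r) = algebraMap S _ (f r) := by
  rw [Algebra.algebraMap_eq_smul_one, Algebra.algebraMap_eq_smul_one,
    ← map_one (pathAlgMap f g)]
  funext j
  exact rowMap_smul f g j r _

theorem pathModMap_id (f : R →+* R) (hf : ∀ r, f r = r)
    (g : ∀ ⦃i j : Q⦄ (a : i ⟶ j), M a →ₛₗ[f] M a) (hg : ∀ i j (a : i ⟶ j) m, g a m = m)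
    {i j : Q} (p : Quiver.Path i j) (x : PathMod R M p) : pathModMap f g p x = x := by
  induction p with
  | nil =>
    obtain ⟨x, rfl⟩ := nilOf_surjective M i x
    rw [pathModMap_nilOf, hf]
  | cons p a ih =>
    induction x using pathMod_cons_induction with
    | zero => simp
    | tmul m x => rw [pathModMap_consOf, hg, ih]
    | add x x' h h' => simp [h, h']

theorem pathAlgMap_id (f : R →+* R) (hf : ∀ r, f r = r)
    (g : ∀ ⦃i j : Q⦄ (a : i ⟶ j), M a →ₛₗ[f] M a) (hg : ∀ i j (a : i ⟶ j) m, g a m = m)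
    (x : PathAlg R M) : pathAlgMap f g x = x := by
  funext j
  change rowMap f g j (x j) = x j
  induction x j using row_induction with
  | zero => simp
  | add u v h h' => simp [h, h']
  | of i p w => rw [rowMap_rowOf, pathModMap_id f hf g hg]

variable (f' : S →+* T) (g' : ∀ ⦃i j : Q⦄ (a : i ⟶ j), N a →ₛₗ[f'] P a)
  (f'' : R →+* T) (g'' : ∀ ⦃i j : Q⦄ (a : i ⟶ j), M a →ₛₗ[f''] P a)

theorem pathModMap_comp (hf : ∀ r, f'' r = f' (f r))
    (hg : ∀ i j (a : i ⟶ j) m, g'' a m = g' a (g a m))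
    {i j : Q} (p : Quiver.Path i j) (x : PathMod R M p) :
    pathModMap f'' g'' p x = pathModMap f' g' p (pathModMap f g p x) := by
  induction p with
  | nil =>
    obtain ⟨x, rfl⟩ := nilOf_surjective M i x
    rw [pathModMap_nilOf, pathModMap_nilOf, pathModMap_nilOf, hf]
  | cons p a ih =>
    induction x using pathMod_cons_induction with
    | zero => simp
    | tmul m x => rw [pathModMap_consOf, pathModMap_consOf, pathModMap_consOf, hg, ih]
    | add x x' h h' => simp [h, h']

theorem pathAlgMap_comp (hf : ∀ r, f'' r = f' (f r))
    (hg : ∀ i j (a : i ⟶ j) m, g'' a m = g' a (g a m)) (x : PathAlg R M) :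
    pathAlgMap f'' g'' x = pathAlgMap f' g' (pathAlgMap f g x) := by
  funext j
  change rowMap f'' g'' j (x j) = rowMap f' g' j (rowMap f g j (x j))
  induction x j using row_induction with
  | zero => simp
  | add u v h h' => simp [h, h']
  | of i p w =>
    rw [rowMap_rowOf, rowMap_rowOf, rowMap_rowOf, pathModMap_comp f g f' g' f'' g'' hf hg]

end Functoriality

end PathAlgebra

section Sheaves

/-- The structure sheaf of a ringed space, as a sheaf of (not necessarily commutative) rings. -/
noncomputable abbrev strSheaf (X : RingedSpace.{u, u}) : Sheaf (Opens.grothendieckTopology X) RingCat.{u} :=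
  (sheafCompose (Opens.grothendieckTopology X) (forget₂ CommRingCat.{u} RingCat.{u})).obj
    (SheafedSpace.sheaf X)

/-- The category of sheaves of `𝒪_X`-modules. -/
abbrev OMod (X : RingedSpace.{u, u}) := SheafOfModules.{u} (strSheaf X)

variable {X : RingedSpace.{u, u}}

/-- The sections of an `𝒪_X`-module over an open set. -/
abbrev Sec (F : PresheafOfModules.{u} (strSheaf X).obj) (U : (Opens X)ᵒᵖ) : Type u := F.obj U

noncomputable instance (F : PresheafOfModules.{u} (strSheaf X).obj) (U : (Opens X)ᵒᵖ) :
    Module (X.presheaf.obj U) (Sec F U) :=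
  inferInstanceAs (Module ((strSheaf X).obj.obj U) (F.obj U))

/-- Restriction of sections of an `𝒪_X`-module. -/
noncomputable def secRes (F : PresheafOfModules.{u} (strSheaf X).obj) {U W : (Opens X)ᵒᵖ} (f : U ⟶ W) :
    Sec F U →ₛₗ[(X.presheaf.map f).hom] Sec F W :=
  F.restrictₛₗ f

theorem secRes_id (F : PresheafOfModules.{u} (strSheaf X).obj) (U : (Opens X)ᵒᵖ) (x : Sec F U) :
    secRes F (𝟙 U) x = x :=
  ConcreteCategory.congr_hom (F.presheaf.map_id U) x

theorem secRes_comp (F : PresheafOfModules.{u} (strSheaf X).obj) {U V W : (Opens X)ᵒᵖ}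
    (f : U ⟶ V) (g : V ⟶ W) (x : Sec F U) :
    secRes F (f ≫ g) x = secRes F g (secRes F f x) :=
  ConcreteCategory.congr_hom (F.presheaf.map_comp f g) x

variable {Q : Type u} [Quiver.{u} Q] (M : ∀ ⦃i j : Q⦄, (i ⟶ j) → OMod X)

/-- The presheaf sending `U` to the path algebra over `𝒪_X(U)` twisted by the modules `M_a(U)`. -/
noncomputable def pathPresheaf : (Opens X)ᵒᵖ ⥤ RingCat.{u} where
  obj U := RingCat.of (PathAlg (X.presheaf.obj U) (fun _ _ a => Sec (M a).val U))
  map f := RingCat.ofHom (pathAlgMap (X.presheaf.map f).hom fun _ _ a => secRes (M a).val f)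
  map_id U := by
    ext x
    exact pathAlgMap_id _ (fun r => by simp) _
      (fun i j a m => secRes_id _ _ m) x
  map_comp {U V W} f g := by
    ext x
    exact pathAlgMap_comp _ _ _ _ _ _ (fun r => by simp)
      (fun i j a m => secRes_comp _ f g m) x

/-- The `M`-twisted path algebra `B` on `X`, a sheaf of rings. -/
noncomputable def pathSheaf : Sheaf (Opens.grothendieckTopology X) RingCat.{u} :=
  (presheafToSheaf (Opens.grothendieckTopology X) RingCat.{u}).obj (pathPresheaf M)


/-- The canonical morphism from the presheaf of path algebras to its associated sheaf `B`. -/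
noncomputable def toPathSheaf : pathPresheaf M ⟶ (pathSheaf M).obj :=
  toSheafify (Opens.grothendieckTopology X) (pathPresheaf M)

/-- The path algebra over `𝒪_X(U)` twisted by the modules `M_a(U)`. -/
abbrev LocalAlg (U : (Opens X)ᵒᵖ) : Type u :=
  PathAlg (X.presheaf.obj U) (fun _ _ a => Sec (M a).val U)

/-- The canonical homomorphism from the path algebra over `U` to the ring of sections of `B`. -/
noncomputable def toSec (U : (Opens X)ᵒᵖ) : LocalAlg M U →+* (pathSheaf M).obj.obj U :=
  ((toPathSheaf M).app U).hom

theorem toSec_res {U W : (Opens X)ᵒᵖ} (f : U ⟶ W) (x : LocalAlg M U) :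
    ((pathSheaf M).obj.map f).hom (toSec M U x) =
      toSec M W (pathAlgMap (X.presheaf.map f).hom (fun _ _ a => secRes (M a).val f) x) :=
  (ConcreteCategory.congr_hom ((toPathSheaf M).naturality f) x).symm

/-- The homomorphism from `𝒪_X(U)` to the ring of sections of `B` over `U`. -/
noncomputable def secScalar (U : (Opens X)ᵒᵖ) : X.presheaf.obj U →+* (pathSheaf M).obj.obj U :=
  (toSec M U).comp (algebraMap (X.presheaf.obj U) (LocalAlg M U))

/-- The structure morphism `𝒪_X → B`. -/
noncomputable def pathScalar : (strSheaf X).obj ⟶ (pathSheaf M).obj where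
  app U := RingCat.ofHom (secScalar M U)
  naturality U W f := by
    ext r
    exact ((toSec_res M f (algebraMap (X.presheaf.obj U) (LocalAlg M U) r)).trans
      (congrArg (toSec M W) (pathAlgMap_algebraMap _ _ _))).symm

/-- The idempotent section `e_i` of `B`. -/
noncomputable def secVertex (i : Q) (U : (Opens X)ᵒᵖ) : (pathSheaf M).obj.obj U :=
  toSec M U (vertexElt (X.presheaf.obj U) (fun _ _ a => Sec (M a).val U) i)

/-- The section of `B` given by a section of `M_a`. -/
noncomputable def secArrow {i j : Q} (a : i ⟶ j) (U : (Opens X)ᵒᵖ) (m : Sec (M a).val U) :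
    (pathSheaf M).obj.obj U :=
  toSec M U (arrowElt (X.presheaf.obj U) (fun _ _ a => Sec (M a).val U) a m)

variable {M}

theorem secVertex_res (i : Q) {U W : (Opens X)ᵒᵖ} (f : U ⟶ W) :
    ((pathSheaf M).obj.map f).hom (secVertex M i U) = secVertex M i W := by
  rw [secVertex, toSec_res, pathAlgMap_vertexElt, secVertex]

theorem secArrow_res {i j : Q} (a : i ⟶ j) {U W : (Opens X)ᵒᵖ} (f : U ⟶ W)
    (m : Sec (M a).val U) :
    ((pathSheaf M).obj.map f).hom (secArrow M a U m) = secArrow M a W (secRes (M a).val f m) := by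
  rw [secArrow, toSec_res, pathAlgMap_arrowElt, secArrow]

theorem secVertex_mul_scalar (i : Q) (U : (Opens X)ᵒᵖ) (r : X.presheaf.obj U) :
    secVertex M i U * secScalar M U r = secScalar M U r * secVertex M i U := by
  rw [secVertex, secScalar, RingHom.comp_apply, ← map_mul, ← map_mul, Algebra.commutes]

theorem secArrow_mul_scalar {i j : Q} (a : i ⟶ j) (U : (Opens X)ᵒᵖ) (m : Sec (M a).val U)
    (r : X.presheaf.obj U) :
    secArrow M a U m * secScalar M U r = secScalar M U r * secArrow M a U m := by
  rw [secArrow, secScalar, RingHom.comp_apply, ← map_mul, ← map_mul, Algebra.commutes]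

theorem secArrow_add {i j : Q} (a : i ⟶ j) (U : (Opens X)ᵒᵖ) (m m' : Sec (M a).val U) :
    secArrow M a U (m + m') = secArrow M a U m + secArrow M a U m' := by
  rw [secArrow, arrowElt_add, map_add, secArrow, secArrow]

theorem secArrow_smul {i j : Q} (a : i ⟶ j) (U : (Opens X)ᵒᵖ) (r : X.presheaf.obj U)
    (m : Sec (M a).val U) :
    secArrow M a U (r • m) = secScalar M U r * secArrow M a U m := by
  rw [secArrow, arrowElt_smul, map_mul, secArrow, secScalar, RingHom.comp_apply]

theorem secVertex_mul_arrow {i j : Q} (a : i ⟶ j) (U : (Opens X)ᵒᵖ) (m : Sec (M a).val U) :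
    secVertex M j U * secArrow M a U m = secArrow M a U m := by
  rw [secVertex, secArrow, ← map_mul, vertexElt_mul_arrowElt]

/-- The `𝒪_X`-module underlying a `B`-module. -/
noncomputable abbrev underlyingO (V : PresheafOfModules.{u} (pathSheaf M).obj) :
    PresheafOfModules.{u} (strSheaf X).obj :=
  (PresheafOfModules.restrictScalars (pathScalar M)).obj V

/-- The sections `v` of a `B`-module with `e_i v = v`. -/
def IsAtVertex (V : PresheafOfModules.{u} (pathSheaf M).obj) (i : Q) {U : (Opens X)ᵒᵖ}
    (v : V.obj U) : Prop :=
  secVertex M i U • v = v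

theorem IsAtVertex.scalar_smul {V : PresheafOfModules.{u} (pathSheaf M).obj} {i : Q}
    {U : (Opens X)ᵒᵖ} (r : X.presheaf.obj U) {v : V.obj U} (hv : IsAtVertex V i v) :
    IsAtVertex V i (secScalar M U r • v) := by
  rw [IsAtVertex, ← mul_smul, secVertex_mul_scalar, mul_smul, hv]

theorem IsAtVertex.res {V : PresheafOfModules.{u} (pathSheaf M).obj} {i : Q}
    {U W : (Opens X)ᵒᵖ} (f : U ⟶ W) {v : V.obj U} (hv : IsAtVertex V i v) :
    IsAtVertex V i (show V.obj W from V.map f v) := by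
  rw [IsAtVertex, ← secVertex_res (M := M) i f]
  exact (V.map_smul f _ _).symm.trans (congrArg (V.map f) hv)

theorem IsAtVertex.arrow_smul {V : PresheafOfModules.{u} (pathSheaf M).obj} {i j : Q}
    (a : i ⟶ j) {U : (Opens X)ᵒᵖ} (m : Sec (M a).val U) (v : V.obj U) :
    IsAtVertex V j (secArrow M a U m • v) := by
  rw [IsAtVertex, ← mul_smul, secVertex_mul_arrow]

/-- The subpresheaf `e_i V` of a `B`-module `V`: the sections `v` with `e_i v = v`. -/
noncomputable def vertexPart (V : PresheafOfModules.{u} (pathSheaf M).obj) (i : Q) :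
    (underlyingO V).Submodule where
  obj U :=
    { carrier := {v | IsAtVertex V i (U := U) v}
      add_mem' := fun {v w} hv hw =>
        (smul_add (A := V.obj U) (secVertex M i U) v w).trans
          (congrArg₂ (fun x y : V.obj U => x + y) hv hw)
      zero_mem' := smul_zero (A := V.obj U) (secVertex M i U)
      smul_mem' := fun r _ hv => IsAtVertex.scalar_smul r hv }
  map f _ hv := IsAtVertex.res f hv

/-- The presheaf of `𝒪_X`-modules `e_i V`. -/
noncomputable abbrev vertexPre (V : PresheafOfModules.{u} (pathSheaf M).obj) (i : Q) :
    PresheafOfModules.{u} (strSheaf X).obj :=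
  (vertexPart V i).toPresheafOfModules

theorem vertexPre_isSheaf (V : SheafOfModules.{u} (pathSheaf M)) (i : Q) :
    Presheaf.IsSheaf (Opens.grothendieckTopology X) (vertexPre V.val i).presheaf := by
  refine (TopCat.Presheaf.isSheaf_iff_isSheafUniqueGluing (X := X.carrier) _).2 ?_
  intro ι U s hs
  let F : TopCat.Sheaf Ab X.carrier := ⟨V.val.presheaf, V.isSheaf⟩
  have hs' : TopCat.Presheaf.IsCompatible F.1 U (fun k => (s k).1) :=
    fun k l => congrArg Subtype.val (hs k l)
  obtain ⟨t, ht, ht'⟩ := F.existsUnique_gluing U _ hs'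
  have hv : IsAtVertex V.val i (U := op (iSup U)) t := by
    refine F.eq_of_locally_eq U _ _ fun k => ?_
    have h1 : V.val.map (Opens.leSupr U k).op t = (s k).1 := ht k
    have h2 : IsAtVertex V.val i (U := op (U k)) (s k).1 := (s k).2
    refine (V.val.map_smul (Opens.leSupr U k).op (secVertex M i _) t).trans ?_
    erw [secVertex_res, h1]
    exact h2
  refine ⟨⟨t, hv⟩, fun k => Subtype.ext (ht k), fun y hy => Subtype.ext (ht' _ fun k => ?_)⟩
  exact congrArg Subtype.val (hy k)

/-- The sheaf of `𝒪_X`-modules `V_i = e_i V` of a `B`-module `V`. -/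
noncomputable def vertexSheaf (V : SheafOfModules.{u} (pathSheaf M)) (i : Q) : OMod X :=
  ⟨vertexPre V.val i, vertexPre_isSheaf V i⟩

section Hom

variable (B : Sheaf (Opens.grothendieckTopology X) RingCat.{u})

/-- A presheaf of `𝒪_X`-modules with a commuting right action of a sheaf of rings `B`. -/
structure RightModule where
  /-- the underlying presheaf of `𝒪_X`-modules -/
  mod : PresheafOfModules.{u} (strSheaf X).obj
  /-- `rmul U b` is the right multiplication `x ↦ x b` -/
  rmul (U : (Opens X)ᵒᵖ) :
    B.obj.obj U →+* (Module.End (X.presheaf.obj U) (Sec mod U))ᵐᵒᵖ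
  res_rmul {U W : (Opens X)ᵒᵖ} (f : U ⟶ W) (b : B.obj.obj U) (x : Sec mod U) :
    secRes mod f ((rmul U b).unop x) = (rmul W (B.obj.map f b)).unop (secRes mod f x)

/-- The sections over `U` of the sheaf `Hom_{𝒪_X}(F, L)`: morphisms of `𝒪_X|_U`-modules
`F|_U → L|_U`, given by compatible linear maps `F(W) → L(W)` for `W ⊆ U`. -/
noncomputable def homSec (F L : PresheafOfModules.{u} (strSheaf X).obj) (U : (Opens X)ᵒᵖ) :
    AddSubgroup (∀ (W : (Opens X)ᵒᵖ) (_ : U ⟶ W), Sec F W →ₗ[X.presheaf.obj W] Sec L W) where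
  carrier := {φ | ∀ (W W' : (Opens X)ᵒᵖ) (f : U ⟶ W) (g : W ⟶ W') (x : Sec F W),
    secRes L g (φ W f x) = φ W' (f ≫ g) (secRes F g x)}
  add_mem' {φ ψ} hφ hψ W W' f g x := by
    simp only [Pi.add_apply, LinearMap.add_apply, map_add, hφ W W' f g x, hψ W W' f g x]
  zero_mem' W W' f g x := by simp
  neg_mem' {φ} hφ W W' f g x := by
    simp only [Pi.neg_apply, LinearMap.neg_apply, map_neg, hφ W W' f g x]

/-- Restriction of sections of `Hom_{𝒪_X}(F, L)`. -/
noncomputable def homRes (F L : PresheafOfModules.{u} (strSheaf X).obj) {U U' : (Opens X)ᵒᵖ}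
    (h : U ⟶ U') : homSec F L U →+ homSec F L U' where
  toFun φ := ⟨fun W f => φ.1 W (h ≫ f), fun W W' f g x => by
    simpa using φ.2 W W' (h ≫ f) g x⟩
  map_zero' := rfl
  map_add' _ _ := rfl

variable {B}

/-- The left action of `B` on `Hom_{𝒪_X}(F, L)` for a right `B`-module `F`, given by
`(b φ)(x) = φ(x b)`. -/
noncomputable instance homSecModule (F : RightModule B) (L : PresheafOfModules.{u} (strSheaf X).obj)
    (U : (Opens X)ᵒᵖ) : Module (B.obj.obj U) (homSec F.mod L U) where
  smul b φ := ⟨fun W f => φ.1 W f ∘ₗ (F.rmul W (B.obj.map f b)).unop, fun W W' f g x => by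
    simp only [LinearMap.comp_apply]
    rw [φ.2 W W' f g, F.res_rmul]
    simp⟩
  one_smul φ := by
    refine Subtype.ext (funext fun W => funext fun f => LinearMap.ext fun x => ?_)
    change φ.1 W f ((F.rmul W (B.obj.map f 1)).unop x) = φ.1 W f x
    simp
  mul_smul b b' φ := by
    refine Subtype.ext (funext fun W => funext fun f => LinearMap.ext fun x => ?_)
    change φ.1 W f ((F.rmul W (B.obj.map f (b * b'))).unop x) =
      φ.1 W f ((F.rmul W (B.obj.map f b')).unop ((F.rmul W (B.obj.map f b)).unop x))
    simp
  smul_zero b := by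
    refine Subtype.ext (funext fun W => funext fun f => LinearMap.ext fun x => ?_)
    rfl
  smul_add b φ ψ := by
    refine Subtype.ext (funext fun W => funext fun f => LinearMap.ext fun x => ?_)
    rfl
  add_smul b b' φ := by
    refine Subtype.ext (funext fun W => funext fun f => LinearMap.ext fun x => ?_)
    change φ.1 W f ((F.rmul W (B.obj.map f (b + b'))).unop x) =
      φ.1 W f ((F.rmul W (B.obj.map f b)).unop x) + φ.1 W f ((F.rmul W (B.obj.map f b')).unop x)
    simp
  zero_smul φ := by
    refine Subtype.ext (funext fun W => funext fun f => LinearMap.ext fun x => ?_)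
    change φ.1 W f ((F.rmul W (B.obj.map f 0)).unop x) = 0
    simp

theorem homSec_smul_apply (F : RightModule B) (L : PresheafOfModules.{u} (strSheaf X).obj)
    (U : (Opens X)ᵒᵖ) (b : B.obj.obj U) (φ : homSec F.mod L U) {W : (Opens X)ᵒᵖ} (f : U ⟶ W)
    (x : Sec F.mod W) : (b • φ).1 W f x = φ.1 W f ((F.rmul W (B.obj.map f b)).unop x) := rfl

/-- The presheaf of abelian groups underlying `Hom_{𝒪_X}(F, L)`. -/
noncomputable def homAb (F L : PresheafOfModules.{u} (strSheaf X).obj) : (Opens X)ᵒᵖ ⥤ Ab.{u} where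
  obj U := AddCommGrpCat.of (homSec F L U)
  map f := AddCommGrpCat.ofHom (homRes F L f)
  map_id U := by
    refine AddCommGrpCat.hom_ext (AddMonoidHom.ext fun φ => ?_)
    refine Subtype.ext (funext fun W => funext fun f => ?_)
    change φ.1 W (𝟙 U ≫ f) = φ.1 W f
    rw [Category.id_comp]
  map_comp g h := by
    refine AddCommGrpCat.hom_ext (AddMonoidHom.ext fun φ => ?_)
    refine Subtype.ext (funext fun W => funext fun f => ?_)
    change φ.1 W ((g ≫ h) ≫ f) = φ.1 W (g ≫ h ≫ f)
    rw [Category.assoc]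

noncomputable instance (F : RightModule B) (L : PresheafOfModules.{u} (strSheaf X).obj)
    (U : (Opens X)ᵒᵖ) : Module (B.obj.obj U) ((homAb F.mod L).obj U) :=
  homSecModule F L U

/-- The presheaf of left `B`-modules `Hom_{𝒪_X}(F, L)`, for a right `B`-module `F`. -/
noncomputable def homPre (F : RightModule B) (L : PresheafOfModules.{u} (strSheaf X).obj) :
    PresheafOfModules.{u} B.obj :=
  PresheafOfModules.ofPresheaf (homAb F.mod L) fun U U' h b φ => by
    refine Subtype.ext (funext fun W => funext fun f => LinearMap.ext fun x => ?_)
    change φ.1 W (h ≫ f) ((F.rmul W (B.obj.map (h ≫ f) b)).unop x) =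
      φ.1 W (h ≫ f) ((F.rmul W (B.obj.map f (B.obj.map h b))).unop x)
    simp

theorem homPre_isSheaf (F : RightModule B) (L : SheafOfModules.{u} (strSheaf X)) :
    Presheaf.IsSheaf (Opens.grothendieckTopology X) (homPre F L.val).presheaf := by
  refine (TopCat.Presheaf.isSheaf_iff_isSheafUniqueGluing (X := X.carrier) _).2 ?_
  intro ι U s hs
  let G : TopCat.Sheaf Ab X.carrier := ⟨L.val.presheaf, L.isSheaf⟩
  -- the value of `s k` on a section over a subset of `U k`
  have hres : ∀ (k l : ι) (W : (Opens X)ᵒᵖ) (hk : op (U k) ⟶ W) (hl : op (U l) ⟶ W)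
      (x : Sec F.mod W), (s k).1 W hk x = (s l).1 W hl x := fun k l W hk hl x => by
    have h := congrArg (fun φ : homSec F.mod L.val (op (U k ⊓ U l)) =>
      φ.1 W (homOfLE (le_inf hk.unop.le hl.unop.le)).op x) (hs k l)
    exact h
  have hcov : ∀ W : (Opens X)ᵒᵖ, (op (iSup U) ⟶ W) → W.unop ≤ ⨆ k, W.unop ⊓ U k :=
    fun W f => by rw [← inf_iSup_eq]; exact le_inf le_rfl f.unop.le
  let iW : ∀ (W : (Opens X)ᵒᵖ) (k : ι), W.unop ⊓ U k ⟶ W.unop := fun W k => homOfLE inf_le_left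
  let iU : ∀ (W : (Opens X)ᵒᵖ) (k : ι), W.unop ⊓ U k ⟶ U k := fun W k => homOfLE inf_le_right
  have hex : ∀ (W : (Opens X)ᵒᵖ) (_ : op (iSup U) ⟶ W) (x : Sec F.mod W),
      ∃! y : Sec L.val W, ∀ k, secRes L.val (iW W k).op y =
        (s k).1 (op (W.unop ⊓ U k)) (iU W k).op (secRes F.mod (iW W k).op x) := fun W f x => by
    refine G.existsUnique_gluing' (fun k => W.unop ⊓ U k) W.unop (iW W) (hcov W f) _ ?_
    intro k l
    have h1 := (s k).2 _ _ (iU W k).op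
      (Opens.infLELeft (W.unop ⊓ U k) (W.unop ⊓ U l)).op (secRes F.mod (iW W k).op x)
    have h2 := (s l).2 _ _ (iU W l).op
      (Opens.infLERight (W.unop ⊓ U k) (W.unop ⊓ U l)).op (secRes F.mod (iW W l).op x)
    refine h1.trans (Eq.trans ?_ h2.symm)
    rw [← secRes_comp, ← secRes_comp]
    exact hres k l _ _ _ _
  choose t ht ht' using hex
  have hadd : ∀ W f x x', t W f (x + x') = t W f x + t W f x' := fun W f x x' =>
    (ht' W f (x + x') _ fun k => by simp only [map_add, ht]).symm
  have hsmul : ∀ W f (r : X.presheaf.obj W) x, t W f (r • x) = r • t W f x := fun W f r x =>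
    (ht' W f (r • x) _ fun k => by simp only [map_smulₛₗ, RingHom.id_apply, ht]).symm
  let φ : homSec F.mod L.val (op (iSup U)) :=
    ⟨fun W f => { toFun := t W f, map_add' := hadd W f, map_smul' := hsmul W f },
      fun W W' f g x => by
        refine ht' W' (f ≫ g) (secRes F.mod g x) _ fun k => ?_
        have e : g ≫ (iW W' k).op = (iW W k).op ≫
          (homOfLE (inf_le_inf_right (U k) g.unop.le) : W'.unop ⊓ U k ⟶ W.unop ⊓ U k).op := rfl
        change secRes L.val (iW W' k).op (secRes L.val g (t W f x)) = _
        rw [← secRes_comp, ← secRes_comp, e, secRes_comp, secRes_comp, ht, (s k).2]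
        rfl⟩
  refine ⟨φ, fun k => ?_, fun ψ hψ => ?_⟩
  · refine Subtype.ext (funext fun W => funext fun f => LinearMap.ext fun x => ?_)
    change t W ((Opens.leSupr U k).op ≫ f) x = (s k).1 W f x
    refine (ht' W _ x _ fun l => ?_).symm
    rw [(s k).2]
    exact hres k l _ _ _ _
  · refine Subtype.ext (funext fun W => funext fun f => LinearMap.ext fun x => ?_)
    refine ht' W f x _ fun k => ?_
    have h := congrArg (fun φ : homSec F.mod L.val (op (U k)) =>
      φ.1 (op (W.unop ⊓ U k)) (iU W k).op (secRes F.mod (iW W k).op x)) (hψ k)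
    exact ((ψ.2 _ _ f (iW W k).op x).trans h)

/-- The sheaf of left `B`-modules `Hom_{𝒪_X}(F, L)`, for a right `B`-module `F` and an
`𝒪_X`-module `L`. Since `L` is a sheaf, `F` need only be a presheaf: replacing it by its
associated sheaf does not change the morphisms to `L`. -/
noncomputable def homSheaf (F : RightModule B) (L : OMod X) : SheafOfModules.{u} B :=
  ⟨homPre F L.val, homPre_isSheaf F L⟩

end Hom

section Tensor

/-- The presheaf tensor product `U ↦ N(U) ⊗ F(U)` of presheaves of `𝒪_X`-modules. -/
noncomputable abbrev tensorPre (N F : PresheafOfModules.{u} (strSheaf X).obj) :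
    PresheafOfModules.{u} (strSheaf X).obj :=
  PresheafOfModules.Monoidal.tensorObj (R := X.presheaf) N F

/-- The section `n ⊗ x` of the presheaf tensor product. -/
noncomputable def tensorMk (N F : PresheafOfModules.{u} (strSheaf X).obj) (U : (Opens X)ᵒᵖ) :
    Sec N U →ₗ[X.presheaf.obj U] Sec F U →ₗ[X.presheaf.obj U] Sec (tensorPre N F) U :=
  TensorProduct.mk (X.presheaf.obj U) (Sec N U) (Sec F U)

theorem tensorMk_res (N F : PresheafOfModules.{u} (strSheaf X).obj) {U W : (Opens X)ᵒᵖ}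
    (f : U ⟶ W) (n : Sec N U) (x : Sec F U) :
    secRes (tensorPre N F) f (tensorMk N F U n x) =
      tensorMk N F W (secRes N f n) (secRes F f x) := rfl

/-- The linear map on sections of the presheaf tensor product given by a bilinear map. -/
noncomputable def tensorLift {N F : PresheafOfModules.{u} (strSheaf X).obj} {U : (Opens X)ᵒᵖ}
    {P : Type u} [AddCommGroup P] [Module (X.presheaf.obj U) P]
    (β : Sec N U →ₗ[X.presheaf.obj U] Sec F U →ₗ[X.presheaf.obj U] P) :
    Sec (tensorPre N F) U →ₗ[X.presheaf.obj U] P :=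
  TensorProduct.lift (R := X.presheaf.obj U) (M := Sec N U) (N := Sec F U) β

theorem tensorLift_mk {N F : PresheafOfModules.{u} (strSheaf X).obj} {U : (Opens X)ᵒᵖ}
    {P : Type u} [AddCommGroup P] [Module (X.presheaf.obj U) P]
    (β : Sec N U →ₗ[X.presheaf.obj U] Sec F U →ₗ[X.presheaf.obj U] P) (n : Sec N U) (x : Sec F U) :
    tensorLift β (tensorMk N F U n x) = β n x := rfl

theorem tensor_induction {N F : PresheafOfModules.{u} (strSheaf X).obj} {U : (Opens X)ᵒᵖ}
    {p : Sec (tensorPre N F) U → Prop} (x : Sec (tensorPre N F) U) (zero : p 0)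
    (tmul : ∀ n y, p (tensorMk N F U n y)) (add : ∀ x y, p x → p y → p (x + y)) : p x :=
  TensorProduct.induction_on (motive := p) x zero tmul add

theorem tensor_ext {N F : PresheafOfModules.{u} (strSheaf X).obj} {U : (Opens X)ᵒᵖ}
    {P : Type u} [AddCommGroup P] [Module (X.presheaf.obj U) P]
    {f g : Sec (tensorPre N F) U →ₗ[X.presheaf.obj U] P}
    (h : ∀ n x, f (tensorMk N F U n x) = g (tensorMk N F U n x)) : f = g :=
  TensorProduct.ext' (R := X.presheaf.obj U) (M := Sec N U) (N := Sec F U) h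

/-- The morphism of presheaves out of a presheaf tensor product given by compatible bilinear
maps. -/
noncomputable def tensorPreDesc {N F L : PresheafOfModules.{u} (strSheaf X).obj}
    (β : ∀ U, Sec N U →ₗ[X.presheaf.obj U] Sec F U →ₗ[X.presheaf.obj U] Sec L U)
    (hβ : ∀ ⦃U W : (Opens X)ᵒᵖ⦄ (f : U ⟶ W) (n : Sec N U) (x : Sec F U),
      secRes L f (β U n x) = β W (secRes N f n) (secRes F f x)) : tensorPre N F ⟶ L :=
  PresheafOfModules.homMk
    { app U := AddCommGrpCat.ofHom (tensorLift (β U)).toAddMonoidHom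
      naturality U W f := by
        refine AddCommGrpCat.hom_ext (AddMonoidHom.ext fun x => ?_)
        change tensorLift (β W) (secRes (tensorPre N F) f x) = secRes L f (tensorLift (β U) x)
        induction x using tensor_induction with
        | zero => simp
        | add x y hx hy => rw [map_add, map_add, map_add, map_add, hx, hy]
        | tmul n x => rw [tensorMk_res, tensorLift_mk, tensorLift_mk, hβ] }
    (fun U r x => map_smul (tensorLift (β U)) r x)

/-- The tensor product `N ⊗_{𝒪_X} F` of `𝒪_X`-modules: the sheaf associated to the presheaf
tensor product. -/
noncomputable def tensorSheaf (N F : OMod X) : OMod X :=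
  (PresheafOfModules.sheafification (𝟙 (strSheaf X).obj)).obj (tensorPre N.val F.val)

/-- The morphism `1 ⊗ f : N ⊗ F → N ⊗ F'`. -/
noncomputable def tensorSheafMap (N : OMod X) {F F' : OMod X} (f : F ⟶ F') :
    tensorSheaf N F ⟶ tensorSheaf N F' :=
  (PresheafOfModules.sheafification (𝟙 (strSheaf X).obj)).map
    (PresheafOfModules.Monoidal.tensorHom (R := X.presheaf) (𝟙 N.val) f.val)

/-- The morphism out of the tensor product of sheaves given by a morphism out of the presheaf
tensor product. -/
noncomputable def tensorSheafDesc {N F L : OMod X} (g : tensorPre N.val F.val ⟶ L.val) :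
    tensorSheaf N F ⟶ L :=
  (PresheafOfModules.sheafificationHomEquiv (𝟙 (strSheaf X).obj)).symm g

/-- The morphism `g` out of the tensor product of sheaves, composed with the canonical morphism
from the presheaf tensor product. -/
noncomputable def tensorSheafRes {N F L : OMod X} (g : tensorSheaf N F ⟶ L) :
    tensorPre N.val F.val ⟶ L.val :=
  (PresheafOfModules.sheafificationHomEquiv (𝟙 (strSheaf X).obj)) g

end Tensor

section HomMaps

variable {B : Sheaf (Opens.grothendieckTopology X) RingCat.{u}}

/-- A morphism of sheaves of `B`-modules `Hom(F, L) → Hom(F', L')` given by an operation on linear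
maps of sections that respects restrictions and right multiplication. -/
noncomputable def homSheafMk {F F' : RightModule B} {L L' : OMod X}
    (t : ∀ W : (Opens X)ᵒᵖ, (Sec F.mod W →ₗ[X.presheaf.obj W] Sec L.val W) →+
      (Sec F'.mod W →ₗ[X.presheaf.obj W] Sec L'.val W))
    (res : ∀ ⦃W W' : (Opens X)ᵒᵖ⦄ (g : W ⟶ W') (α : Sec F.mod W →ₗ[X.presheaf.obj W] Sec L.val W)
      (α' : Sec F.mod W' →ₗ[X.presheaf.obj W'] Sec L.val W'),
      (∀ x, secRes L.val g (α x) = α' (secRes F.mod g x)) →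
      ∀ x, secRes L'.val g (t W α x) = t W' α' (secRes F'.mod g x))
    (mul : ∀ (W : (Opens X)ᵒᵖ) (α : Sec F.mod W →ₗ[X.presheaf.obj W] Sec L.val W)
      (b : B.obj.obj W), t W (α ∘ₗ (F.rmul W b).unop) = t W α ∘ₗ (F'.rmul W b).unop) :
    homSheaf F L ⟶ homSheaf F' L' where
  val := PresheafOfModules.homMk (M₁ := homPre F L.val) (M₂ := homPre F' L'.val)
    { app U := AddCommGrpCat.ofHom
        { toFun := fun φ : homSec F.mod L.val U =>
            (⟨fun W f => t W (φ.1 W f), fun W W' f g x => res g _ _ (φ.2 W W' f g) x⟩ :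
              homSec F'.mod L'.val U)
          map_zero' := Subtype.ext (funext fun W => funext fun _ => map_zero (t W))
          map_add' := fun φ ψ => Subtype.ext (funext fun W => funext fun f =>
            map_add (t W) (φ.1 W f) (ψ.1 W f)) }
      naturality _ _ _ := rfl }
    (fun U b (φ : homSec F.mod L.val U) => Subtype.ext (funext fun W => funext fun f =>
      mul W (φ.1 W f) (B.obj.map f b)))

/-- The linear map on sections over `U` given by a morphism of presheaves of `𝒪_X`-modules. -/
noncomputable def secMap {L L' : PresheafOfModules.{u} (strSheaf X).obj} (f : L ⟶ L')
    (U : (Opens X)ᵒᵖ) : Sec L U →ₗ[X.presheaf.obj U] Sec L' U :=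
  (f.app U).hom

theorem secMap_res {L L' : PresheafOfModules.{u} (strSheaf X).obj} (f : L ⟶ L')
    {U W : (Opens X)ᵒᵖ} (g : U ⟶ W) (x : Sec L U) :
    secRes L' g (secMap f U x) = secMap f W (secRes L g x) :=
  (PresheafOfModules.naturality_apply f g x).symm

/-- The morphism `Hom(F, L) → Hom(F, L')`, `α ↦ f ∘ α`, given by a morphism `f : L → L'`. -/
noncomputable def homMap (F : RightModule B) {L L' : OMod X} (f : L ⟶ L') :
    homSheaf F L ⟶ homSheaf F L' :=
  homSheafMk
    (fun W => (LinearMap.compRight (X.presheaf.obj W) (secMap f.val W)).toAddMonoidHom)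
    (fun W W' g α α' h x => by
      change secRes L'.val g (secMap f.val W (α x)) = secMap f.val W' (α' (secRes F.mod g x))
      rw [← h, secMap_res])
    (fun _ _ _ => rfl)

/-- The right `B`-module `N ⊗ F` for an `𝒪_X`-module `N` and a right `B`-module `F`, with
`(n ⊗ x) b = n ⊗ x b`. -/
noncomputable def tensorRight (N : OMod X) (F : RightModule B) : RightModule B where
  mod := tensorPre N.val F.mod
  rmul U :=
    { toFun := fun b => MulOpposite.op
        (tensorLift ((tensorMk N.val F.mod U).compl₂ (F.rmul U b).unop))
      map_one' := congrArg MulOpposite.op (tensor_ext fun n x => by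
        rw [tensorLift_mk, map_one]; rfl)
      map_mul' := fun b b' => congrArg MulOpposite.op (tensor_ext fun n x => by
        rw [tensorLift_mk, map_mul]; rfl)
      map_zero' := congrArg MulOpposite.op (tensor_ext fun n x => by
        rw [tensorLift_mk, map_zero]; exact map_zero (tensorMk N.val F.mod U n))
      map_add' := fun b b' => congrArg MulOpposite.op (tensor_ext fun n x => by
        rw [tensorLift_mk, map_add]; exact map_add (tensorMk N.val F.mod U n) _ _) }
  res_rmul {U W} f b x := by
    change secRes (tensorPre N.val F.mod) f
        (tensorLift ((tensorMk N.val F.mod U).compl₂ (F.rmul U b).unop) x) =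
      tensorLift ((tensorMk N.val F.mod W).compl₂ (F.rmul W (B.obj.map f b)).unop)
        (secRes (tensorPre N.val F.mod) f x)
    induction x using tensor_induction with
    | zero => simp
    | add x y hx hy => simp only [map_add, hx, hy]
    | tmul n x =>
      rw [tensorMk_res, tensorLift_mk, tensorLift_mk]
      simp only [LinearMap.compl₂_apply]
      rw [tensorMk_res, F.res_rmul]

theorem tensorRight_rmul_mk (N : OMod X) (F : RightModule B) (U : (Opens X)ᵒᵖ) (b : B.obj.obj U)
    (n : Sec N.val U) (x : Sec F.mod U) :
    ((tensorRight N F).rmul U b).unop (tensorMk N.val F.mod U n x) =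
      tensorMk N.val F.mod U n ((F.rmul U b).unop x) := rfl

/-- The linear map `g ∘ (1 ⊗ α)` on the sections over one open set, for a linear map `α` and a
morphism `g` out of a tensor product. -/
noncomputable def tensorCompSec {N : OMod X} {F : PresheafOfModules.{u} (strSheaf X).obj}
    {L L' : OMod X} (g : tensorSheaf N L ⟶ L') (W : (Opens X)ᵒᵖ) :
    (Sec F W →ₗ[X.presheaf.obj W] Sec L.val W) →+
      (Sec (tensorPre N.val F) W →ₗ[X.presheaf.obj W] Sec L'.val W) where
  toFun α := secMap (tensorSheafRes g) W ∘ₗ tensorLift ((tensorMk N.val L.val W).compl₂ α)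
  map_zero' := tensor_ext fun n x => by
    rw [LinearMap.comp_apply, tensorLift_mk]
    simp
  map_add' α α' := tensor_ext fun n x => by
    simp only [LinearMap.comp_apply, LinearMap.add_apply, tensorLift_mk, LinearMap.compl₂_apply,
      map_add]

theorem tensorCompSec_mk {N : OMod X} {F : PresheafOfModules.{u} (strSheaf X).obj}
    {L L' : OMod X} (g : tensorSheaf N L ⟶ L') (W : (Opens X)ᵒᵖ)
    (α : Sec F W →ₗ[X.presheaf.obj W] Sec L.val W) (n : Sec N.val W) (x : Sec F W) :
    tensorCompSec g W α (tensorMk N.val F W n x) =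
      secMap (tensorSheafRes g) W (tensorMk N.val L.val W n (α x)) := rfl

/-- The morphism `Hom(F, L) → Hom(N ⊗ F, L')`, `α ↦ g ∘ (1 ⊗ α)`, given by a morphism
`g : N ⊗ L → L'`. -/
noncomputable def homTensor (F : RightModule B) {N L L' : OMod X} (g : tensorSheaf N L ⟶ L') :
    homSheaf F L ⟶ homSheaf (tensorRight N F) L' :=
  homSheafMk (tensorCompSec g)
    (fun W W' f α α' h x => by
      change secRes L'.val f (tensorCompSec g W α x) =
        tensorCompSec g W' α' (secRes (tensorPre N.val F.mod) f x)
      change Sec (tensorPre N.val F.mod) W at x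
      induction x using tensor_induction with
      | zero => simp
      | add x y hx hy => simp only [map_add, hx, hy]
      | tmul n x => rw [tensorMk_res, tensorCompSec_mk, tensorCompSec_mk, secMap_res,
          tensorMk_res, h])
    (fun W α b => tensor_ext fun n x => rfl)

/-- The morphism `Hom(F, L) → Hom(F', L)`, `α ↦ α ∘ μ`, given by a morphism `μ : F' → F` of right
`B`-modules. -/
noncomputable def homPrecomp {F F' : RightModule B} (μ : F'.mod ⟶ F.mod)
    (hμ : ∀ (U : (Opens X)ᵒᵖ) (b : B.obj.obj U) (x : Sec F'.mod U),
      secMap μ U ((F'.rmul U b).unop x) = (F.rmul U b).unop (secMap μ U x)) (L : OMod X) :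
    homSheaf F L ⟶ homSheaf F' L :=
  homSheafMk
    (fun W => (LinearMap.lcomp (X.presheaf.obj W) (Sec L.val W) (secMap μ W)).toAddMonoidHom)
    (fun W W' g α α' h x => by
      change secRes L.val g (α (secMap μ W x)) = α' (secMap μ W' (secRes F'.mod g x))
      rw [h, secMap_res])
    (fun W α b => LinearMap.ext fun x => by
      change α ((F.rmul W b).unop (secMap μ W x)) = α (secMap μ W ((F'.rmul W b).unop x))
      rw [hμ])

end HomMaps

section Vertex

/-- The section of `e_i V` given by a section `v` of `V` with `e_i v = v`. -/
def vertexMk {V : PresheafOfModules.{u} (pathSheaf M).obj} {i : Q} {U : (Opens X)ᵒᵖ}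
    (v : V.obj U) (hv : IsAtVertex V i v) : Sec (vertexPre V i) U := ⟨v, hv⟩

/-- The section of `V` underlying a section of `e_i V`. -/
def vertexVal {V : PresheafOfModules.{u} (pathSheaf M).obj} {i : Q} {U : (Opens X)ᵒᵖ} :
    Sec (vertexPre V i) U →+ V.obj U where
  toFun v := v.1
  map_zero' := rfl
  map_add' _ _ := rfl

theorem vertexVal_mk {V : PresheafOfModules.{u} (pathSheaf M).obj} {i : Q} {U : (Opens X)ᵒᵖ}
    (v : V.obj U) (hv : IsAtVertex V i v) : vertexVal (vertexMk v hv) = v := rfl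

theorem vertexVal_smul {V : PresheafOfModules.{u} (pathSheaf M).obj} {i : Q} {U : (Opens X)ᵒᵖ}
    (r : X.presheaf.obj U) (v : Sec (vertexPre V i) U) :
    vertexVal (r • v) = secScalar M U r • vertexVal v := rfl

theorem vertexVal_res {V : PresheafOfModules.{u} (pathSheaf M).obj} {i : Q} {U W : (Opens X)ᵒᵖ}
    (f : U ⟶ W) (v : Sec (vertexPre V i) U) :
    vertexVal (secRes (vertexPre V i) f v) = V.map f (vertexVal v) := rfl

theorem vertexVal_injective {V : PresheafOfModules.{u} (pathSheaf M).obj} {i : Q}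
    {U : (Opens X)ᵒᵖ} :
    Function.Injective (vertexVal : Sec (vertexPre V i) U →+ V.obj U) := Subtype.val_injective

theorem vertexVal_prop {V : PresheafOfModules.{u} (pathSheaf M).obj} {i : Q} {U : (Opens X)ᵒᵖ}
    (v : Sec (vertexPre V i) U) : IsAtVertex V i (vertexVal v) := v.2

theorem map_smul_res (V : PresheafOfModules.{u} (pathSheaf M).obj) {U W : (Opens X)ᵒᵖ}
    (f : U ⟶ W) (b : (pathSheaf M).obj.obj U) (v : V.obj U) :
    (show V.obj W from V.map f (b • v)) =
      (pathSheaf M).obj.map f b • (show V.obj W from V.map f v) :=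
  V.map_smul f b v

variable (M) in
/-- The sheaf of rings `B`, as a left module over itself. -/
noncomputable abbrev leftB : PresheafOfModules.{u} (pathSheaf M).obj :=
  PresheafOfModules.unit (pathSheaf M).obj

/-- The section of `B` underlying a section of `e_i B`. -/
noncomputable def ringVal {i : Q} {U : (Opens X)ᵒᵖ} :
    Sec (vertexPre (leftB M) i) U →+ (pathSheaf M).obj.obj U where
  toFun x := vertexVal x
  map_zero' := rfl
  map_add' _ _ := rfl

theorem ringVal_injective {i : Q} {U : (Opens X)ᵒᵖ} :
    Function.Injective (ringVal : Sec (vertexPre (leftB M) i) U →+ (pathSheaf M).obj.obj U) :=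
  vertexVal_injective

theorem secVertex_mul_ringVal {i : Q} {U : (Opens X)ᵒᵖ} (x : Sec (vertexPre (leftB M) i) U) :
    secVertex M i U * ringVal x = ringVal x := vertexVal_prop x

theorem ringVal_smul {i : Q} {U : (Opens X)ᵒᵖ} (r : X.presheaf.obj U)
    (x : Sec (vertexPre (leftB M) i) U) :
    ringVal (r • x) = secScalar M U r * ringVal x := rfl

theorem ringVal_res {i : Q} {U W : (Opens X)ᵒᵖ} (f : U ⟶ W)
    (x : Sec (vertexPre (leftB M) i) U) :
    ringVal (secRes (vertexPre (leftB M) i) f x) = (pathSheaf M).obj.map f (ringVal x) := rfl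

/-- Right multiplication by a section `b` of `B` on the sections of `e_i B`. -/
noncomputable def rightMul (i : Q) {U : (Opens X)ᵒᵖ} (b : (pathSheaf M).obj.obj U) :
    Module.End (X.presheaf.obj U) (Sec (vertexPre (leftB M) i) U) where
  toFun x := vertexMk (V := leftB M) (ringVal x * b)
    ((mul_assoc (secVertex M i U) (ringVal x) b).symm.trans (by rw [secVertex_mul_ringVal]))
  map_add' x y := ringVal_injective (add_mul (ringVal x) (ringVal y) b)
  map_smul' r x := ringVal_injective (mul_assoc (secScalar M U r) (ringVal x) b)

theorem ringVal_rightMul (i : Q) {U : (Opens X)ᵒᵖ} (b : (pathSheaf M).obj.obj U)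
    (x : Sec (vertexPre (leftB M) i) U) : ringVal (rightMul i b x) = ringVal x * b := rfl

/-- The bilinear map `(m, v) ↦ m v` from `M_a` and `e_i V` to `e_j V`, for `a : i → j`. -/
noncomputable def arrowBilin (V : PresheafOfModules.{u} (pathSheaf M).obj) {i j : Q} (a : i ⟶ j)
    (U : (Opens X)ᵒᵖ) :
    Sec (M a).val U →ₗ[X.presheaf.obj U] Sec (vertexPre V i) U →ₗ[X.presheaf.obj U]
      Sec (vertexPre V j) U :=
  LinearMap.mk₂ _ (fun m v => vertexMk (secArrow M a U m • vertexVal v) (.arrow_smul a m _))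
    (fun m m' v => vertexVal_injective (by
      simp only [map_add, vertexVal_mk, secArrow_add, add_smul]))
    (fun r m v => vertexVal_injective (by
      simp only [vertexVal_smul, vertexVal_mk, secArrow_smul, mul_smul]))
    (fun m v v' => vertexVal_injective (by
      simp only [map_add, vertexVal_mk, smul_add]))
    (fun r m v => vertexVal_injective (by
      simp only [vertexVal_smul, vertexVal_mk, smul_smul, secArrow_mul_scalar]))

theorem vertexVal_arrowBilin (V : PresheafOfModules.{u} (pathSheaf M).obj) {i j : Q} (a : i ⟶ j)
    (U : (Opens X)ᵒᵖ) (m : Sec (M a).val U) (v : Sec (vertexPre V i) U) :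
    vertexVal (arrowBilin V a U m v) = secArrow M a U m • vertexVal v := rfl

/-- The morphism `m ⊗ v ↦ m v` from the presheaf tensor product of `M_a` and `e_i V` to `e_j V`,
for `a : i → j`. For `V = B` this is the multiplication map `μ_a`. -/
noncomputable def arrowPre (V : PresheafOfModules.{u} (pathSheaf M).obj) {i j : Q} (a : i ⟶ j) :
    tensorPre (M a).val (vertexPre V i) ⟶ vertexPre V j :=
  tensorPreDesc (arrowBilin V a) fun _ W f m v => vertexVal_injective (by
    rw [vertexVal_res, vertexVal_arrowBilin, vertexVal_arrowBilin]
    refine (map_smul_res V f _ _).trans ?_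
    rw [vertexVal_res]
    exact congrArg (fun b : (pathSheaf M).obj.obj W => b • (show V.obj W from V.map f (vertexVal v)))
      (secArrow_res a f m))

theorem arrowPre_mk (V : PresheafOfModules.{u} (pathSheaf M).obj) {i j : Q} (a : i ⟶ j)
    (U : (Opens X)ᵒᵖ) (m : Sec (M a).val U) (v : Sec (vertexPre V i) U) :
    secMap (arrowPre V a) U (tensorMk _ _ U m v) = arrowBilin V a U m v := rfl

/-- The structure map `φ_a : M_a ⊗ V_i → V_j`, `m ⊗ v ↦ m v`, of a `B`-module `V`,
for `a : i → j`. -/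
noncomputable def arrowMap (V : SheafOfModules.{u} (pathSheaf M)) {i j : Q} (a : i ⟶ j) :
    tensorSheaf (M a) (vertexSheaf V i) ⟶ vertexSheaf V j :=
  tensorSheafDesc (arrowPre V.val a)

variable (M) in
/-- The right `B`-module `e_i B`. -/
noncomputable def vertexRight (i : Q) : RightModule (pathSheaf M) where
  mod := vertexPre (leftB M) i
  rmul _ :=
    { toFun := fun b => MulOpposite.op (rightMul i b)
      map_one' := congrArg MulOpposite.op (LinearMap.ext fun x => ringVal_injective
        (mul_one (ringVal x)))
      map_mul' := fun b b' => congrArg MulOpposite.op (LinearMap.ext fun x => ringVal_injective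
        (mul_assoc (ringVal x) b b').symm)
      map_zero' := congrArg MulOpposite.op (LinearMap.ext fun x => ringVal_injective
        (mul_zero (ringVal x)))
      map_add' := fun b b' => congrArg MulOpposite.op (LinearMap.ext fun x => ringVal_injective
        (mul_add (ringVal x) b b')) }
  res_rmul f b x := ringVal_injective
    (map_mul ((pathSheaf M).obj.map f).hom (ringVal x) b)

variable (M) in
/-- The right `B`-module `M_a ⊗ e_i B`, for `a : i → j`. -/
noncomputable abbrev arrowRight {i j : Q} (a : i ⟶ j) : RightModule (pathSheaf M) :=
  tensorRight (M a) (vertexRight M i)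

/-- The morphism `Hom(e_j B, L) → Hom(M_a ⊗ e_i B, L)`, `α ↦ α ∘ μ_a`, for `a : i → j`. -/
noncomputable def homMul {i j : Q} (a : i ⟶ j) (L : OMod X) :
    homSheaf (vertexRight M j) L ⟶ homSheaf (arrowRight M a) L :=
  homPrecomp (F := vertexRight M j) (F' := arrowRight M a) (arrowPre (leftB M) a)
    (fun U b x => by
      change Sec (tensorPre (M a).val (vertexPre (leftB M) i)) U at x
      change secMap (arrowPre (leftB M) a) U (tensorLift
        ((tensorMk (M a).val (vertexPre (leftB M) i) U).compl₂ (rightMul i b)) x) =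
          rightMul j b (secMap (arrowPre (leftB M) a) U x)
      induction x using tensor_induction with
      | zero => simp
      | add x y hx hy => simp only [map_add, hx, hy]
      | tmul m x =>
        exact ringVal_injective
          (mul_assoc (secArrow M a U m) (ringVal x) b).symm) L

/-- The linear map `e_i B(W) → e_i V(W)`, `x ↦ x v`, for a section `v` of `V` over `W`. -/
noncomputable def smulSec (V : PresheafOfModules.{u} (pathSheaf M).obj) (i : Q) {W : (Opens X)ᵒᵖ}
    (v : V.obj W) :
    Sec (vertexPre (leftB M) i) W →ₗ[X.presheaf.obj W] Sec (vertexPre V i) W where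
  toFun x := vertexMk (ringVal x • v) (by rw [IsAtVertex, smul_smul, secVertex_mul_ringVal])
  map_add' x y := vertexVal_injective (by
    simp only [map_add, vertexVal_mk, add_smul])
  map_smul' r x := vertexVal_injective (by
    simp only [RingHom.id_apply, ringVal_smul, vertexVal_mk, vertexVal_smul, mul_smul])

theorem vertexVal_smulSec (V : PresheafOfModules.{u} (pathSheaf M).obj) (i : Q)
    {W : (Opens X)ᵒᵖ} (v : V.obj W) (x : Sec (vertexPre (leftB M) i) W) :
    vertexVal (smulSec V i v x) = ringVal x • v := rfl

theorem smulSec_res (V : PresheafOfModules.{u} (pathSheaf M).obj) (i : Q)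
    {W W' : (Opens X)ᵒᵖ} (g : W ⟶ W') (v : V.obj W) (x : Sec (vertexPre (leftB M) i) W) :
    secRes (vertexPre V i) g (smulSec V i v x) =
      smulSec V i (show V.obj W' from V.map g v) (secRes (vertexPre (leftB M) i) g x) :=
  vertexVal_injective (map_smul_res V g _ _)

theorem smulSec_add (V : PresheafOfModules.{u} (pathSheaf M).obj) (i : Q)
    {W : (Opens X)ᵒᵖ} (v w : V.obj W) : smulSec V i (v + w) = smulSec V i v + smulSec V i w :=
  LinearMap.ext fun _ => vertexVal_injective (by
    simp only [LinearMap.add_apply, map_add, vertexVal_smulSec, smul_add])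

theorem smulSec_smul (V : PresheafOfModules.{u} (pathSheaf M).obj) (i : Q)
    {W : (Opens X)ᵒᵖ} (b : (pathSheaf M).obj.obj W) (v : V.obj W) :
    smulSec V i (b • v) = smulSec V i v ∘ₗ rightMul i b :=
  LinearMap.ext fun _ => vertexVal_injective (by
    simp only [LinearMap.comp_apply, vertexVal_smulSec, ringVal_rightMul, mul_smul])

/-- Restriction of sections of a `B`-module. -/
noncomputable def modRes (V : PresheafOfModules.{u} (pathSheaf M).obj) {U W : (Opens X)ᵒᵖ}
    (f : U ⟶ W) : V.obj U →+ V.obj W :=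
  (V.presheaf.map f).hom

theorem modRes_comp (V : PresheafOfModules.{u} (pathSheaf M).obj) {U W W' : (Opens X)ᵒᵖ}
    (f : U ⟶ W) (g : W ⟶ W') (v : V.obj U) : modRes V (f ≫ g) v = modRes V g (modRes V f v) :=
  ConcreteCategory.congr_hom (V.presheaf.map_comp f g) v

/-- The section `x ↦ x v` of `Hom(e_i B, V_i)` given by a section `v` of `V`. -/
noncomputable def epsSec (V : SheafOfModules.{u} (pathSheaf M)) (i : Q) {U : (Opens X)ᵒᵖ}
    (v : V.val.obj U) : homSec (vertexPre (leftB M) i) (vertexPre V.val i) U :=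
  ⟨fun _ f => smulSec V.val i (modRes V.val f v), fun W W' f g x => by
    change secRes (vertexPre V.val i) g (smulSec V.val i (modRes V.val f v) x) =
      smulSec V.val i (modRes V.val (f ≫ g) v) (secRes (vertexPre (leftB M) i) g x)
    rw [modRes_comp]
    exact smulSec_res V.val i g _ x⟩

/-- The component `V → Hom(e_i B, V_i)`, `v ↦ (x ↦ x v)`, of the morphism `ε`. -/
noncomputable def epsMap (V : SheafOfModules.{u} (pathSheaf M)) (i : Q) :
    V ⟶ homSheaf (vertexRight M i) (vertexSheaf V i) where
  val := PresheafOfModules.homMk (M₁ := V.val)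
    (M₂ := homPre (vertexRight M i) (vertexSheaf V i).val)
    { app U := AddCommGrpCat.ofHom (AddMonoidHom.mk' (epsSec V i (U := U)) fun v w =>
        Subtype.ext (funext fun _ => funext fun f =>
          (congrArg (smulSec V.val i) (map_add (modRes V.val f) v w)).trans (smulSec_add _ _ _ _)))
      naturality _ _ h := AddCommGrpCat.hom_ext (AddMonoidHom.ext fun v => Subtype.ext
        (funext fun _ => funext fun f => congrArg (smulSec V.val i)
          (modRes_comp V.val h f v).symm)) }
    (fun _ b v => Subtype.ext (funext fun _ => funext fun f =>
      (congrArg (smulSec V.val i) (map_smul_res V.val f b v)).trans (smulSec_smul _ _ _ _)))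

end Vertex

section Naturality

theorem tensorSheafRes_comp {N F L L' : OMod X} (g : tensorSheaf N F ⟶ L) (f : L ⟶ L') :
    tensorSheafRes (g ≫ f) = tensorSheafRes g ≫ f.val :=
  (PresheafOfModules.sheafificationAdjunction (𝟙 (strSheaf X).obj)).homEquiv_naturality_right g f

theorem tensorSheafRes_map_comp (N : OMod X) {F F' L : OMod X} (f : F ⟶ F')
    (g : tensorSheaf N F' ⟶ L) :
    tensorSheafRes (tensorSheafMap N f ≫ g) =
      PresheafOfModules.Monoidal.tensorHom (R := X.presheaf) (𝟙 N.val) f.val ≫ tensorSheafRes g :=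
  (PresheafOfModules.sheafificationAdjunction (𝟙 (strSheaf X).obj)).homEquiv_naturality_left _ g

theorem tensorSheafRes_desc {N F L : OMod X} (g : tensorPre N.val F.val ⟶ L.val) :
    tensorSheafRes (tensorSheafDesc g) = g :=
  (PresheafOfModules.sheafificationHomEquiv (𝟙 (strSheaf X).obj)).apply_symm_apply g

variable {B : Sheaf (Opens.grothendieckTopology X) RingCat.{u}}

/-- The value of a morphism of sheaves of modules on a section. -/
noncomputable def secApp {V W : SheafOfModules.{u} B} (k : V ⟶ W) (U : (Opens X)ᵒᵖ) :
    V.val.obj U →+ W.val.obj U :=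
  (k.val.app U).hom.toAddMonoidHom

theorem secApp_ext {V W : SheafOfModules.{u} B} {k k' : V ⟶ W}
    (h : ∀ U v, secApp k U v = secApp k' U v) : k = k' := by
  refine SheafOfModules.hom_ext (PresheafOfModules.hom_ext fun U => ModuleCat.hom_ext ?_)
  exact LinearMap.ext (h U)

theorem toHomSheaf_ext {V : SheafOfModules.{u} B} {F : RightModule B} {L : OMod X}
    {k k' : V ⟶ homSheaf F L}
    (h : ∀ U v W (f : U ⟶ W) x, (show homSec F.mod L.val U from secApp k U v).1 W f x =
      (show homSec F.mod L.val U from secApp k' U v).1 W f x) : k = k' :=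
  secApp_ext fun U v => Subtype.ext (funext fun W => funext fun f => LinearMap.ext (h U v W f))

theorem homMap_comp (F : RightModule B) {L L' L'' : OMod X} (f : L ⟶ L') (g : L' ⟶ L'') :
    homMap F (f ≫ g) = homMap F f ≫ homMap F g :=
  toHomSheaf_ext fun _ _ _ _ _ => rfl

theorem homMap_zero (F : RightModule B) (L L' : OMod X) : homMap F (0 : L ⟶ L') = 0 :=
  toHomSheaf_ext fun _ _ _ _ _ => rfl

theorem homMul_homMap {i j : Q} (a : i ⟶ j) {L L' : OMod X} (f : L ⟶ L') :
    homMul (M := M) a L ≫ homMap (arrowRight M a) f =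
      homMap (vertexRight M j) f ≫ homMul a L' :=
  toHomSheaf_ext fun _ _ _ _ _ => rfl

theorem homTensor_homMap (F : RightModule B) {N L L' L'' : OMod X} (g : tensorSheaf N L ⟶ L')
    (f : L' ⟶ L'') : homTensor F g ≫ homMap (tensorRight N F) f = homTensor F (g ≫ f) :=
  toHomSheaf_ext fun U φ W h x => by
    change secMap f.val W (tensorCompSec g W ((show homSec F.mod L.val U from φ).1 W h) x) =
      tensorCompSec (g ≫ f) W ((show homSec F.mod L.val U from φ).1 W h) x
    change Sec (tensorPre N.val F.mod) W at x
    induction x using tensor_induction with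
    | zero => simp
    | add x y hx hy => simp only [map_add, hx, hy]
    | tmul n x =>
      rw [tensorCompSec_mk, tensorCompSec_mk, tensorSheafRes_comp]
      rfl

theorem homMap_homTensor (F : RightModule B) {N L L' L'' : OMod X} (f : L ⟶ L')
    (g : tensorSheaf N L' ⟶ L'') :
    homMap F f ≫ homTensor F g = homTensor F (tensorSheafMap N f ≫ g) :=
  toHomSheaf_ext fun U φ W h x => by
    change tensorCompSec g W (secMap f.val W ∘ₗ (show homSec F.mod L.val U from φ).1 W h) x =
      tensorCompSec (tensorSheafMap N f ≫ g) W ((show homSec F.mod L.val U from φ).1 W h) x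
    change Sec (tensorPre N.val F.mod) W at x
    induction x using tensor_induction with
    | zero => simp
    | add x y hx hy => simp only [map_add, hx, hy]
    | tmul n x =>
      rw [tensorCompSec_mk, tensorCompSec_mk, tensorSheafRes_map_comp]
      rfl

theorem arrowMap_smulSec (V : SheafOfModules.{u} (pathSheaf M)) {i j : Q} (a : i ⟶ j)
    (W : (Opens X)ᵒᵖ) (w : V.val.obj W) :
    (smulSec V.val j w) ∘ₗ secMap (arrowPre (leftB M) a) W =
      tensorCompSec (L := vertexSheaf V i) (L' := vertexSheaf V j) (arrowMap V a) W
        (smulSec V.val i w) :=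
  tensor_ext fun n x => by
    refine Eq.trans ?_ (tensorCompSec_mk (L := vertexSheaf V i) (L' := vertexSheaf V j)
      (arrowMap V a) W (smulSec V.val i w) n x).symm
    refine Eq.trans ?_ (congrArg (fun g => secMap g W (tensorMk (M a).val (vertexPre V.val i) W n
      (smulSec V.val i w x))) (tensorSheafRes_desc (N := M a) (F := vertexSheaf V i)
        (L := vertexSheaf V j) (arrowPre V.val a))).symm
    exact vertexVal_injective (mul_smul (secArrow M a W n) (ringVal x) w)

theorem epsMap_homMul (V : SheafOfModules.{u} (pathSheaf M)) {i j : Q} (a : i ⟶ j) :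
    epsMap V j ≫ homMul a (vertexSheaf V j) =
      epsMap V i ≫ homTensor (vertexRight M i) (arrowMap V a) :=
  toHomSheaf_ext fun _ v W h x =>
    LinearMap.congr_fun (arrowMap_smulSec V a W (modRes V.val h v)) x

end Naturality

instance hasFiniteBiproducts_sheafOfModules {B : Sheaf (Opens.grothendieckTopology X) RingCat.{u}} :
    HasFiniteBiproducts (SheafOfModules.{u} B) :=
  HasFiniteBiproducts.of_hasFiniteProducts

section Resolution

variable [Finite Q] [∀ i j : Q, Finite (i ⟶ j)]

variable (Q) in
/-- The arrows of a quiver. -/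
abbrev Arrows : Type u := Σ i j : Q, (i ⟶ j)

/-- Injective resolutions `V_i → V_i^•` of the `𝒪_X`-modules `V_i` of a `B`-module `V`. -/
abbrev VertexResolutions (V : SheafOfModules.{u} (pathSheaf M)) :=
  ∀ i : Q, InjectiveResolution (vertexSheaf V i)

/-- The `𝒪_X`-module `V_i^q`. -/
noncomputable abbrev VertexResolutions.obj {V : SheafOfModules.{u} (pathSheaf M)}
    (J : VertexResolutions V) (i : Q) (q : ℕ) : OMod X :=
  (J i).cocomplex.X q

/-- The differential `δ : V_i^q → V_i^{q+1}`. -/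
noncomputable abbrev VertexResolutions.δ {V : SheafOfModules.{u} (pathSheaf M)}
    (J : VertexResolutions V) (i : Q) (q : ℕ) : J.obj i q ⟶ J.obj i (q + 1) :=
  (J i).cocomplex.d q (q + 1)

/-- The augmentation `V_i → V_i^0`. -/
noncomputable abbrev VertexResolutions.aug {V : SheafOfModules.{u} (pathSheaf M)}
    (J : VertexResolutions V) (i : Q) : vertexSheaf V i ⟶ J.obj i 0 :=
  (J i).ι.f 0

/-- Chain maps `φ_a^• : M_a ⊗ V_i^• → V_j^•`, for `a : i → j`, lifting the structure maps
`φ_a : M_a ⊗ V_i → V_j` of a `B`-module `V`. -/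
structure ArrowLifts {V : SheafOfModules.{u} (pathSheaf M)} (J : VertexResolutions V) where
  /-- the morphism `φ_a^q` -/
  φ ⦃i j : Q⦄ (a : i ⟶ j) (q : ℕ) : tensorSheaf (M a) (J.obj i q) ⟶ J.obj j q
  comm ⦃i j : Q⦄ (a : i ⟶ j) (q : ℕ) :
    tensorSheafMap (M a) (J.δ i q) ≫ φ a (q + 1) = φ a q ≫ J.δ j q
  comm_aug ⦃i j : Q⦄ (a : i ⟶ j) :
    tensorSheafMap (M a) (J.aug i) ≫ φ a 0 = arrowMap V a ≫ J.aug j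

variable {V : SheafOfModules.{u} (pathSheaf M)} (J : VertexResolutions V) (Φ : ArrowLifts J)

/-- The term `C(V)^{0,q} = ⨁_i Hom(e_i B, V_i^q)` of the double complex. -/
noncomputable abbrev column0 (q : ℕ) : SheafOfModules.{u} (pathSheaf M) :=
  ⨁ fun i : Q => homSheaf (vertexRight M i) (J.obj i q)

/-- The term `C(V)^{1,q} = ⨁_a Hom(M_a ⊗ e_{ta} B, V_{ha}^q)` of the double complex. -/
noncomputable abbrev column1 (q : ℕ) : SheafOfModules.{u} (pathSheaf M) :=
  ⨁ fun a : Arrows Q => homSheaf (arrowRight M a.2.2) (J.obj a.2.1 q)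

/-- The map `d : (α_i)_i ↦ (α_{ha} ∘ μ_a - φ_a^q ∘ (1 ⊗ α_{ta}))_a` for `V^q`. -/
noncomputable def rowMapD (q : ℕ) : column0 J q ⟶ column1 J q :=
  biproduct.lift fun a : Arrows Q =>
    biproduct.π _ a.2.1 ≫ homMul a.2.2 (J.obj a.2.1 q) -
      biproduct.π _ a.1 ≫ homTensor (vertexRight M a.1) (Φ.φ a.2.2 q)

/-- The horizontal differential `(-1)^q d` of the double complex. -/
noncomputable def dHor (q : ℕ) : column0 J q ⟶ column1 J q := (-1 : ℤ) ^ q • rowMapD J Φ q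

/-- The vertical differential `C(V)^{0,q} → C(V)^{0,q+1}` induced by `δ`. -/
noncomputable def dVert0 (q : ℕ) : column0 J q ⟶ column0 J (q + 1) :=
  biproduct.map fun i : Q => homMap (vertexRight M i) (J.δ i q)

/-- The vertical differential `C(V)^{1,q} → C(V)^{1,q+1}` induced by `δ`. -/
noncomputable def dVert1 (q : ℕ) : column1 J q ⟶ column1 J (q + 1) :=
  biproduct.map fun a : Arrows Q => homMap (arrowRight M a.2.2) (J.δ a.2.1 q)

theorem dVert0_comp (q : ℕ) : dVert0 J q ≫ dVert0 J (q + 1) = 0 := by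
  refine biproduct.hom_ext _ _ fun i => ?_
  simp only [dVert0, Category.assoc, biproduct.map_π, biproduct.map_π_assoc, ← homMap_comp,
    HomologicalComplex.d_comp_d, homMap_zero, comp_zero, zero_comp]

theorem dVert1_comp (q : ℕ) : dVert1 J q ≫ dVert1 J (q + 1) = 0 := by
  refine biproduct.hom_ext _ _ fun i => ?_
  simp only [dVert1, Category.assoc, biproduct.map_π, biproduct.map_π_assoc, ← homMap_comp,
    HomologicalComplex.d_comp_d, homMap_zero, comp_zero, zero_comp]

theorem rowMapD_comm (q : ℕ) :
    rowMapD J Φ q ≫ dVert1 J q = dVert0 J q ≫ rowMapD J Φ (q + 1) := by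
  refine biproduct.hom_ext _ _ fun a => ?_
  simp only [rowMapD, dVert1, dVert0, Category.assoc, biproduct.map_π, biproduct.lift_π_assoc,
    biproduct.lift_π, Preadditive.sub_comp, Preadditive.comp_sub, homMul_homMap,
    homTensor_homMap, biproduct.map_π_assoc, homMap_homTensor, Φ.comm]

/-- The squares of the double complex anticommute. -/
theorem dHor_dVert (q : ℕ) : dHor J Φ q ≫ dVert1 J q = -(dVert0 J q ≫ dHor J Φ (q + 1)) := by
  simp only [dHor, Preadditive.zsmul_comp, Preadditive.comp_zsmul, rowMapD_comm, pow_succ]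
  simp

/-- The term of degree `n` of the total complex `I(V)^•`. -/
noncomputable def totalX : ℕ → SheafOfModules.{u} (pathSheaf M)
  | 0 => column0 J 0
  | n + 1 => column0 J (n + 1) ⊞ column1 J n

/-- The differential of the total complex `I(V)^•`, the sum of the horizontal and the vertical
differentials. -/
noncomputable def totalD : ∀ n : ℕ, totalX J n ⟶ totalX J (n + 1)
  | 0 => biprod.lift (dVert0 J 0) (dHor J Φ 0)
  | n + 1 => biprod.lift (biprod.fst ≫ dVert0 J (n + 1))
      (biprod.fst ≫ dHor J Φ (n + 1) + biprod.snd ≫ dVert1 J n)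

theorem totalD_comp_zero : biprod.lift (dVert0 J 0) (dHor J Φ 0) ≫
    biprod.lift (biprod.fst ≫ dVert0 J 1) (biprod.fst ≫ dHor J Φ 1 + biprod.snd ≫ dVert1 J 0) =
      0 := by
  refine biprod.hom_ext _ _ ?_ ?_
  · simp [dVert0_comp]
  · simp [dHor_dVert]

theorem totalD_comp_succ (n : ℕ) :
    biprod.lift (biprod.fst ≫ dVert0 J (n + 1))
      (biprod.fst ≫ dHor J Φ (n + 1) + biprod.snd ≫ dVert1 J n) ≫
    biprod.lift (biprod.fst ≫ dVert0 J (n + 2))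
      (biprod.fst ≫ dHor J Φ (n + 2) + biprod.snd ≫ dVert1 J (n + 1)) = 0 := by
  refine biprod.hom_ext _ _ ?_ ?_
  · simp [dVert0_comp]
  · simp [dHor_dVert, dVert1_comp]

theorem totalD_comp : ∀ n : ℕ, totalD J Φ n ≫ totalD J Φ (n + 1) = 0
  | 0 => totalD_comp_zero J Φ
  | n + 1 => totalD_comp_succ J Φ n

/-- The total complex `I(V)^•` of the double complex `C(V)^{••}`. -/
noncomputable def totalComplex : CochainComplex (SheafOfModules.{u} (pathSheaf M)) ℕ :=
  CochainComplex.of (totalX J) (totalD J Φ) (totalD_comp J Φ)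

/-- The morphism `V → I(V)^0` whose components `V → Hom(e_i B, V_i^0)` are the composites of
`v ↦ (x ↦ x v)` with `V_i → V_i^0`. -/
noncomputable def epsBar : V ⟶ column0 J 0 :=
  biproduct.lift fun i : Q => epsMap V i ≫ homMap (vertexRight M i) (J.aug i)

theorem aug_δ (i : Q) : J.aug i ≫ J.δ i 0 = 0 := (J i).ι_f_zero_comp_complex_d

theorem epsBar_dVert0 : epsBar J ≫ dVert0 J 0 = 0 := by
  refine biproduct.hom_ext _ _ fun i => ?_
  simp only [epsBar, dVert0, Category.assoc, biproduct.map_π, biproduct.lift_π_assoc,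
    ← homMap_comp, aug_δ, homMap_zero, comp_zero, zero_comp]

theorem epsBar_rowMapD : epsBar J ≫ rowMapD J Φ 0 = 0 := by
  refine biproduct.hom_ext _ _ fun a => ?_
  simp only [epsBar, rowMapD, Category.assoc, biproduct.lift_π, biproduct.lift_π_assoc,
    Preadditive.comp_sub, ← homMul_homMap, homMap_homTensor, Φ.comm_aug, ← homTensor_homMap,
    zero_comp]
  rw [← Category.assoc, ← Category.assoc, epsMap_homMul, sub_self]

theorem epsBar_lift : epsBar J ≫ biprod.lift (dVert0 J 0) (dHor J Φ 0) = 0 := by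
  refine biprod.hom_ext _ _ ?_ ?_
  · simp only [Category.assoc, biprod.lift_fst, epsBar_dVert0, zero_comp]
  · simp only [Category.assoc, biprod.lift_snd, dHor, Preadditive.comp_zsmul,
      epsBar_rowMapD, zero_comp, smul_zero]

theorem epsBar_comp : epsBar J ≫ totalD J Φ 0 = 0 := epsBar_lift J Φ

/-- The augmentation `V → I(V)^•`, where `V` is regarded as a complex in degree `0`. -/
noncomputable def augmentation :
    (CochainComplex.single₀ (SheafOfModules.{u} (pathSheaf M))).obj V ⟶ totalComplex J Φ :=
  ((totalComplex J Φ).fromSingle₀Equiv V).symm ⟨epsBar J, by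
    refine Eq.trans (congrArg (fun f => epsBar J ≫ f) ?_) (epsBar_comp J Φ)
    exact CochainComplex.of_d (totalX J) (totalD J Φ) 0⟩

end Resolution

section TwistedQSheaves

theorem tensorSheafMap_id (N F : OMod X) : tensorSheafMap N (𝟙 F) = 𝟙 (tensorSheaf N F) := by
  refine Eq.trans (congrArg (PresheafOfModules.sheafification (𝟙 (strSheaf X).obj)).map ?_)
    ((PresheafOfModules.sheafification (𝟙 (strSheaf X).obj)).map_id _)
  refine PresheafOfModules.hom_ext fun U => ModuleCat.hom_ext ?_
  exact tensor_ext (P := Sec (tensorPre N.val F.val) U) (f := secMap _ U) (g := LinearMap.id)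
    fun n x => rfl

theorem tensorSheafMap_comp (N : OMod X) {F F' F'' : OMod X} (f : F ⟶ F') (g : F' ⟶ F'') :
    tensorSheafMap N (f ≫ g) = tensorSheafMap N f ≫ tensorSheafMap N g := by
  refine Eq.trans (congrArg (PresheafOfModules.sheafification (𝟙 (strSheaf X).obj)).map ?_)
    ((PresheafOfModules.sheafification (𝟙 (strSheaf X).obj)).map_comp _ _)
  refine PresheafOfModules.hom_ext fun U => ModuleCat.hom_ext ?_
  exact tensor_ext (P := Sec (tensorPre N.val F''.val) U) (f := secMap _ U)
    (g := secMap _ U ∘ₗ secMap _ U) fun n x => rfl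

variable (M) in
/-- An `M`-twisted `Q`-sheaf: an `𝒪_X`-module `V_i` for every vertex `i` and a morphism
`φ_a : M_a ⊗ V_i → V_j` for every arrow `a : i → j`. -/
structure TwistedQSheaf where
  /-- the `𝒪_X`-module `V_i` -/
  obj : Q → OMod X
  /-- the morphism `φ_a` -/
  φ ⦃i j : Q⦄ (a : i ⟶ j) : tensorSheaf (M a) (obj i) ⟶ obj j

/-- A morphism of twisted `Q`-sheaves: a family of morphisms `f_i : V_i → W_i` commuting with the
morphisms `φ_a`. -/
@[ext]
structure TwistedQSheaf.Hom (V W : TwistedQSheaf M) where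
  /-- the morphism `f_i` -/
  app (i : Q) : V.obj i ⟶ W.obj i
  comm ⦃i j : Q⦄ (a : i ⟶ j) :
    V.φ a ≫ app j = tensorSheafMap (M a) (app i) ≫ W.φ a

noncomputable instance : Category (TwistedQSheaf M) where
  Hom := TwistedQSheaf.Hom
  id V :=
    { app i := 𝟙 (V.obj i)
      comm i j a := by rw [tensorSheafMap_id, Category.comp_id, Category.id_comp] }
  comp f g :=
    { app i := f.app i ≫ g.app i
      comm i j a := by
        rw [tensorSheafMap_comp, Category.assoc, ← g.comm, ← Category.assoc, f.comm,
          Category.assoc] }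
  id_comp f := TwistedQSheaf.Hom.ext (funext fun i => Category.id_comp (f.app i))
  comp_id f := TwistedQSheaf.Hom.ext (funext fun i => Category.comp_id (f.app i))
  assoc f g h := TwistedQSheaf.Hom.ext (funext fun i =>
    Category.assoc (f.app i) (g.app i) (h.app i))

end TwistedQSheaves

end Sheaves

end TwistedQuiver

namespace TwistedQuiver

/-! ### Sheaves of modules: Grothendieck abelian, with monos, kernels and epis read off on sections.
-/

section SheavesOfModules

variable {C : Type u} [SmallCategory C] {J : GrothendieckTopology C} {R : Sheaf J RingCat.{u}}

/-! Injectivity of the terms comes from an adjunction. Sending `k : V ⟶ Hom(e_i B, L)` to `v ↦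
k(v)(e_i)` identifies `B`-linear maps into `Hom(e_i B, L)` with `𝒪_X`-linear maps `V_i ⟶ L`, and in
the same way maps into `Hom(N ⊗ e_i B, L)` correspond to maps `N ⊗ V_i ⟶ L`. Monos `V ⟶ W` induce
monos `V_i ⟶ W_i`, and `N ⊗ -` is exact for locally free `N`, so both constructions send injective
`L` to injective `B`-modules (`injective_homSheaf_vertexRight`, `injective_homSheaf_tensorRight`).
Exactness of `M_a ⊗ -` is also what produces the lifts `φ_a^•`, by the usual comparison of an exact
complex with a complex of injectives (`exists_arrow_lift`).

Exactness of the total complex rests on the tensor algebra structure of `B`: `e_j B` is the sum of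
`𝒪_X e_j` and of the `M_a ⊗ e_{ta} B` with `ha = j`. Hence, for any twisted `Q`-sheaf `(L_i, φ_a)`,
a family `α_i : e_i B ⟶ L_i` can be prescribed freely and uniquely, by recursion on path length,
through its values `α_i(e_i)` and its image `β = d α` (`VertexHoms.eq_of_unit`, `exists_vertexHoms`;
for sections of the direct sums `vertexSum_ext`, `exists_vertexSum`). In particular `d` is
surjective on sections, and its kernel is detected by the values at the `e_i`.

Given a cocycle `(α, β)` of the total complex in positive degree, the values `α_i(e_i)` are
`δ`-cocycles, so locally they are `δ t_i`. Choose `α'` with horizontal image `β` and `α'_i(e_i) =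
t_i`. Then `δ α'` and `α` have the same horizontal image, because the squares anticommute, and the
same values at the `e_i`, so they are equal and `α'` bounds the cocycle (`exists_column0_lift`). The
same argument at the start, together with `V = ⨁ V_i`, gives exactness at `V` and at `I(V)^0`.

Enough injectives for `B`-modules follow from the Grothendieck abelian structure. They pass to
twisted `Q`-sheaves along the equivalence `V ↦ (V_i, φ_a)`, whose inverse sends `T` to the kernel of
`d` for `T`. -/

instance hasExactColimitsOfShape_presheafOfModules (R₀ : Cᵒᵖ ⥤ RingCat.{u}) (K : Type u)
    [SmallCategory K] [IsFiltered K] :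
    HasExactColimitsOfShape K (PresheafOfModules.{u} R₀) :=
  have : ReflectsFiniteLimits (PresheafOfModules.toPresheaf.{u} R₀) :=
    { reflects := fun _ _ _ => reflectsLimitsOfShape_of_reflectsIsomorphisms }
  HasExactColimitsOfShape.domain_of_functor K (PresheafOfModules.toPresheaf.{u} R₀)

/-- Sheafification is an exact reflection of presheaves onto sheaves, so exactness of filtered
colimits descends from presheaves, where it is checked on underlying abelian presheaves. -/
instance ab5OfSize_sheafOfModules : AB5OfSize.{u, u} (SheafOfModules.{u} R) where
  ofShape K _ _ :=
    have := (PresheafOfModules.sheafificationAdjunction (𝟙 R.obj)).isLeftAdjoint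
    have : (SheafOfModules.forget R ⋙ PresheafOfModules.restrictScalars (𝟙 R.obj)).Full :=
      inferInstance
    (PresheafOfModules.sheafificationAdjunction (𝟙 R.obj)).hasExactColimitsOfShape K

variable (R) in
/-- The sheaf of modules freely generated by a section over `U`. -/
noncomputable def freeOn (U : C) : SheafOfModules.{u} R :=
  (PresheafOfModules.sheafification (𝟙 R.obj)).obj
    ((PresheafOfModules.free R.obj).obj (yoneda.obj U))

/-- Morphisms out of `freeOn R U` are the sections over `U`. -/
noncomputable def freeOnEquiv {F : SheafOfModules.{u} R} {U : C} :
    (freeOn R U ⟶ F) ≃ F.val.obj (op U) :=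
  (PresheafOfModules.sheafificationHomEquiv (𝟙 R.obj)).trans
    (PresheafOfModules.freeYonedaEquiv (M := F.val))

theorem freeOnEquiv_comp {F G : SheafOfModules.{u} R} {U : C} (s : freeOn R U ⟶ F) (f : F ⟶ G) :
    freeOnEquiv (s ≫ f) = f.val.app (op U) (freeOnEquiv s) := rfl

/-- Sections over `U` are the morphisms out of `freeOn R U`, so these objects separate; they form a
small family, and their coproduct is a single separator. -/
instance hasSeparator_sheafOfModules : HasSeparator (SheafOfModules.{u} R) := by
  have h : ObjectProperty.IsSeparating (.ofObj (freeOn R)) := by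
    intro F G f g hfg
    refine SheafOfModules.hom_ext (PresheafOfModules.hom_ext fun U => ModuleCat.hom_ext ?_)
    refine LinearMap.ext fun s => ?_
    obtain ⟨s, rfl⟩ := freeOnEquiv.surjective s
    exact congrArg freeOnEquiv (hfg _ (ObjectProperty.ofObj_apply _ U.unop) s)
  exact ⟨_, h.isSeparator_coproduct⟩

/-- Source of enough injectives, both for `𝒪_X`-modules (needed to resolve the `V_i`) and for
`B`-modules. -/
instance isGrothendieckAbelian_sheafOfModules :
    IsGrothendieckAbelian.{u} (SheafOfModules.{u} R) where

theorem injective_of_mono {F G : SheafOfModules.{u} R} (f : F ⟶ G) [Mono f] (U : Cᵒᵖ) :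
    Function.Injective (f.val.app U) := by
  intro x y h
  obtain ⟨x, rfl⟩ := freeOnEquiv.surjective x
  obtain ⟨y, rfl⟩ := freeOnEquiv.surjective y
  refine congrArg freeOnEquiv ((cancel_mono f).1 (freeOnEquiv.injective ?_))
  exact h

theorem mono_of_injective {F G : SheafOfModules.{u} R} (f : F ⟶ G)
    (h : ∀ U, Function.Injective (f.val.app U)) : Mono f where
  right_cancellation k k' e := by
    refine SheafOfModules.hom_ext (PresheafOfModules.hom_ext fun U => ModuleCat.hom_ext ?_)
    refine LinearMap.ext fun s => h U ?_
    exact congrArg (fun k : _ ⟶ G => k.val.app U s) e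

/-- A section is a morphism from `freeOn`, so sections killed by `f` factor through the kernel by
its universal property. -/
theorem exists_lift_kernel {F G : SheafOfModules.{u} R} (f : F ⟶ G) {U : Cᵒᵖ} (s : F.val.obj U)
    (hs : f.val.app U s = 0) : ∃ t, (kernel.ι f).val.app U t = s := by
  obtain ⟨s, rfl⟩ := freeOnEquiv.surjective s
  refine ⟨freeOnEquiv (kernel.lift f s (freeOnEquiv.injective ?_)), ?_⟩
  · exact hs
  · rw [← freeOnEquiv_comp, kernel.lift_ι]

/-- The map from `G` to the sheafified presheaf cokernel of `f` vanishes when `f` is epi. A section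
of `G` therefore dies locally in the presheaf cokernel itself, and there presheaf exactness supplies
a preimage. -/
theorem isLocallySurjective_of_epi {F G : SheafOfModules.{u} R} (f : F ⟶ G) [Epi f] :
    Presheaf.IsLocallySurjective J ((PresheafOfModules.toPresheaf R.obj).map f.val) where
  imageSieve_mem {U} s := by
    let p : G.val ⟶ cokernel f.val := cokernel.π f.val
    let P := PresheafOfModules.sheafification (𝟙 R.obj)
    let adj := PresheafOfModules.sheafificationAdjunction (𝟙 R.obj)
    let e : cokernel f.val ⟶ (P.obj (cokernel f.val)).val := adj.unit.app (cokernel f.val)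
    let q : G ⟶ P.obj (cokernel f.val) := ⟨p ≫ e⟩
    have hq : q = 0 := by
      rw [← cancel_epi f, comp_zero]
      refine SheafOfModules.hom_ext ?_
      change f.val ≫ p ≫ e = 0
      rw [← Category.assoc, cokernel.condition, zero_comp]
    let η := toSheafify J (cokernel f.val).presheaf
    have h0 : η.app (op U) (p.app (op U) s) = η.app (op U) 0 := by
      rw [map_zero]
      have := congrArg (fun k : G ⟶ P.obj (cokernel f.val) => k.val.app (op U) s) hq
      exact this
    refine J.superset_covering ?_ (Presheaf.equalizerSieve_mem J η _ _ h0)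
    intro V g hg
    have hg' : p.app (op V) (G.val.map g.op s) = 0 := by
      have h1 : (cokernel f.val).presheaf.map g.op (p.app (op U) s) =
        (cokernel f.val).presheaf.map g.op 0 := hg
      rw [map_zero] at h1
      refine Eq.trans ?_ h1
      exact (PresheafOfModules.naturality_apply p g.op s)
    have hex : (ShortComplex.mk f.val p (cokernel.condition _)).Exact :=
      ShortComplex.exact_cokernel f.val
    have hex' := hex.map (PresheafOfModules.evaluation R.obj (op V))
    obtain ⟨t, ht⟩ := (ShortComplex.moduleCat_exact_iff _).1 hex' _ hg'
    exact ⟨t, ht⟩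

theorem epi_of_isLocallySurjective {F G : SheafOfModules.{u} R} (f : F ⟶ G)
    (h : Presheaf.IsLocallySurjective J ((PresheafOfModules.toPresheaf R.obj).map f.val)) :
    Epi f := by
  have : Sheaf.IsLocallySurjective ((SheafOfModules.toSheaf R).map f) := h
  have : Epi ((SheafOfModules.toSheaf R).map f) := Sheaf.epi_of_isLocallySurjective _
  exact (SheafOfModules.toSheaf R).epi_of_epi_map this

end SheavesOfModules

/-! ### Local criterion for exactness on a topological space. -/

section Opens

variable {X : TopCat.{u}} {R : Sheaf (Opens.grothendieckTopology X) RingCat.{u}}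

/-- Restriction of sections to a smaller open set. -/
noncomputable def resTo (F : PresheafOfModules.{u} R.obj) {U W : Opens X} (h : W ≤ U) :
    F.obj (op U) →+ F.obj (op W) :=
  (F.presheaf.map (homOfLE h).op).hom

theorem resTo_app {F G : PresheafOfModules.{u} R.obj} (f : F ⟶ G) {U W : Opens X} (h : W ≤ U)
    (s : F.obj (op U)) : resTo G h (f.app _ s) = f.app (op W) (resTo F h s) :=
  (PresheafOfModules.naturality_apply f (homOfLE h).op s).symm

theorem eq_of_locally_eq (F : SheafOfModules.{u} R) {U : Opens X} (s t : F.val.obj (op U))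
    (h : ∀ x ∈ U, ∃ (W : Opens X) (hW : W ≤ U), x ∈ W ∧ resTo F.val hW s = resTo F.val hW t) :
    s = t := by
  choose W hW hx e using h
  let G : TopCat.Sheaf Ab X := ⟨F.val.presheaf, F.isSheaf⟩
  refine G.eq_of_locally_eq' (fun x : U => W x.1 x.2) U (fun x => homOfLE (hW x.1 x.2)) ?_ s t
    fun x => e x.1 x.2
  intro x hxU
  exact Opens.mem_iSup.2 ⟨⟨x, hxU⟩, hx x hxU⟩

/-- A sequence of sheaves of modules is exact at its middle term if and only if it is locally
exact on sections. -/
theorem exact_iff_locally (S : ShortComplex (SheafOfModules.{u} R)) :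
    S.Exact ↔ ∀ (U : Opens X) (s : S.X₂.val.obj (op U)), S.g.val.app _ s = 0 → ∀ x ∈ U,
      ∃ (W : Opens X) (hW : W ≤ U), x ∈ W ∧ ∃ t, S.f.val.app (op W) t = resTo S.X₂.val hW s := by
  -- Exactness becomes local surjectivity of `X₁` onto the kernel of `g`, whose sections are exactly
  -- the sections killed by `g`.
  rw [S.exact_iff_epi_kernel_lift]
  constructor
  · intro _ U s hs x hx
    obtain ⟨k, rfl⟩ := exists_lift_kernel S.g s hs
    have h := isLocallySurjective_of_epi (kernel.lift S.g S.f S.zero)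
    obtain ⟨W, i, ⟨t, ht⟩, hxW⟩ := h.imageSieve_mem k x hx
    refine ⟨W, i.le, hxW, t, ?_⟩
    have e : S.f = kernel.lift S.g S.f S.zero ≫ kernel.ι S.g := (kernel.lift_ι _ _ _).symm
    rw [resTo_app, e]
    exact congrArg ((kernel.ι S.g).val.app (op W)) ht
  · intro h
    refine epi_of_isLocallySurjective _ ⟨fun {U} k x hx => ?_⟩
    have hk : S.g.val.app (op U) ((kernel.ι S.g).val.app (op U) k) = 0 :=
      congrArg (fun f : kernel S.g ⟶ S.X₃ => f.val.app (op U) k) (kernel.condition S.g)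
    obtain ⟨W, hW, hxW, t, ht⟩ := h U _ hk x hx
    refine ⟨W, homOfLE hW, ⟨t, injective_of_mono (kernel.ι S.g) _ ?_⟩, hxW⟩
    replace ht := ht.trans (resTo_app (kernel.ι S.g).val hW k)
    refine Eq.trans ?_ ht
    exact congrArg (fun f : S.X₁ ⟶ S.X₂ => f.val.app (op W) t) (kernel.lift_ι S.g S.f S.zero)

end Opens

/-! ### Free sheaves of modules: local finite expansions and coordinate functionals. -/

section Generators

variable {C : Type u} [SmallCategory C] {J : GrothendieckTopology C} {R : Sheaf J RingCat.{u}}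
  {N : SheafOfModules.{u} R} (σ : N.GeneratingSections)

/-- The morphism from a free presheaf of modules given by a family of generating sections. -/
noncomputable def generatorsPre :
    PresheafOfModules.freeObj (R := R.obj) ((Functor.const Cᵒᵖ).obj σ.I) ⟶ N.val :=
  PresheafOfModules.freeObjDesc
    { app U := ↾fun i => (σ.s i).1 U
      naturality U V f := by
        ext i
        exact ((σ.s i).2 f).symm }

/-- The epimorphism `σ.π` from the free sheaf factors through the sheafification of the free
presheaf. So the induced map `d` from that sheafification is epi, hence locally surjective, and
composing with the locally surjective unit gives the claim for the presheaf. -/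
theorem isLocallySurjective_generatorsPre :
    Presheaf.IsLocallySurjective J ((PresheafOfModules.toPresheaf R.obj).map
      (generatorsPre σ)) := by
  let P := PresheafOfModules.freeObj (R := R.obj) ((Functor.const Cᵒᵖ).obj σ.I)
  let P' : SheafOfModules R := (PresheafOfModules.sheafification (𝟙 R.obj)).obj P
  let η : P ⟶ P'.val := (PresheafOfModules.sheafificationAdjunction (𝟙 R.obj)).unit.app P
  let d : P' ⟶ N := (PresheafOfModules.sheafificationHomEquiv (𝟙 R.obj)).symm (generatorsPre σ)
  have hd : η ≫ d.val = generatorsPre σ :=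
    (PresheafOfModules.sheafificationHomEquiv (𝟙 R.obj)).apply_symm_apply (generatorsPre σ)
  let e : σ.I → P.sections := fun i => PresheafOfModules.sectionsMk
    (fun U => ModuleCat.freeMk (R := R.obj.obj U) (show ((Functor.const Cᵒᵖ).obj σ.I).obj U from i))
    (fun U V f => by
      exact ModuleCat.freeDesc_apply _ _)
  let k : SheafOfModules.free σ.I ⟶ P' :=
    P'.freeHomEquiv.symm fun i => PresheafOfModules.sectionsMap η (e i)
  have hk : k ≫ d = σ.π := by
    rw [SheafOfModules.freeHomEquiv_symm_comp]
    congr 1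
    funext i
    refine PresheafOfModules.sections_ext _ _ fun U => ?_
    refine (congrArg (fun f : P ⟶ N.val => f.app U ((e i).1 U)) hd).trans ?_
    exact ModuleCat.freeDesc_apply _ _
  have : Epi (k ≫ d) := hk ▸ σ.epi
  have : Epi d := epi_of_epi k d
  have h1 := isLocallySurjective_of_epi d
  have h2 : Presheaf.IsLocallySurjective J ((PresheafOfModules.toPresheaf R.obj).map η) :=
    inferInstanceAs (Presheaf.IsLocallySurjective J (toSheafify J P.presheaf))
  rw [← hd, Functor.map_comp]
  infer_instance

/-- Coordinate functionals of a sheaf of modules that is free on a family of sections. -/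
theorem exists_coordinates [IsIso σ.π] : ∃ c : σ.I → (N ⟶ SheafOfModules.unit R),
    ∀ (U : C) (n : N.val.obj (op U)), ∃ S ∈ J U, ∀ (V : C) (g : V ⟶ U), S g →
      ∃ s : Finset σ.I, ∀ s', s ⊆ s' → N.val.map g.op n =
        ∑ j ∈ s', (show R.obj.obj (op V) from (c j).val.app (op V) (N.val.map g.op n)) •
          (σ.s j).eval (op V) := by
  classical
  -- The `j`-th coordinate is the inverse of `σ.π` followed by the `j`-th projection of the free
  -- sheaf.
  let c : σ.I → (N ⟶ SheafOfModules.unit R) := fun j => inv σ.π ≫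
    (SheafOfModules.unit R).freeHomEquiv.symm fun i =>
      (SheafOfModules.unit R).unitHomEquiv (if i = j then 𝟙 _ else 0)
  have hc : ∀ i j V, (c j).val.app V ((σ.s i).1 V) =
      (show R.obj.obj V from if i = j then 1 else 0) := by
    intro i j V
    have h : σ.π ≫ c j = (SheafOfModules.unit R).freeHomEquiv.symm fun i =>
        (SheafOfModules.unit R).unitHomEquiv (if i = j then 𝟙 _ else 0) := by simp [c]
    rw [SheafOfModules.freeHomEquiv_symm_comp] at h
    have h' := congrArg (fun t => t.1 V)
      (congrFun ((SheafOfModules.unit R).freeHomEquiv.symm.injective h) i)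
    refine Eq.trans h' ?_
    by_cases hij : i = j
    · simp only [hij, if_true]; rfl
    · simp only [hij, if_false]; rfl
  refine ⟨c, fun U n => ⟨_, (isLocallySurjective_generatorsPre σ).imageSieve_mem n, ?_⟩⟩
  rintro V g ⟨f, hf⟩
  let f : σ.I →₀ R.obj.obj (op V) := f
  have hf' : N.val.map g.op n = f.sum fun j r => r • (σ.s j).eval (op V) := by
    refine Eq.trans hf.symm ?_
    exact Finsupp.lift_apply (N.val.obj (op V)) (R.obj.obj (op V)) σ.I _ f
  have hcf : ∀ j, (show R.obj.obj (op V) from (c j).val.app (op V) (N.val.map g.op n)) = f j := by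
    intro j
    rw [hf']
    change ((c j).val.app (op V)).hom _ = _
    rw [map_finsuppSum]
    have e : ∀ i, ((c j).val.app (op V)).hom (f i • (σ.s i).eval (op V)) =
        (show R.obj.obj (op V) from if i = j then f i else 0) := by
      intro i
      refine (((c j).val.app (op V)).hom.map_smul _ _).trans ?_
      refine (congrArg (f i • ·) (hc i j (op V))).trans ?_
      change f i * (if i = j then 1 else 0) = _
      rw [mul_ite, mul_one, mul_zero]
    refine (Finset.sum_congr rfl fun i _ => e i).trans ?_
    refine (Finset.sum_ite_eq' f.support j f).trans ?_
    rw [ite_eq_left_iff, Finsupp.notMem_support_iff]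
    exact fun h => h.symm
  -- Enlarging the index set beyond the support only adds zero terms. This freedom lets several
  -- sections share one finite index set later.
  refine ⟨f.support, fun s' hs' => ?_⟩
  simp only [hcf]
  refine hf'.trans (Finset.sum_subset hs' fun j _ hj => ?_)
  rw [Finsupp.notMem_support_iff.1 hj]
  exact zero_smul _ ((σ.s j).eval (op V))

end Generators

/-! ### Dual bases of locally free sheaves near a point. -/

section DualBasis

variable {X : RingedSpace.{u, u}}

/-- Sections over `U` of an `𝒪_X`-module with coordinate functionals on its restriction to `U`,
such that every section is locally the finite linear combination given by its coordinates. -/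
structure DualBasis (N : OMod X) (U : (Opens X)ᵒᵖ) where
  /-- the index set of the sections -/
  I : Type u
  /-- the sections -/
  e : I → Sec N.val U
  /-- the coordinate functionals -/
  c : I → ∀ W : (Opens X)ᵒᵖ, (U ⟶ W) → Sec N.val W →ₗ[X.presheaf.obj W] X.presheaf.obj W
  c_res (j : I) {W W' : (Opens X)ᵒᵖ} (f : U ⟶ W) (g : W ⟶ W') (n : Sec N.val W) :
    X.presheaf.map g (c j W f n) = c j W' (f ≫ g) (secRes N.val g n)
  span {W : (Opens X)ᵒᵖ} (f : U ⟶ W) (n : Sec N.val W) (x : X) (hx : x ∈ W.unop) :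
    ∃ (W' : (Opens X)ᵒᵖ) (g : W ⟶ W'), x ∈ W'.unop ∧ ∃ s : Finset I, ∀ s', s ⊆ s' →
      secRes N.val g n = ∑ j ∈ s', c j W' (f ≫ g) (secRes N.val g n) • secRes N.val (f ≫ g) (e j)

/-- The functional on the sections over `W ⊆ U` given by a morphism `N|_U → 𝒪_U`. -/
noncomputable def overApp {N : OMod X} {U : Opens X}
    (c : N.over U ⟶ SheafOfModules.unit ((strSheaf X).over U)) (W : (Opens X)ᵒᵖ) (f : op U ⟶ W) :
    Sec N.val W →ₗ[X.presheaf.obj W] X.presheaf.obj W where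
  toFun n := c.val.app (op (Over.mk f.unop)) n
  map_add' n n' := (c.val.app (op (Over.mk f.unop))).hom.map_add n n'
  map_smul' r n := (c.val.app (op (Over.mk f.unop))).hom.map_smul r n

theorem overApp_res {N : OMod X} {U : Opens X}
    (c : N.over U ⟶ SheafOfModules.unit ((strSheaf X).over U)) {W W' : (Opens X)ᵒᵖ} (f : op U ⟶ W)
    (g : W ⟶ W') (n : Sec N.val W) :
    X.presheaf.map g (overApp c W f n) = overApp c W' (f ≫ g) (secRes N.val g n) :=
  let k : Over.mk (f ≫ g).unop ⟶ Over.mk f.unop := Over.homMk g.unop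
  (PresheafOfModules.naturality_apply c.val k.op n).symm

theorem secRes_sections {N : OMod X} {U : Opens X} (s : (N.over U).sections) {W : (Opens X)ᵒᵖ}
    (f : op U ⟶ W) :
    secRes N.val f (s.eval (op (Over.mk (𝟙 U)))) = s.eval (op (Over.mk f.unop)) :=
  let k : Over.mk f.unop ⟶ Over.mk (𝟙 U) := Over.homMk f.unop
  PresheafOfModules.sections_property s k.op

/-- Coordinates on the slice site over `U`, rewritten as functionals on the open subsets of `U`;
covering sieves of the slice become neighbourhoods of points. -/
theorem nonempty_dualBasis {N : OMod X} {U : Opens X} (σ : (N.over U).GeneratingSections)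
    [IsIso σ.π] : Nonempty (DualBasis N (op U)) := by
  obtain ⟨c, hc⟩ := exists_coordinates σ
  refine ⟨⟨σ.I, fun j => (σ.s j).eval (op (Over.mk (𝟙 U))), fun j => overApp (c j),
    fun j => overApp_res (c j), fun {W} f n x hx => ?_⟩⟩
  cases hc (Over.mk f.unop) n with | intro S hS =>
  have hS' : ∀ y ∈ W.unop, ∃ (W' : Opens X) (k : W' ⟶ W.unop),
      Sieve.overEquiv (Over.mk f.unop) S k ∧ y ∈ W' :=
    (GrothendieckTopology.mem_over_iff _ S).1 hS.1
  obtain ⟨W', k, hk, hxW'⟩ := hS' x hx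
  cases hS.2 _ _ ((Sieve.overEquiv_iff S k).1 hk) with | intro s hs =>
  refine ⟨op W', k.op, hxW', s, fun s' hs' => ?_⟩
  refine Eq.trans (hs s' hs') (Finset.sum_congr rfl fun j _ => ?_)
  rw [secRes_sections]
  rfl

theorem exists_dualBasis (N : OMod X) (hN : N.IsLocallyFree) (x : X) :
    ∃ U : (Opens X)ᵒᵖ, x ∈ U.unop ∧ Nonempty (DualBasis N U) := by
  obtain ⟨q, hq⟩ := hN.exists_isLocallyFreeData
  obtain ⟨V, -, ⟨i, ⟨g⟩⟩, hxV⟩ := q.coversTop ⊤ x trivial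
  exact ⟨op (q.X i), g.le hxV, nonempty_dualBasis (q.generators i)⟩

end DualBasis

/-! ### Tensoring with a locally free sheaf is exact. -/

section Flatness

variable {X : RingedSpace.{u, u}}

/-- Finitely many neighbourhoods of a point can be intersected; used wherever finitely many local
lifts have to live on one open set. -/
theorem exists_common_restriction {ι : Type*} (s : Finset ι) {U : (Opens X)ᵒᵖ} (x : X)
    (hx : x ∈ U.unop) (P : ι → ∀ W : (Opens X)ᵒᵖ, (U ⟶ W) → Prop)
    (res : ∀ j {W W' : (Opens X)ᵒᵖ} (f : U ⟶ W) (g : W ⟶ W'), P j W f → P j W' (f ≫ g))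
    (h : ∀ j ∈ s, ∃ (W : (Opens X)ᵒᵖ) (f : U ⟶ W), x ∈ W.unop ∧ P j W f) :
    ∃ (W : (Opens X)ᵒᵖ) (f : U ⟶ W), x ∈ W.unop ∧ ∀ j ∈ s, P j W f := by
  classical
  induction s using Finset.induction_on with
  | empty => exact ⟨U, 𝟙 U, hx, by simp⟩
  | insert j s _ ih =>
    obtain ⟨W, f, hxW, hf⟩ := ih fun k hk => h k (Finset.mem_insert_of_mem hk)
    obtain ⟨W', f', hxW', hf'⟩ := h j (Finset.mem_insert_self _ _)
    let g : W ⟶ op (W.unop ⊓ W'.unop) := (homOfLE inf_le_left).op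
    let g' : W' ⟶ op (W.unop ⊓ W'.unop) := (homOfLE inf_le_right).op
    refine ⟨_, f ≫ g, ⟨hxW, hxW'⟩, fun k hk => ?_⟩
    rcases Finset.mem_insert.1 hk with rfl | hk
    · exact res _ f' g' hf'
    · exact res _ f g (hf k hk)

theorem sec_eq_of_locally_eq (F : OMod X) {U : (Opens X)ᵒᵖ} (s t : Sec F.val U)
    (h : ∀ x ∈ U.unop, ∃ (W : (Opens X)ᵒᵖ) (f : U ⟶ W), x ∈ W.unop ∧
      secRes F.val f s = secRes F.val f t) : s = t := by
  refine eq_of_locally_eq F (U := U.unop) s t fun x hx => ?_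
  obtain ⟨W, f, hxW, e⟩ := h x hx
  exact ⟨W.unop, f.unop.le, hxW, e⟩

/-- The canonical morphism from the presheaf tensor product to the tensor product of sheaves. -/
noncomputable def tensorUnit (N F : OMod X) : tensorPre N.val F.val ⟶ (tensorSheaf N F).val :=
  tensorSheafRes (𝟙 _)

theorem tensorSheafRes_eq {N F L : OMod X} (g : tensorSheaf N F ⟶ L) :
    tensorSheafRes g = tensorUnit N F ≫ g.val := by
  rw [tensorUnit, ← tensorSheafRes_comp, Category.id_comp]

theorem tensorUnit_map (N : OMod X) {F F' : OMod X} (f : F ⟶ F') :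
    tensorUnit N F ≫ (tensorSheafMap N f).val =
      PresheafOfModules.Monoidal.tensorHom (R := X.presheaf) (𝟙 N.val) f.val ≫ tensorUnit N F' := by
  rw [tensorUnit, tensorUnit, ← tensorSheafRes_comp, ← tensorSheafRes_map_comp, Category.id_comp,
    Category.comp_id]

theorem tensorUnit_locally_surjective (N F : OMod X) {U : (Opens X)ᵒᵖ}
    (s : Sec (tensorSheaf N F).val U) (x : X) (hx : x ∈ U.unop) :
    ∃ (W : (Opens X)ᵒᵖ) (f : U ⟶ W), x ∈ W.unop ∧
      ∃ t, secMap (tensorUnit N F) W t = secRes (tensorSheaf N F).val f s := by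
  obtain ⟨W, f, ⟨t, ht⟩, hxW⟩ := Presheaf.imageSieve_mem (Opens.grothendieckTopology X)
    (toSheafify (Opens.grothendieckTopology X) (tensorPre N.val F.val).presheaf) s x hx
  exact ⟨op W, f.op, hxW, t, ht⟩

theorem tensorUnit_locally_injective (N F : OMod X) {U : (Opens X)ᵒᵖ}
    (t : Sec (tensorPre N.val F.val) U) (ht : secMap (tensorUnit N F) U t = 0) (x : X)
    (hx : x ∈ U.unop) : ∃ (W : (Opens X)ᵒᵖ) (f : U ⟶ W), x ∈ W.unop ∧
      secRes (tensorPre N.val F.val) f t = 0 := by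
  obtain ⟨W, f, hf, hxW⟩ := Presheaf.equalizerSieve_mem (Opens.grothendieckTopology X)
    (toSheafify (Opens.grothendieckTopology X) (tensorPre N.val F.val).presheaf) t 0
    (ht.trans (map_zero (secMap (tensorUnit N F) U)).symm) x hx
  refine ⟨op W, f.op, hxW, ?_⟩
  exact Eq.trans hf (map_zero (secRes (tensorPre N.val F.val) f.op))

/-- The presheaf map `1 ⊗ f` on sections. -/
noncomputable def tensorPreMap (N : OMod X) {F F' : OMod X} (f : F ⟶ F') (U : (Opens X)ᵒᵖ) :
    Sec (tensorPre N.val F.val) U →ₗ[X.presheaf.obj U] Sec (tensorPre N.val F'.val) U :=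
  secMap (PresheafOfModules.Monoidal.tensorHom (R := X.presheaf) (𝟙 N.val) f.val) U

theorem tensorPreMap_mk (N : OMod X) {F F' : OMod X} (f : F ⟶ F') (U : (Opens X)ᵒᵖ)
    (n : Sec N.val U) (x : Sec F.val U) :
    tensorPreMap N f U (tensorMk N.val F.val U n x) =
      tensorMk N.val F'.val U n (secMap f.val U x) := rfl

theorem tensorPreMap_zero (N F F' : OMod X) (U : (Opens X)ᵒᵖ) :
    tensorPreMap N (0 : F ⟶ F') U = 0 :=
  tensor_ext fun n _ => map_zero (tensorMk N.val F'.val U n)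

theorem tensorPreMap_res (N : OMod X) {F F' : OMod X} (f : F ⟶ F') {U W : (Opens X)ᵒᵖ}
    (g : U ⟶ W) (t : Sec (tensorPre N.val F.val) U) :
    secRes (tensorPre N.val F'.val) g (tensorPreMap N f U t) =
      tensorPreMap N f W (secRes (tensorPre N.val F.val) g t) :=
  secMap_res _ g t

theorem secMap_tensorUnit_map (N : OMod X) {F F' : OMod X} (f : F ⟶ F') (U : (Opens X)ᵒᵖ)
    (t : Sec (tensorPre N.val F.val) U) :
    secMap (tensorSheafMap N f).val U (secMap (tensorUnit N F) U t) =
      secMap (tensorUnit N F') U (tensorPreMap N f U t) :=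
  congrArg (fun k => secMap k U t) (tensorUnit_map N f)

namespace DualBasis

variable {N : OMod X} {U : (Opens X)ᵒᵖ} (D : DualBasis N U)

/-- The contraction `n ⊗ x ↦ c_j(n) x`. -/
noncomputable def contract (F : OMod X) (j : D.I) (W : (Opens X)ᵒᵖ) (f : U ⟶ W) :
    Sec (tensorPre N.val F.val) W →ₗ[X.presheaf.obj W] Sec F.val W :=
  tensorLift ((LinearMap.lsmul (X.presheaf.obj W) (Sec F.val W)).comp (D.c j W f))

theorem contract_mk (F : OMod X) (j : D.I) (W : (Opens X)ᵒᵖ) (f : U ⟶ W) (n : Sec N.val W)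
    (x : Sec F.val W) : D.contract F j W f (tensorMk N.val F.val W n x) = D.c j W f n • x := rfl

theorem contract_map {F F' : OMod X} (h : F ⟶ F') (j : D.I) (W : (Opens X)ᵒᵖ) (f : U ⟶ W)
    (t : Sec (tensorPre N.val F.val) W) :
    D.contract F' j W f (tensorPreMap N h W t) = secMap h.val W (D.contract F j W f t) := by
  induction t using tensor_induction with
  | zero => simp
  | add x y hx hy => simp only [map_add, hx, hy]
  | tmul n x => rw [tensorPreMap_mk, contract_mk, contract_mk, map_smul]

theorem contract_res (F : OMod X) (j : D.I) {W W' : (Opens X)ᵒᵖ} (f : U ⟶ W) (g : W ⟶ W')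
    (t : Sec (tensorPre N.val F.val) W) :
    secRes F.val g (D.contract F j W f t) =
      D.contract F j W' (f ≫ g) (secRes (tensorPre N.val F.val) g t) := by
  induction t using tensor_induction with
  | zero => simp
  | add x y hx hy => simp only [map_add, hx, hy]
  | tmul n x =>
    rw [tensorMk_res, contract_mk, contract_mk, map_smulₛₗ, ← D.c_res]

/-- The expansion `t = ∑ e_j ⊗ c_j(t)` replaces a tensor by finitely many sections of `F`.
Quantifying over all larger index sets makes it additive in `t`; quantifying over all further
restrictions keeps it available when the neighbourhood shrinks again. -/
theorem tensor_span (F : OMod X) {W : (Opens X)ᵒᵖ} (f : U ⟶ W)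
    (t : Sec (tensorPre N.val F.val) W) (x : X) (hx : x ∈ W.unop) :
    ∃ (W' : (Opens X)ᵒᵖ) (g : W ⟶ W'), x ∈ W'.unop ∧ ∃ s : Finset D.I,
      ∀ s', s ⊆ s' → ∀ (W'' : (Opens X)ᵒᵖ) (g' : W' ⟶ W''),
        secRes (tensorPre N.val F.val) (g ≫ g') t =
          ∑ j ∈ s', tensorMk N.val F.val W'' (secRes N.val (f ≫ g ≫ g') (D.e j))
            (D.contract F j W'' (f ≫ g ≫ g') (secRes (tensorPre N.val F.val) (g ≫ g') t)) := by
  classical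
  induction t using tensor_induction with
  | zero => exact ⟨W, 𝟙 W, hx, ∅, fun _ _ _ _ => by simp⟩
  | add t t' ht ht' =>
    obtain ⟨W₁, g₁, hx₁, s₁, h₁⟩ := ht
    obtain ⟨W₂, g₂, hx₂, s₂, h₂⟩ := ht'
    let k₁ : W₁ ⟶ op (W₁.unop ⊓ W₂.unop) := (homOfLE inf_le_left).op
    let k₂ : W₂ ⟶ op (W₁.unop ⊓ W₂.unop) := (homOfLE inf_le_right).op
    refine ⟨_, g₁ ≫ k₁, ⟨hx₁, hx₂⟩, s₁ ∪ s₂, fun s' hs' W'' g' => ?_⟩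
    have e₁ := h₁ s' (Finset.union_subset_left hs') W'' (k₁ ≫ g')
    have e₂ := h₂ s' (Finset.union_subset_right hs') W'' (k₂ ≫ g')
    rw [show g₂ ≫ k₂ ≫ g' = g₁ ≫ k₁ ≫ g' from Subsingleton.elim _ _] at e₂
    rw [Category.assoc]
    simp only [map_add, Finset.sum_add_distrib]
    rw [← e₁, ← e₂]
  | tmul n y =>
    obtain ⟨W', g, hxW', s, hs⟩ := D.span f n x hx
    refine ⟨W', g, hxW', s, fun s' hs' W'' g' => ?_⟩
    rw [tensorMk_res]
    have h := congrArg (secRes N.val g') (hs s' hs')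
    simp only [map_sum, map_smulₛₗ, D.c_res, ← secRes_comp, Category.assoc] at h
    refine (congrArg (fun m => tensorMk N.val F.val W'' m (secRes F.val (g ≫ g') y)) h).trans ?_
    simp only [map_sum, LinearMap.sum_apply, map_smul, LinearMap.smul_apply, contract_mk]
    rfl

end DualBasis

/-- Flatness by hand: the contractions `c_j(t)` are killed by `g`, hence lift locally through `f` to
some `y_j`, and `∑ e_j ⊗ y_j` is a preimage. Only finitely many `j` matter, so one neighbourhood is
enough. -/
theorem tensorPre_locally_exact {N : OMod X} (hN : N.IsLocallyFree)
    (S : ShortComplex (OMod X)) (hS : S.Exact) {U : (Opens X)ᵒᵖ}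
    (t : Sec (tensorPre N.val S.X₂.val) U) (ht : tensorPreMap N S.g U t = 0) (x : X)
    (hx : x ∈ U.unop) : ∃ (W : (Opens X)ᵒᵖ) (f : U ⟶ W), x ∈ W.unop ∧
      ∃ y, tensorPreMap N S.f W y = secRes (tensorPre N.val S.X₂.val) f t := by
  classical
  obtain ⟨U₀, hx₀, ⟨D⟩⟩ := exists_dualBasis N hN x
  let U₁ : (Opens X)ᵒᵖ := op (U.unop ⊓ U₀.unop)
  let i : U ⟶ U₁ := (homOfLE inf_le_left).op
  let i₀ : U₀ ⟶ U₁ := (homOfLE inf_le_right).op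
  obtain ⟨W, g, hxW, s, hs⟩ := D.tensor_span S.X₂ i₀ (secRes _ i t) x ⟨hx, hx₀⟩
  let b : D.I → Sec S.X₂.val W := fun j =>
    D.contract S.X₂ j W (i₀ ≫ g) (secRes (tensorPre N.val S.X₂.val) g (secRes _ i t))
  -- Contraction against a functional on `N` commutes with any map in the second factor.
  have hb : ∀ j, secMap S.g.val W (b j) = 0 := fun j => by
    rw [← D.contract_map, ← tensorPreMap_res, ← tensorPreMap_res, ht]
    simp
  have hloc : ∀ j ∈ s, ∃ (W' : (Opens X)ᵒᵖ) (f : W ⟶ W'), x ∈ W'.unop ∧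
      ∃ y, secMap S.f.val W' y = secRes S.X₂.val f (b j) := fun j _ => by
    obtain ⟨W', hW', hxW', y, hy⟩ := (exact_iff_locally S).1 hS W.unop (b j) (hb j) x hxW
    exact ⟨op W', (homOfLE hW').op, hxW', y, hy⟩
  obtain ⟨W', k, hxW', hk⟩ := exists_common_restriction s x hxW
    (fun j W' f => ∃ y, secMap S.f.val W' y = secRes S.X₂.val f (b j))
    (fun j V V' f g ⟨y, hy⟩ => ⟨secRes _ g y, by rw [← secMap_res, hy, secRes_comp]⟩) hloc
  choose! y hy using hk
  refine ⟨W', i ≫ g ≫ k, hxW', ∑ j ∈ s,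
    tensorMk N.val S.X₁.val W' (secRes N.val (i₀ ≫ g ≫ k) (D.e j)) (y j), ?_⟩
  rw [secRes_comp, hs s le_rfl W' k, map_sum]
  refine Finset.sum_congr rfl fun j hj => ?_
  rw [tensorPreMap_mk, hy j hj, secRes_comp _ g k]
  congr 1
  exact (D.contract_res _ j (i₀ ≫ g) k _).trans (by rw [Category.assoc])

/-- Local exactness applied to the zero map followed by the mono `h`. -/
theorem tensorPre_locally_injective {N : OMod X} (hN : N.IsLocallyFree) {F F' : OMod X}
    (h : F ⟶ F') [Mono h] {U : (Opens X)ᵒᵖ} (t : Sec (tensorPre N.val F.val) U)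
    (ht : tensorPreMap N h U t = 0) (x : X) (hx : x ∈ U.unop) :
    ∃ (W : (Opens X)ᵒᵖ) (f : U ⟶ W), x ∈ W.unop ∧ secRes (tensorPre N.val F.val) f t = 0 := by
  have hS : (ShortComplex.mk (0 : F ⟶ F) h zero_comp).Exact :=
    (ShortComplex.exact_iff_mono _ rfl).2 inferInstance
  obtain ⟨W, f, hxW, y, hy⟩ := tensorPre_locally_exact hN _ hS t ht x hx
  refine ⟨W, f, hxW, hy.symm.trans ?_⟩
  rw [tensorPreMap_zero]
  rfl

/-- Local exactness survives sheafification. Three shrinkings are needed: to represent the section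
by a presheaf tensor, to make its image vanish before sheafification, and to lift it. -/
theorem tensorSheafMap_exact {N : OMod X} (hN : N.IsLocallyFree) (S : ShortComplex (OMod X))
    (hS : S.Exact) (zero : tensorSheafMap N S.f ≫ tensorSheafMap N S.g = 0) :
    (ShortComplex.mk (tensorSheafMap N S.f) (tensorSheafMap N S.g) zero).Exact := by
  refine (exact_iff_locally _).2 fun U s hs x hx => ?_
  obtain ⟨W, f, hxW, t, ht⟩ := tensorUnit_locally_surjective N S.X₂ (U := op U) s x hx
  have h0 : secMap (tensorUnit N S.X₃) W (tensorPreMap N S.g W t) = 0 := by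
    rw [← secMap_tensorUnit_map, ht, ← secMap_res]
    exact (congrArg (secRes _ f) hs).trans (map_zero _)
  obtain ⟨W', f', hxW', h1⟩ := tensorUnit_locally_injective N S.X₃ _ h0 x hxW
  rw [tensorPreMap_res] at h1
  obtain ⟨W'', f'', hxW'', y, hy⟩ := tensorPre_locally_exact hN S hS _ h1 x hxW'
  refine ⟨W''.unop, (f ≫ f' ≫ f'').unop.le, hxW'', secMap (tensorUnit N S.X₁) W'' y, ?_⟩
  refine (secMap_tensorUnit_map N S.f W'' y).trans ?_
  rw [hy, ← secMap_res, ← secMap_res, ht, ← secRes_comp, ← secRes_comp]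
  rfl

theorem mono_tensorSheafMap {N : OMod X} (hN : N.IsLocallyFree) {F F' : OMod X} (h : F ⟶ F')
    [Mono h] : Mono (tensorSheafMap N h) := by
  refine mono_of_injective _ fun U => (injective_iff_map_eq_zero
    (secMap (tensorSheafMap N h).val U)).2 fun s hs => ?_
  refine sec_eq_of_locally_eq _ s 0 fun x hx => ?_
  obtain ⟨W, f, hxW, t, ht⟩ := tensorUnit_locally_surjective N F s x hx
  have h0 : secMap (tensorUnit N F') W (tensorPreMap N h W t) = 0 := by
    rw [← secMap_tensorUnit_map, ht, ← secMap_res, hs, map_zero]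
  obtain ⟨W', f', hxW', h1⟩ := tensorUnit_locally_injective N F' _ h0 x hxW
  rw [tensorPreMap_res] at h1
  obtain ⟨W'', f'', hxW'', h2⟩ := tensorPre_locally_injective hN h _ h1 x hxW'
  refine ⟨W'', f ≫ f' ≫ f'', hxW'', ?_⟩
  rw [map_zero, secRes_comp, secRes_comp, ← ht, secMap_res, secMap_res, h2, map_zero]

end Flatness

/-! ### Induction along arrows in the path algebra over a ring. -/

section RowAlgebra

open scoped TensorProduct DirectSum Classical

variable {Q : Type u} [Quiver.{u} Q] {R : Type u} [CommRing R]
  {M : ∀ ⦃i j : Q⦄, (i ⟶ j) → Type u}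
  [∀ i j (a : i ⟶ j), AddCommGroup (M a)] [∀ i j (a : i ⟶ j), Module R (M a)]

/-- The rows are generated additively from scalar multiples of the `e_i` by left multiplication with
arrows. The predicate ranges over all rows at once because an arrow changes the row. -/
theorem row_arrow_induction {P : ∀ j : Q, Row R M j → Prop} (zero : ∀ j, P j 0)
    (add : ∀ j x y, P j x → P j y → P j (x + y)) (nil : ∀ i r, P i (rowOf R M .nil (nilOf M i r)))
    (arrow : ∀ i j (a : i ⟶ j) m x, P i x → P j (arrowAct R M a m x)) (j : Q) (x : Row R M j) :
    P j x := by
  induction x using row_induction with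
  | zero => exact zero j
  | add x y hx hy => exact add j x y hx hy
  | of i p y =>
    induction p with
    | nil =>
      obtain ⟨y, rfl⟩ := nilOf_surjective M i y
      exact nil i y
    | cons p a ih =>
      induction y using pathMod_cons_induction with
      | zero => rw [map_zero]; exact zero _
      | add x y hx hy => rw [map_add]; exact add _ _ _ hx hy
      | tmul m y => rw [← arrowAct_rowOf]; exact arrow _ _ a m _ (ih y)

theorem vertexElt_mul (j : Q) (z : PathAlg R M) :
    vertexElt R M j * z = rowSingle R M j (z j) := by
  funext k
  change rowMul R M k (rowSingle R M j (rowOf R M .nil (nilOf M j 1)) k) z = _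
  by_cases h : k = j
  · subst h
    rw [rowSingle_same, rowSingle_same, rowMul_rowOf, pathAct_nilOf, one_smul]
  · rw [rowSingle_of_ne h, rowSingle_of_ne h, map_zero, LinearMap.zero_apply]

theorem arrowElt_mul {i j : Q} (a : i ⟶ j) (m : M a) (z : PathAlg R M) :
    arrowElt R M a m * z = rowSingle R M j (arrowAct R M a m (z i)) := by
  funext k
  change rowMul R M k (rowSingle R M j (rowOf R M (Quiver.Path.nil.cons a)
    (consOf R M .nil a m (nilOf M i 1))) k) z = _
  by_cases h : k = j
  · subst h
    rw [rowSingle_same, rowSingle_same, rowMul_rowOf, pathAct_consOf, pathAct_nilOf, one_smul]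
  · rw [rowSingle_of_ne h, rowSingle_of_ne h, map_zero, LinearMap.zero_apply]

end RowAlgebra

/-! ### Comparison of the sheaf `e_j B` with the rows of the presheaf of path algebras. -/

section Rows

variable {X : RingedSpace.{u, u}} {Q : Type u} [Quiver.{u} Q] {M : ∀ ⦃i j : Q⦄, (i ⟶ j) → OMod X}

variable (M) in
/-- The row `e_j A` of the path algebra over `𝒪_X(U)` twisted by the modules `M_a(U)`. -/
abbrev LocalRow (j : Q) (U : (Opens X)ᵒᵖ) : Type u :=
  Row (X.presheaf.obj U) (fun _ _ a => Sec (M a).val U) j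

variable (M) in
/-- Restriction of the rows of the presheaf of path algebras. -/
noncomputable def localRowRes (j : Q) {U W : (Opens X)ᵒᵖ} (f : U ⟶ W) :
    LocalRow M j U →+ LocalRow M j W :=
  rowMap (X.presheaf.map f).hom (fun _ _ a => secRes (M a).val f) j

variable (M) in
/-- The canonical map from `e_j A` to the sections of `e_j B`. -/
noncomputable def rowToSec (j : Q) (U : (Opens X)ᵒᵖ) :
    LocalRow M j U →ₗ[X.presheaf.obj U] Sec (vertexPre (leftB M) j) U where
  toFun y := vertexMk (V := leftB M) (toSec M U (rowSingle _ _ j y)) (by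
    change secVertex M j U * toSec M U _ = _
    rw [secVertex, ← map_mul, vertexElt_mul, rowSingle_same])
  map_add' y y' := ringVal_injective (by
    change toSec M U (rowSingle _ _ j (y + y')) = toSec M U _ + toSec M U _
    rw [map_add, map_add])
  map_smul' r y := ringVal_injective (by
    change toSec M U (rowSingle _ _ j (r • y)) = secScalar M U r * toSec M U _
    rw [map_smul, Algebra.smul_def, map_mul]
    rfl)

theorem ringVal_rowToSec (j : Q) (U : (Opens X)ᵒᵖ) (y : LocalRow M j U) :
    ringVal (rowToSec M j U y) = toSec M U (rowSingle _ _ j y) := rfl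

theorem rowToSec_res (j : Q) {U W : (Opens X)ᵒᵖ} (f : U ⟶ W) (y : LocalRow M j U) :
    secRes (vertexPre (leftB M) j) f (rowToSec M j U y) =
      rowToSec M j W (localRowRes M j f y) := by
  refine ringVal_injective ?_
  rw [ringVal_res, ringVal_rowToSec, ringVal_rowToSec]
  exact (toSec_res M f _).trans (congrArg (toSec M W) (pathAlgMap_single _ _ _ _))

theorem rowToSec_arrowAct {i j : Q} (a : i ⟶ j) (U : (Opens X)ᵒᵖ) (m : Sec (M a).val U)
    (y : LocalRow M i U) :
    rowToSec M j U (arrowAct _ _ a m y) = arrowBilin (leftB M) a U m (rowToSec M i U y) := by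
  refine ringVal_injective ?_
  change toSec M U _ = secArrow M a U m * toSec M U _
  rw [secArrow, ← map_mul, arrowElt_mul, rowSingle_same]

theorem toSec_locally_injective {U : (Opens X)ᵒᵖ} (z : LocalAlg M U) (hz : toSec M U z = 0)
    (x : X) (hx : x ∈ U.unop) : ∃ (W : (Opens X)ᵒᵖ) (f : U ⟶ W), x ∈ W.unop ∧
      pathAlgMap (X.presheaf.map f).hom (fun _ _ a => secRes (M a).val f) z = 0 := by
  obtain ⟨W, f, hf, hxW⟩ := Presheaf.equalizerSieve_mem (Opens.grothendieckTopology X)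
    (toSheafify (Opens.grothendieckTopology X) (pathPresheaf M)) z 0
    (hz.trans (map_zero (toSec M U)).symm) x hx
  exact ⟨op W, f.op, hxW, Eq.trans hf (map_zero ((pathPresheaf M).map f.op).hom)⟩

theorem toSec_locally_surjective {U : (Opens X)ᵒᵖ} (b : (pathSheaf M).obj.obj U)
    (x : X) (hx : x ∈ U.unop) : ∃ (W : (Opens X)ᵒᵖ) (f : U ⟶ W), x ∈ W.unop ∧
      ∃ z, toSec M W z = (pathSheaf M).obj.map f b := by
  obtain ⟨W, f, ⟨z, hz⟩, hxW⟩ := Presheaf.imageSieve_mem (Opens.grothendieckTopology X)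
    (toSheafify (Opens.grothendieckTopology X) (pathPresheaf M)) b x hx
  exact ⟨op W, f.op, hxW, z, hz⟩

theorem rowToSec_locally_injective {j : Q} {U : (Opens X)ᵒᵖ} (y : LocalRow M j U)
    (hy : rowToSec M j U y = 0) (x : X) (hx : x ∈ U.unop) :
    ∃ (W : (Opens X)ᵒᵖ) (f : U ⟶ W), x ∈ W.unop ∧ localRowRes M j f y = 0 := by
  obtain ⟨W, f, hxW, h⟩ := toSec_locally_injective _ (congrArg ringVal hy) x hx
  refine ⟨W, f, hxW, ?_⟩
  rw [pathAlgMap_single] at h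
  exact (rowSingle_same j _).symm.trans (congrFun h j)

/-- A section of `B` comes locally from an element of the whole path algebra; multiplying by `e_j`
keeps only its row at `j`, without changing a section of `e_j B`. -/
theorem rowToSec_locally_surjective {j : Q} {U : (Opens X)ᵒᵖ}
    (b : Sec (vertexPre (leftB M) j) U) (x : X) (hx : x ∈ U.unop) :
    ∃ (W : (Opens X)ᵒᵖ) (f : U ⟶ W), x ∈ W.unop ∧
      ∃ y, rowToSec M j W y = secRes (vertexPre (leftB M) j) f b := by
  obtain ⟨W, f, hxW, z, hz⟩ := toSec_locally_surjective (ringVal b) x hx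
  refine ⟨W, f, hxW, z j, ringVal_injective ?_⟩
  rw [ringVal_rowToSec, ← vertexElt_mul, map_mul, hz, ringVal_res]
  exact secVertex_mul_ringVal (secRes (vertexPre (leftB M) j) f b)

/-- Sections of `e_j B` come locally from the rows, and sections of the sheaf `L` are determined
locally. -/
theorem homSec_ext_row {j : Q} {L : OMod X} {U : (Opens X)ᵒᵖ}
    {α α' : homSec (vertexPre (leftB M) j) L.val U}
    (h : ∀ W f y, α.1 W f (rowToSec M j W y) = α'.1 W f (rowToSec M j W y)) : α = α' := by
  refine Subtype.ext (funext fun W => funext fun f => LinearMap.ext fun b => ?_)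
  refine sec_eq_of_locally_eq L _ _ fun x hx => ?_
  obtain ⟨W', g, hxW', y, hy⟩ := rowToSec_locally_surjective b x hx
  exact ⟨W', g, hxW', by rw [α.2, α'.2, ← hy, h]⟩

/-- A compatible family of linear maps on the rows of the presheaf of path algebras extends to
the sections of `e_j B`. -/
theorem exists_extension_row {j : Q} {L : OMod X} {U : (Opens X)ᵒᵖ}
    (A : ∀ W : (Opens X)ᵒᵖ, (U ⟶ W) → LocalRow M j W →ₗ[X.presheaf.obj W] Sec L.val W)
    (hA : ∀ {W W' : (Opens X)ᵒᵖ} (f : U ⟶ W) (g : W ⟶ W') y,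
      secRes L.val g (A W f y) = A W' (f ≫ g) (localRowRes M j g y)) :
    ∃ α : homSec (vertexPre (leftB M) j) L.val U, ∀ W f y,
      α.1 W f (rowToSec M j W y) = A W f y := by
  let G : TopCat.Sheaf Ab X.carrier := ⟨L.val.presheaf, L.isSheaf⟩
  -- An element of a row that dies in `e_j B` dies already on smaller open sets, so its image under
  -- `A` is locally zero. Hence the value on a section of `e_j B` is independent of the chosen
  -- representative.
  have hzero : ∀ (W : (Opens X)ᵒᵖ) (f : U ⟶ W) y, rowToSec M j W y = 0 → A W f y = 0 := by
    intro W f y hy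
    refine sec_eq_of_locally_eq L _ _ fun x hx => ?_
    obtain ⟨W', g, hxW', h⟩ := rowToSec_locally_injective y hy x hx
    exact ⟨W', g, hxW', by rw [hA, h, map_zero, map_zero]⟩
  have heq : ∀ (W : (Opens X)ᵒᵖ) (f : U ⟶ W) y y', rowToSec M j W y = rowToSec M j W y' →
      A W f y = A W f y' := fun W f y y' h => by
    rw [← sub_eq_zero, ← map_sub]
    exact hzero W f _ (by rw [map_sub, h, sub_self])
  -- The value at `b` is glued from the values on local representatives. It is characterised against
  -- all representatives of restrictions of `b`, not just those used for gluing, so that uniqueness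
  -- and linearity need no further choices.
  have hex : ∀ (W : (Opens X)ᵒᵖ) (f : U ⟶ W) (b : Sec (vertexPre (leftB M) j) W),
      ∃ t : Sec L.val W, ∀ (W' : (Opens X)ᵒᵖ) (g : W ⟶ W') y,
        rowToSec M j W' y = secRes (vertexPre (leftB M) j) g b →
          secRes L.val g t = A W' (f ≫ g) y := by
    intro W f b
    choose V g hV y hy using fun x : W.unop => rowToSec_locally_surjective b x.1 x.2
    have hglue : ∃ t : Sec L.val W, ∀ x, secRes L.val (g x) t = A (V x) (f ≫ g x) (y x) := by
      refine (G.existsUnique_gluing' (fun x => (V x).unop) W.unop (fun x => (g x).unop)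
        (fun x hx => Opens.mem_iSup.2 ⟨⟨x, hx⟩, hV ⟨x, hx⟩⟩)
        (fun x => A (V x) (f ≫ g x) (y x)) ?_).exists
      intro x x'
      let p : V x ⟶ op ((V x).unop ⊓ (V x').unop) := (homOfLE inf_le_left).op
      let q : V x' ⟶ op ((V x).unop ⊓ (V x').unop) := (homOfLE inf_le_right).op
      change secRes L.val p (A (V x) (f ≫ g x) (y x)) = secRes L.val q (A (V x') (f ≫ g x') (y x'))
      rw [hA, hA]
      refine heq _ _ _ _ ?_
      rw [← rowToSec_res, ← rowToSec_res, hy, hy, ← secRes_comp, ← secRes_comp]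
      rfl
    obtain ⟨t, ht⟩ := hglue
    refine ⟨t, fun W' k y' hy' => sec_eq_of_locally_eq L _ _ fun x hx => ?_⟩
    let x' : W.unop := ⟨x, k.unop.le hx⟩
    let p : W' ⟶ op (W'.unop ⊓ (V x').unop) := (homOfLE inf_le_left).op
    let q : V x' ⟶ op (W'.unop ⊓ (V x').unop) := (homOfLE inf_le_right).op
    refine ⟨op (W'.unop ⊓ (V x').unop), p, ⟨hx, hV x'⟩, ?_⟩
    rw [← secRes_comp, hA, show k ≫ p = g x' ≫ q from Subsingleton.elim _ _, secRes_comp, ht, hA]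
    refine heq _ _ _ _ ?_
    rw [← rowToSec_res, ← rowToSec_res, hy, hy', ← secRes_comp, ← secRes_comp]
    rfl
  choose t ht using hex
  have huniq : ∀ (W : (Opens X)ᵒᵖ) (f : U ⟶ W) (b : Sec (vertexPre (leftB M) j) W)
      (t' : Sec L.val W), (∀ (W' : (Opens X)ᵒᵖ) (g : W ⟶ W') y,
        rowToSec M j W' y = secRes (vertexPre (leftB M) j) g b →
          secRes L.val g t' = A W' (f ≫ g) y) → t' = t W f b := by
    intro W f b t' h
    refine sec_eq_of_locally_eq L _ _ fun x hx => ?_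
    obtain ⟨W', g, hxW', y, hy⟩ := rowToSec_locally_surjective b x hx
    exact ⟨W', g, hxW', by rw [h W' g y hy, ht W f b W' g y hy]⟩
  have hadd : ∀ W f b b', t W f (b + b') = t W f b + t W f b' := by
    intro W f b b'
    refine sec_eq_of_locally_eq L _ _ fun x hx => ?_
    obtain ⟨W₁, g₁, hxW₁, y, hy⟩ := rowToSec_locally_surjective b x hx
    obtain ⟨W', g₂, hxW', y', hy'⟩ := rowToSec_locally_surjective
      (secRes (vertexPre (leftB M) j) g₁ b') x hxW₁
    rw [← secRes_comp] at hy'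
    have hy₂ : rowToSec M j W' (localRowRes M j g₂ y) =
        secRes (vertexPre (leftB M) j) (g₁ ≫ g₂) b := by
      rw [← rowToSec_res, hy, secRes_comp]
    refine ⟨W', g₁ ≫ g₂, hxW', ?_⟩
    rw [map_add, ht W f b W' _ _ hy₂, ht W f b' W' _ _ hy', ← map_add]
    exact ht W f (b + b') W' _ _ (by rw [map_add, map_add, hy₂, hy'])
  have hsmul : ∀ W f (r : X.presheaf.obj W) b, t W f (r • b) = r • t W f b := by
    intro W f r b
    refine sec_eq_of_locally_eq L _ _ fun x hx => ?_
    obtain ⟨W', g, hxW', y, hy⟩ := rowToSec_locally_surjective b x hx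
    refine ⟨W', g, hxW', ?_⟩
    rw [map_smulₛₗ, ht W f b W' _ _ hy, ← map_smul]
    exact ht W f (r • b) W' _ _ (by rw [map_smul, map_smulₛₗ, hy])
  let α : homSec (vertexPre (leftB M) j) L.val U :=
    ⟨fun W f => { toFun := t W f, map_add' := hadd W f, map_smul' := hsmul W f },
      fun W W' f g b => huniq W' (f ≫ g) (secRes (vertexPre (leftB M) j) g b) _
        fun W'' h y hy => by
          change secRes L.val h (secRes L.val g (t W f b)) = A W'' (f ≫ g ≫ h) y
          rw [← secRes_comp]
          exact ht W f b W'' (g ≫ h) y (by rw [hy, secRes_comp])⟩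
  refine ⟨α, fun W f y => ?_⟩
  have h := ht W f (rowToSec M j W y) W (𝟙 W) y (secRes_id _ _ _).symm
  rw [secRes_id] at h
  exact h

end Rows

/-! ### Recursive construction of linear maps on the rows over a ring. -/

section RowSolution

open scoped TensorProduct DirectSum Classical

variable {Q : Type u} [Quiver.{u} Q] {R : Type u} [CommRing R]
  {M : ∀ ⦃i j : Q⦄, (i ⟶ j) → Type u}
  [∀ i j (a : i ⟶ j), AddCommGroup (M a)] [∀ i j (a : i ⟶ j), Module R (M a)]
  {L : Q → Type u} [∀ i, AddCommGroup (L i)] [∀ i, Module R (L i)]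
  (act : ∀ ⦃i j : Q⦄ (a : i ⟶ j), M a →ₗ[R] L i →ₗ[R] L j)
  (β : ∀ ⦃i j : Q⦄ (a : i ⟶ j), M a →ₗ[R] Row R M i →ₗ[R] L j) (s : ∀ i, L i)

/-- The linear maps `M_p → L_j` with `1 ↦ s_i` and `m ⊗ x ↦ m σ(x) + β(m, x)`. -/
noncomputable def pathSol {i : Q} : ∀ {j : Q} (p : Quiver.Path i j), PathMod R M p →ₗ[R] L j
  | _, .nil => LinearMap.toSpanSingleton R (L i) (s i)
  | _, .cons p a => TensorProduct.lift
      ((act a).compl₂ (pathSol p) + (β a).compl₂ (rowOf R M p))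

/-- The linear maps `e_j A → L_j` with `e_i ↦ s_i` and `m x ↦ m σ(x) + β(m, x)`. -/
noncomputable def rowSol (j : Q) : Row R M j →ₗ[R] L j :=
  DirectSum.toModule R _ _ fun q => pathSol act β s q.2

theorem rowSol_rowOf {i j : Q} (p : Quiver.Path i j) (x : PathMod R M p) :
    rowSol act β s j (rowOf R M p x) = pathSol act β s p x := by
  simp only [rowSol, rowOf, DirectSum.toModule_lof]

theorem rowSol_nil (i : Q) (r : R) :
    rowSol act β s i (rowOf R M .nil (nilOf M i r)) = r • s i := by
  rw [rowSol_rowOf]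
  rfl

/-- The recursion equation built into `pathSol` on each summand, extended additively to the row.
This is the freeness of `e_j A` as `R e_j` plus the sum of the `M_a ⊗ e_{ta} A`. -/
theorem rowSol_arrowAct {i j : Q} (a : i ⟶ j) (m : M a) (x : Row R M i) :
    rowSol act β s j (arrowAct R M a m x) = act a m (rowSol act β s i x) + β a m x := by
  induction x using row_induction with
  | zero => simp
  | add x y hx hy => simp only [map_add, hx, hy]; abel
  | of k p x =>
    rw [arrowAct_rowOf, rowSol_rowOf, rowSol_rowOf]
    rfl

end RowSolution

/-! ### Families of maps `e_i B ⟶ L_i` are free on their values at `e_i` and their image under `d`.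
-/

section Rows

variable {X : RingedSpace.{u, u}} {Q : Type u} [Quiver.{u} Q] {M : ∀ ⦃i j : Q⦄, (i ⟶ j) → OMod X}

variable (M) in
/-- The section `e_i` of `e_i B`. -/
noncomputable def unitSec (i : Q) (U : (Opens X)ᵒᵖ) : Sec (vertexPre (leftB M) i) U :=
  rowToSec M i U (rowOf _ _ .nil (nilOf _ i 1))

theorem rowToSec_nil (i : Q) (U : (Opens X)ᵒᵖ) (r : X.presheaf.obj U) :
    rowToSec M i U (rowOf _ _ .nil (nilOf _ i r)) = r • unitSec M i U := by
  rw [unitSec, ← map_smul, ← map_smul, ← map_smul, smul_eq_mul, mul_one]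

theorem localRowRes_nil (i : Q) {U W : (Opens X)ᵒᵖ} (f : U ⟶ W) (r : X.presheaf.obj U) :
    localRowRes M i f (rowOf _ _ .nil (nilOf _ i r)) =
      rowOf _ _ .nil (nilOf _ i ((X.presheaf.map f).hom r)) := by
  rw [localRowRes, rowMap_rowOf, pathModMap_nilOf]

theorem localRowRes_arrowAct {i j : Q} (a : i ⟶ j) {U W : (Opens X)ᵒᵖ} (f : U ⟶ W)
    (m : Sec (M a).val U) (y : LocalRow M i U) :
    localRowRes M j f (arrowAct _ _ a m y) =
      arrowAct _ _ a (secRes (M a).val f m) (localRowRes M i f y) :=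
  rowMap_arrowAct _ _ _ _ _

theorem unitSec_res (i : Q) {U W : (Opens X)ᵒᵖ} (f : U ⟶ W) :
    secRes (vertexPre (leftB M) i) f (unitSec M i U) = unitSec M i W := by
  rw [unitSec, rowToSec_res, localRowRes_nil, map_one, unitSec]

/-- The action `(m, v) ↦ φ_a(m ⊗ v)` of the sections of `M_a` on a twisted `Q`-sheaf. -/
noncomputable def TwistedQSheaf.act (T : TwistedQSheaf M) {i j : Q} (a : i ⟶ j)
    (U : (Opens X)ᵒᵖ) : Sec (M a).val U →ₗ[X.presheaf.obj U] Sec (T.obj i).val U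
      →ₗ[X.presheaf.obj U] Sec (T.obj j).val U :=
  (tensorMk (M a).val (T.obj i).val U).compr₂ (secMap (tensorSheafRes (T.φ a)) U)

theorem TwistedQSheaf.act_res (T : TwistedQSheaf M) {i j : Q} (a : i ⟶ j) {U W : (Opens X)ᵒᵖ}
    (f : U ⟶ W) (m : Sec (M a).val U) (v : Sec (T.obj i).val U) :
    secRes (T.obj j).val f (T.act a U m v) =
      T.act a W (secRes (M a).val f m) (secRes (T.obj i).val f v) :=
  secMap_res (tensorSheafRes (T.φ a)) f (tensorMk (M a).val (T.obj i).val U m v)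

/-- The sections of the sheaves `Hom(e_i B, L_i)`, for the `𝒪_X`-modules `L_i` of a twisted
`Q`-sheaf. -/
abbrev VertexHoms (T : TwistedQSheaf M) (U : (Opens X)ᵒᵖ) : Type u :=
  ∀ i, homSec (vertexPre (leftB M) i) (T.obj i).val U

/-- The sections of the sheaves `Hom(M_a ⊗ e_i B, L_j)`, for the `𝒪_X`-modules `L_i` of a twisted
`Q`-sheaf. -/
abbrev ArrowHoms (T : TwistedQSheaf M) (U : (Opens X)ᵒᵖ) : Type u :=
  ∀ ⦃i j : Q⦄ (a : i ⟶ j),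
    homSec (tensorPre (M a).val (vertexPre (leftB M) i)) (T.obj j).val U

/-- Uniqueness in the recursion: the values at `e_i` start it, and the arrow equation determines
`α_j` on `m x` from `α_i` on `x`. -/
theorem VertexHoms.eq_of_unit {T : TwistedQSheaf M} {U : (Opens X)ᵒᵖ} {α α' : VertexHoms T U}
    (h : ∀ i, (α i).1 U (𝟙 U) (unitSec M i U) = (α' i).1 U (𝟙 U) (unitSec M i U))
    (ha : ∀ {i j : Q} (a : i ⟶ j) (W : (Opens X)ᵒᵖ) (f : U ⟶ W) m x,
      (α j).1 W f (arrowBilin (leftB M) a W m x) - T.act a W m ((α i).1 W f x) =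
        (α' j).1 W f (arrowBilin (leftB M) a W m x) - T.act a W m ((α' i).1 W f x)) :
    α = α' := by
  refine funext fun j => homSec_ext_row fun W f y => ?_
  induction j, y using row_arrow_induction with
  | zero j => simp
  | add j x y hx hy => simp only [map_add, hx, hy]
  | nil i r =>
    rw [rowToSec_nil, map_smul, map_smul, ← unitSec_res i f]
    have h1 := (α i).2 U W (𝟙 U) f (unitSec M i U)
    have h2 := (α' i).2 U W (𝟙 U) f (unitSec M i U)
    rw [h i] at h1
    exact congrArg (r • ·) (h1.symm.trans h2)
  | arrow i j a m x ih =>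
    have h3 := ha a W f m (rowToSec M i W x)
    rw [ih] at h3
    rw [rowToSec_arrowAct]
    exact sub_left_injective h3

/-- Existence in the recursion, solved on the presheaf rows over each `W ⊆ U` and then extended to
`e_j B`. Together with uniqueness this replaces any exactness statement for the columns of the
double complex. -/
theorem exists_vertexHoms (T : TwistedQSheaf M) {U : (Opens X)ᵒᵖ} (β : ArrowHoms T U)
    (s : ∀ i, Sec (T.obj i).val U) :
    ∃ α : VertexHoms T U, (∀ i, (α i).1 U (𝟙 U) (unitSec M i U) = s i) ∧
      ∀ {i j : Q} (a : i ⟶ j) (W : (Opens X)ᵒᵖ) (f : U ⟶ W) m x,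
        (α j).1 W f (arrowBilin (leftB M) a W m x) - T.act a W m ((α i).1 W f x) =
          (β a).1 W f (tensorMk _ _ W m x) := by
  let A : ∀ (j : Q) (W : (Opens X)ᵒᵖ), (U ⟶ W) →
      LocalRow M j W →ₗ[X.presheaf.obj W] Sec (T.obj j).val W := fun j W f =>
    rowSol (L := fun i => Sec (T.obj i).val W) (fun i j a => T.act a W)
      (fun i j a => ((tensorMk (M a).val (vertexPre (leftB M) i) W).compl₂
        (rowToSec M i W)).compr₂ ((β a).1 W f)) (fun i => secRes (T.obj i).val f (s i)) j
  have hnil : ∀ (j : Q) (W : (Opens X)ᵒᵖ) (f : U ⟶ W) r,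
      A j W f (rowOf _ _ .nil (nilOf _ j r)) = r • secRes (T.obj j).val f (s j) :=
    fun j W f r => rowSol_nil _ _ _ _ _
  have harr : ∀ {i j : Q} (a : i ⟶ j) (W : (Opens X)ᵒᵖ) (f : U ⟶ W) m y,
      A j W f (arrowAct _ _ a m y) = T.act a W m (A i W f y) +
        (β a).1 W f (tensorMk _ _ W m (rowToSec M i W y)) :=
    fun a W f m y => rowSol_arrowAct _ _ _ _ _ _
  -- The solutions over different open sets are compatible because their restrictions obey the same
  -- recursion with the same initial values.
  have hA : ∀ (j : Q) {W W' : (Opens X)ᵒᵖ} (f : U ⟶ W) (g : W ⟶ W') y,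
      secRes (T.obj j).val g (A j W f y) = A j W' (f ≫ g) (localRowRes M j g y) := by
    intro j W W' f g y
    induction j, y using row_arrow_induction with
    | zero j => simp
    | add j x y hx hy => simp only [map_add, hx, hy]
    | nil i r =>
      rw [localRowRes_nil, hnil, hnil, map_smulₛₗ, secRes_comp]
    | arrow i j a m x ih =>
      rw [localRowRes_arrowAct, harr, harr, map_add, T.act_res, ih, (β a).2, tensorMk_res,
        rowToSec_res]
  choose α hα using fun j => exists_extension_row (L := T.obj j) (A j) (hA j)
  refine ⟨α, fun i => ?_, fun {i j} a W f m x => ?_⟩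
  · refine (hα i U (𝟙 U) _).trans ((hnil i U (𝟙 U) 1).trans ?_)
    rw [one_smul, secRes_id]
  -- A section `x` of `e_i B` comes from a row only locally, so the arrow equation is checked near
  -- each point.
  · refine sec_eq_of_locally_eq (T.obj j) _ _ fun p hp => ?_
    obtain ⟨W', g, hpW', y, hy⟩ := rowToSec_locally_surjective x p hp
    refine ⟨W', g, hpW', ?_⟩
    have e : secRes (vertexPre (leftB M) j) g (arrowBilin (leftB M) a W m x) =
        rowToSec M j W' (arrowAct _ _ a (secRes (M a).val g m) y) := by
      rw [rowToSec_arrowAct, hy]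
      exact (secMap_res (arrowPre (leftB M) a) g (tensorMk _ _ W m x)).trans rfl
    rw [map_sub, T.act_res, (α j).2, (α i).2, (β a).2, tensorMk_res, e, ← hy, hα, hα, harr]
    exact add_sub_cancel_left _ _

end Rows

/-! ### Injectivity of the modules `Hom(e_i B, L)` and `Hom(N ⊗ e_i B, L)`. -/

section Injectives

variable {X : RingedSpace.{u, u}}

section General

variable {B : Sheaf (Opens.grothendieckTopology X) RingCat.{u}}

/-- The values of a morphism to a sheaf `Hom(F, L)`. -/
noncomputable def homVal {V : SheafOfModules.{u} B} {F : RightModule B} {L : OMod X}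
    (k : V ⟶ homSheaf F L) (U : (Opens X)ᵒᵖ) : V.val.obj U →+ homSec F.mod L.val U :=
  secApp k U

theorem homVal_smul {V : SheafOfModules.{u} B} {F : RightModule B} {L : OMod X}
    (k : V ⟶ homSheaf F L) (U : (Opens X)ᵒᵖ) (b : B.obj.obj U) (v : V.val.obj U) :
    homVal k U (b • v) = b • homVal k U v :=
  map_smul (k.val.app U).hom b v

theorem homVal_res {V : SheafOfModules.{u} B} {F : RightModule B} {L : OMod X}
    (k : V ⟶ homSheaf F L) {U W W' : (Opens X)ᵒᵖ} (f : U ⟶ W) (g : W ⟶ W') (v : V.val.obj U) :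
    (homVal k W (V.val.presheaf.map f v)).1 W' g = (homVal k U v).1 W' (f ≫ g) :=
  congrArg (fun φ : homSec F.mod L.val W => φ.1 W' g) (PresheafOfModules.naturality_apply k.val f v)

/-- The values of a morphism to a sheaf `Hom(F, L)`, as linear maps on the sections over one open
set. -/
noncomputable def valAt {V : SheafOfModules.{u} B} {F : RightModule B} {L : OMod X}
    (k : V ⟶ homSheaf F L) (U : (Opens X)ᵒᵖ) :
    V.val.obj U →+ (Sec F.mod U →ₗ[X.presheaf.obj U] Sec L.val U) where
  toFun v := (homVal k U v).1 U (𝟙 U)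
  map_zero' := by rw [map_zero]; rfl
  map_add' v w := by rw [map_add]; rfl

theorem valAt_smul {V : SheafOfModules.{u} B} {F : RightModule B} {L : OMod X}
    (k : V ⟶ homSheaf F L) (U : (Opens X)ᵒᵖ) (b : B.obj.obj U) (v : V.val.obj U)
    (x : Sec F.mod U) : valAt k U (b • v) x = valAt k U v ((F.rmul U b).unop x) := by
  change (homVal k U (b • v)).1 U (𝟙 U) x = (homVal k U v).1 U (𝟙 U) _
  rw [homVal_smul, homSec_smul_apply]
  exact congrArg (fun b => (homVal k U v).1 U (𝟙 U) ((F.rmul U b).unop x))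
    (ConcreteCategory.congr_hom (B.obj.map_id U) b)

theorem homVal_eq {V : SheafOfModules.{u} B} {F : RightModule B} {L : OMod X}
    (k : V ⟶ homSheaf F L) {U W : (Opens X)ᵒᵖ} (f : U ⟶ W) (v : V.val.obj U) (x : Sec F.mod W) :
    (homVal k U v).1 W f x = valAt k W (show V.val.obj W from V.val.presheaf.map f v) x :=
  (congrArg (fun φ : Sec F.mod W →ₗ[X.presheaf.obj W] Sec L.val W => φ x)
    (homVal_res k f (𝟙 W) v)).symm

theorem valAt_res {V : SheafOfModules.{u} B} {F : RightModule B} {L : OMod X}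
    (k : V ⟶ homSheaf F L) {U W : (Opens X)ᵒᵖ} (f : U ⟶ W) (v : V.val.obj U) (x : Sec F.mod U) :
    secRes L.val f (valAt k U v x) =
      valAt k W (show V.val.obj W from V.val.presheaf.map f v) (secRes F.mod f x) :=
  ((homVal k U v).2 U W (𝟙 U) f x).trans (homVal_eq k f v _)

end General

variable {Q : Type u} [Quiver.{u} Q] {M : ∀ ⦃i j : Q⦄, (i ⟶ j) → OMod X}

theorem secApp_smul {V W : SheafOfModules.{u} (pathSheaf M)} (k : V ⟶ W)
    (U : (Opens X)ᵒᵖ) (b : (pathSheaf M).obj.obj U) (v : V.val.obj U) :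
    secApp k U (b • v) = b • secApp k U v :=
  map_smul (k.val.app U).hom b v

theorem secApp_res {V W : SheafOfModules.{u} (pathSheaf M)} (k : V ⟶ W)
    {U U' : (Opens X)ᵒᵖ} (f : U ⟶ U') (v : V.val.obj U) :
    secApp k U' (modRes V.val f v) = modRes W.val f (secApp k U v) :=
  PresheafOfModules.naturality_apply k.val f v

/-- The map on sections of `e_i V` induced by a morphism of `B`-modules. -/
noncomputable def vertexSecMap {V W : SheafOfModules.{u} (pathSheaf M)} (k : V ⟶ W) (i : Q)
    (U : (Opens X)ᵒᵖ) : Sec (vertexPre V.val i) U →ₗ[X.presheaf.obj U] Sec (vertexPre W.val i) U where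
  toFun v := vertexMk (secApp k U (vertexVal v)) (by
    rw [IsAtVertex, ← secApp_smul k, vertexVal_prop v])
  map_add' v w := vertexVal_injective (map_add (secApp k U) _ _)
  map_smul' r v := vertexVal_injective (secApp_smul k _ _ _)

/-- The morphism `V_i → W_i` induced by a morphism `V → W` of `B`-modules. -/
noncomputable def vertexMap {V W : SheafOfModules.{u} (pathSheaf M)} (k : V ⟶ W) (i : Q) :
    vertexSheaf V i ⟶ vertexSheaf W i where
  val := PresheafOfModules.homMk (M₁ := vertexPre V.val i) (M₂ := vertexPre W.val i)
    { app U := AddCommGrpCat.ofHom (vertexSecMap k i U).toAddMonoidHom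
      naturality U U' f := by
        refine AddCommGrpCat.hom_ext (AddMonoidHom.ext fun v => ?_)
        exact vertexVal_injective (secApp_res k f (vertexVal v)) }
    (fun _ r v => map_smul (vertexSecMap k i _) r v)

instance mono_vertexMap {V W : SheafOfModules.{u} (pathSheaf M)} (k : V ⟶ W) [Mono k] (i : Q) :
    Mono (vertexMap k i) :=
  mono_of_injective _ fun _ _ _ e => vertexVal_injective
    (injective_of_mono k _ (congrArg vertexVal e))

theorem epsMap_naturality {V W : SheafOfModules.{u} (pathSheaf M)} (k : V ⟶ W) (i : Q) :
    k ≫ epsMap W i = epsMap V i ≫ homMap (vertexRight M i) (vertexMap k i) :=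
  toHomSheaf_ext fun U v W' f x => by
    refine vertexVal_injective ?_
    change ringVal x • modRes W.val f (secApp k U v) =
      secApp k W' (ringVal x • modRes V.val f v)
    rw [secApp_smul k, secApp_res]

theorem ringVal_unitSec_mul (i : Q) {U : (Opens X)ᵒᵖ} (x : Sec (vertexPre (leftB M) i) U) :
    rightMul i (ringVal x) (unitSec M i U) = x :=
  ringVal_injective (secVertex_mul_ringVal x)

/-- Scalars commute with `e_i`; this makes evaluation at `e_i` linear over `𝒪_X`. -/
theorem rightMul_secScalar (i : Q) {U : (Opens X)ᵒᵖ} (r : X.presheaf.obj U) :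
    rightMul i (secScalar M U r) (unitSec M i U) = r • unitSec M i U :=
  ringVal_injective (secVertex_mul_scalar i U r)

/-- The morphism `V_i → L`, `v ↦ k(v)(e_i)`, given by a morphism `k : V → Hom(e_i B, L)`. -/
noncomputable def evalUnit {V : SheafOfModules.{u} (pathSheaf M)} {i : Q} {L : OMod X}
    (k : V ⟶ homSheaf (vertexRight M i) L) : vertexSheaf V i ⟶ L where
  val := PresheafOfModules.homMk (M₁ := vertexPre V.val i) (M₂ := L.val)
    { app U := AddCommGrpCat.ofHom (AddMonoidHom.mk'
        (fun v : Sec (vertexPre V.val i) U => valAt k U (vertexVal v) (unitSec M i U))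
        fun v w => congrArg (fun φ => φ (unitSec M i U))
          ((congrArg (valAt k U) (map_add vertexVal v w)).trans (map_add (valAt k U) _ _)))
      naturality U W f := by
        refine AddCommGrpCat.hom_ext (AddMonoidHom.ext fun v : Sec (vertexPre V.val i) U => ?_)
        refine Eq.trans ?_ (valAt_res k f (vertexVal v) (unitSec M i U)).symm
        exact congrArg (valAt k W (show V.val.obj W from V.val.presheaf.map f (vertexVal v)))
          (unitSec_res i f).symm }
    (fun _ (r : X.presheaf.obj _) (v : Sec (vertexPre V.val i) _) =>
      (valAt_smul k _ (secScalar M _ r) (vertexVal v) (unitSec M i _)).trans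
        ((congrArg (valAt k _ (vertexVal v)) (rightMul_secScalar i r)).trans
          (map_smul (valAt k _ (vertexVal v)) r (unitSec M i _))))

/-- Since `x = e_i x` in `e_i B`, linearity of `k` gives `k(v)(x) = (x k(v))(e_i) = k(x v)(e_i)`. So
`k` is recovered from its evaluation at `e_i`. -/
theorem epsMap_evalUnit {V : SheafOfModules.{u} (pathSheaf M)} {i : Q} {L : OMod X}
    (k : V ⟶ homSheaf (vertexRight M i) L) :
    epsMap V i ≫ homMap (vertexRight M i) (evalUnit k) = k :=
  toHomSheaf_ext fun _ v W f (x : Sec (vertexPre (leftB M) i) W) =>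
    (valAt_smul k W (ringVal x) (modRes V.val f v) (unitSec M i W)).trans
      ((congrArg (valAt k W (modRes V.val f v)) (ringVal_unitSec_mul i x)).trans
        (homVal_eq k f v x).symm)

/-- Extending `k` along `f` amounts to extending `evalUnit k` along the mono `V_i ⟶ W_i`, which
injectivity of `L` allows. -/
instance injective_homSheaf_vertexRight (i : Q) (L : OMod X) [Injective L] :
    Injective (homSheaf (vertexRight M i) L) where
  factors {V W} k f _ := by
    refine ⟨epsMap W i ≫ homMap _ (Injective.factorThru (evalUnit k) (vertexMap f i)), ?_⟩
    rw [← Category.assoc, epsMap_naturality, Category.assoc, ← homMap_comp,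
      Injective.comp_factorThru, epsMap_evalUnit]

/-- The bilinear map `(n, v) ↦ k(v)(n ⊗ e_i)` given by a morphism `k : V → Hom(N ⊗ e_i B, L)`. -/
noncomputable def evalTensorBilin {V : SheafOfModules.{u} (pathSheaf M)} {i : Q} {N L : OMod X}
    (k : V ⟶ homSheaf (tensorRight N (vertexRight M i)) L) (U : (Opens X)ᵒᵖ) :
    Sec N.val U →ₗ[X.presheaf.obj U] Sec (vertexPre V.val i) U →ₗ[X.presheaf.obj U] Sec L.val U :=
  LinearMap.mk₂ _ (fun n v => valAt k U (vertexVal v)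
      (tensorMk N.val (vertexPre (leftB M) i) U n (unitSec M i U)))
    (fun n n' v => (congrArg (valAt k U (vertexVal v)) (congrArg (fun φ => φ (unitSec M i U))
      (map_add (tensorMk N.val (vertexPre (leftB M) i) U) n n'))).trans
        (map_add (valAt k U (vertexVal v)) _ _))
    (fun r n v => (congrArg (valAt k U (vertexVal v)) (congrArg (fun φ => φ (unitSec M i U))
      (map_smul (tensorMk N.val (vertexPre (leftB M) i) U) r n))).trans
        (map_smul (valAt k U (vertexVal v)) r
          (tensorMk N.val (vertexPre (leftB M) i) U n (unitSec M i U))))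
    (fun n v v' => LinearMap.congr_fun
      ((congrArg (valAt k U) (map_add vertexVal v v')).trans (map_add (valAt k U) _ _))
      (tensorMk N.val (vertexPre (leftB M) i) U n (unitSec M i U)))
    (fun r n v => (valAt_smul k U (secScalar M U r) (vertexVal v)
        (tensorMk N.val (vertexPre (leftB M) i) U n (unitSec M i U))).trans
      ((congrArg (valAt k U (vertexVal v))
        ((congrArg (tensorMk N.val (vertexPre (leftB M) i) U n) (rightMul_secScalar i r)).trans
          (map_smul (tensorMk N.val (vertexPre (leftB M) i) U n) r _))).trans
          (map_smul (valAt k U (vertexVal v)) r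
            (tensorMk N.val (vertexPre (leftB M) i) U n (unitSec M i U)))))

theorem evalTensorBilin_res {V : SheafOfModules.{u} (pathSheaf M)} {i : Q} {N L : OMod X}
    (k : V ⟶ homSheaf (tensorRight N (vertexRight M i)) L) {U W : (Opens X)ᵒᵖ} (f : U ⟶ W)
    (n : Sec N.val U) (v : Sec (vertexPre V.val i) U) :
    secRes L.val f (evalTensorBilin k U n v) =
      evalTensorBilin k W (secRes N.val f n) (secRes (vertexPre V.val i) f v) :=
  (valAt_res k f (vertexVal v) (tensorMk N.val (vertexPre (leftB M) i) U n (unitSec M i U))).trans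
    (congrArg (valAt k W (show V.val.obj W from V.val.presheaf.map f (vertexVal v)))
      ((tensorMk_res N.val (vertexPre (leftB M) i) f n (unitSec M i U)).trans
        (congrArg (tensorMk N.val (vertexPre (leftB M) i) W _) (unitSec_res i f))))

/-- The morphism `N ⊗ V_i → L`, `n ⊗ v ↦ k(v)(n ⊗ e_i)`, given by a morphism
`k : V → Hom(N ⊗ e_i B, L)`. -/
noncomputable def evalTensorUnit {V : SheafOfModules.{u} (pathSheaf M)} {i : Q} {N L : OMod X}
    (k : V ⟶ homSheaf (tensorRight N (vertexRight M i)) L) :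
    tensorSheaf N (vertexSheaf V i) ⟶ L :=
  tensorSheafDesc (tensorPreDesc (N := N.val) (F := vertexPre V.val i) (L := L.val)
    (evalTensorBilin k) fun _ _ f n v => evalTensorBilin_res k f n v)

theorem evalTensorUnit_mk {V : SheafOfModules.{u} (pathSheaf M)} {i : Q} {N L : OMod X}
    (k : V ⟶ homSheaf (tensorRight N (vertexRight M i)) L) (U : (Opens X)ᵒᵖ)
    (n : Sec N.val U) (v : Sec (vertexPre V.val i) U) :
    secMap (tensorSheafRes (evalTensorUnit k)) U (tensorMk N.val (vertexPre V.val i) U n v) =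
      evalTensorBilin k U n v :=
  congrArg (fun g => secMap g U (tensorMk N.val (vertexPre V.val i) U n v))
    (tensorSheafRes_desc (N := N) (F := vertexSheaf V i) (L := L) _)

/-- The tensor form of the same identity: `k(x v)(n ⊗ e_i) = k(v)(n ⊗ e_i x) = k(v)(n ⊗ x)`. -/
theorem tensorCompSec_evalTensorUnit {V : SheafOfModules.{u} (pathSheaf M)} {i : Q} {N L : OMod X}
    (k : V ⟶ homSheaf (tensorRight N (vertexRight M i)) L) (W : (Opens X)ᵒᵖ) (v : V.val.obj W) :
    tensorCompSec (L := vertexSheaf V i) (evalTensorUnit k) W (smulSec V.val i v) =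
      (valAt k W v : Sec (tensorPre N.val (vertexPre (leftB M) i)) W →ₗ[X.presheaf.obj W]
        Sec L.val W) :=
  tensor_ext fun n x =>
    (tensorCompSec_mk (L := vertexSheaf V i) (evalTensorUnit k) W (smulSec V.val i v) n x).trans
      ((evalTensorUnit_mk k W n (smulSec V.val i v x)).trans
        ((valAt_smul k W (ringVal x) v
          (tensorMk N.val (vertexPre (leftB M) i) W n (unitSec M i W))).trans
            (congrArg (valAt k W v) (congrArg (tensorMk N.val (vertexPre (leftB M) i) W n)
              (ringVal_unitSec_mul i x)))))

theorem epsMap_evalTensorUnit {V : SheafOfModules.{u} (pathSheaf M)} {i : Q} {N L : OMod X}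
    (k : V ⟶ homSheaf (tensorRight N (vertexRight M i)) L) :
    epsMap V i ≫ homTensor (vertexRight M i) (evalTensorUnit k) = k :=
  toHomSheaf_ext fun _ v W f x =>
    (LinearMap.congr_fun (tensorCompSec_evalTensorUnit k W (modRes V.val f v)) x).trans
      (homVal_eq k f v x).symm

/-- Here the extension takes place along `N ⊗ V_i ⟶ N ⊗ W_i`, which is mono because `N` is locally
free. -/
theorem injective_homSheaf_tensorRight {N : OMod X} (hN : N.IsLocallyFree) (i : Q) (L : OMod X)
    [Injective L] : Injective (homSheaf (tensorRight N (vertexRight M i)) L) where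
  factors {V W} k f _ := by
    have := mono_tensorSheafMap hN (vertexMap f i)
    refine ⟨epsMap W i ≫ homTensor _
      (Injective.factorThru (evalTensorUnit k) (tensorSheafMap N (vertexMap f i))), ?_⟩
    rw [← Category.assoc, epsMap_naturality, Category.assoc, homMap_homTensor,
      Injective.comp_factorThru, epsMap_evalTensorUnit]

variable [Finite Q] [∀ i j : Q, Finite (i ⟶ j)]

theorem injective_totalX (hM : ∀ ⦃i j : Q⦄ (a : i ⟶ j), (M a).IsLocallyFree)
    {V : SheafOfModules.{u} (pathSheaf M)} (J : VertexResolutions V) (n : ℕ) :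
    Injective (totalX J n) := by
  have hJ : ∀ i q, Injective (J.obj i q) := fun i q => (J i).injective q
  have h0 : ∀ q, Injective (column0 J q) := fun q => inferInstance
  have ha : ∀ (a : Arrows Q) q, Injective (homSheaf (arrowRight M a.2.2) (J.obj a.2.1 q)) :=
    fun a q => injective_homSheaf_tensorRight (hM a.2.2) a.1 _
  have h1 : ∀ q, Injective (column1 J q) := fun q => inferInstance
  cases n with
  | zero => exact h0 0
  | succ n =>
    have := h0 (n + 1)
    have := h1 n
    exact inferInstanceAs (Injective (column0 J (n + 1) ⊞ column1 J n))

end Injectives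

/-! ### Comparison of complexes and augmented resolutions in an abelian category. -/

section HomologicalAlgebra

variable {C : Type*} [Category C] [Abelian C]

/-- A morphism `A → B` extends to a morphism from an exact complex `A → P^•` to a complex
`B → I^•` of injective objects. -/
theorem exists_chain_lift {P I : ℕ → C} (d : ∀ n, P n ⟶ P (n + 1)) (δ : ∀ n, I n ⟶ I (n + 1))
    (hd : ∀ n, d n ≫ d (n + 1) = 0) (hδ : ∀ n, δ n ≫ δ (n + 1) = 0) [∀ n, Injective (I n)]
    (hex : ∀ n, (ShortComplex.mk (d n) (d (n + 1)) (hd n)).Exact) {A B : C} (ε : A ⟶ P 0)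
    (η : B ⟶ I 0) [Mono ε] (hε : ε ≫ d 0 = 0) (hη : η ≫ δ 0 = 0)
    (hex₀ : (ShortComplex.mk ε (d 0) hε).Exact) (f : A ⟶ B) :
    ∃ φ : ∀ n, P n ⟶ I n, (∀ n, d n ≫ φ (n + 1) = φ n ≫ δ n) ∧ ε ≫ φ 0 = f ≫ η := by
  let φ₀ : P 0 ⟶ I 0 := Injective.factorThru (f ≫ η) ε
  have h₀ : ε ≫ φ₀ = f ≫ η := Injective.comp_factorThru _ _
  have w₀ : ε ≫ φ₀ ≫ δ 0 = 0 := by rw [← Category.assoc, h₀, Category.assoc, hη, comp_zero]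
  let φ₁ : P 1 ⟶ I 1 := hex₀.descToInjective (φ₀ ≫ δ 0) w₀
  have h₁ : d 0 ≫ φ₁ = φ₀ ≫ δ 0 := hex₀.comp_descToInjective _ _
  have step : ∀ n (p : {p : (P n ⟶ I n) × (P (n + 1) ⟶ I (n + 1)) // d n ≫ p.2 = p.1 ≫ δ n}),
      d n ≫ p.1.2 ≫ δ (n + 1) = 0 := fun n p => by
    rw [← Category.assoc, p.2, Category.assoc, hδ, comp_zero]
  -- The recursion carries two consecutive components and their commutation relation, since the next
  -- component exists only because of that relation.
  let seq : ∀ n, {p : (P n ⟶ I n) × (P (n + 1) ⟶ I (n + 1)) // d n ≫ p.2 = p.1 ≫ δ n} :=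
    fun n => Nat.rec ⟨(φ₀, φ₁), h₁⟩ (fun n p =>
      ⟨(p.1.2, (hex n).descToInjective (p.1.2 ≫ δ (n + 1)) (step n p)),
        (hex n).comp_descToInjective _ _⟩) n
  exact ⟨fun n => (seq n).1.1, fun n => (seq n).2, h₀⟩

/-- Transports exactness along propositional equalities of the maps, as needed for the differentials
of `CochainComplex.of`. -/
theorem exact_congr {X Y Z : C} {f f' : X ⟶ Y} {g g' : Y ⟶ Z} {w : f ≫ g = 0} (hf : f = f')
    (hg : g = g') (h : ∀ w', (ShortComplex.mk f' g' w').Exact) : (ShortComplex.mk f g w).Exact := by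
  subst hf hg
  exact h w

/-- In degree `0` a quasi-isomorphism means exactness of `0 ⟶ Z ⟶ K⁰ ⟶ K¹`; in positive degrees the
source is exact, so it means exactness of `K`. -/
theorem quasiIso_fromSingle₀ {Z : C} (K : CochainComplex C ℕ)
    (f : { f : Z ⟶ K.X 0 // f ≫ K.d 0 1 = 0 }) [Mono f.1]
    (h₀ : (ShortComplex.mk f.1 (K.d 0 1) f.2).Exact)
    (h : ∀ n, (ShortComplex.mk _ _ (K.d_comp_d n (n + 1) (n + 2))).Exact) :
    QuasiIso ((K.fromSingle₀Equiv Z).symm f) where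
  quasiIsoAt n := by
    cases n
    · rw [CochainComplex.quasiIsoAt₀_iff, ShortComplex.quasiIso_iff_of_zeros]
      · refine (ShortComplex.exact_and_mono_f_iff_of_iso ?_).2 ⟨h₀, by dsimp; infer_instance⟩
        exact ShortComplex.isoMk (Iso.refl _) (Iso.refl _) (Iso.refl _)
          ((Category.id_comp _).trans (Eq.trans
            (CochainComplex.fromSingle₀Equiv_symm_apply_f_zero f.1 f.2).symm (Category.comp_id _).symm))
          ((Category.id_comp _).trans (Category.comp_id _).symm)
      · rfl
      · rfl
      · exact K.shape _ _ (by simp)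
    · rw [quasiIsoAt_iff_exactAt]
      · exact (HomologicalComplex.exactAt_iff' _ _ _ _ (by simp)
          (by simp only [CochainComplex.next]; rfl)).2 (h _)
      · apply CochainComplex.exactAt_succ_single_obj

end HomologicalAlgebra

/-! ### Existence of the resolutions `V_i^•` and of the lifts `φ_a^•`. -/

section Lifts

variable {X : RingedSpace.{u, u}} {Q : Type u} [Quiver.{u} Q] {M : ∀ ⦃i j : Q⦄, (i ⟶ j) → OMod X}

theorem tensorSheafMap_zero (N F F' : OMod X) : tensorSheafMap N (0 : F ⟶ F') = 0 := by
  refine (PresheafOfModules.sheafificationHomEquiv (𝟙 (strSheaf X).obj)).injective ?_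
  have h0 : tensorSheafRes (N := N) (F := F) (0 : tensorSheaf N F ⟶ tensorSheaf N F') = 0 := by
    rw [tensorSheafRes_eq]
    exact comp_zero
  have h : tensorSheafRes (N := N) (F := F) (tensorSheafMap N (0 : F ⟶ F') ≫ 𝟙 _) = 0 := by
    rw [tensorSheafRes_map_comp]
    refine PresheafOfModules.hom_ext fun U => ModuleCat.hom_ext ?_
    refine tensor_ext (P := Sec (tensorSheaf N F').val U)
      (f := secMap (tensorSheafRes (𝟙 (tensorSheaf N F'))) U ∘ₗ tensorPreMap N (0 : F ⟶ F') U)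
      (g := 0) fun n x => ?_
    rw [LinearMap.comp_apply, tensorPreMap_zero]
    simp
  rw [Category.comp_id] at h
  exact h.trans h0.symm

theorem nonempty_vertexResolutions (V : SheafOfModules.{u} (pathSheaf M)) :
    Nonempty (VertexResolutions V) :=
  ⟨fun i => InjectiveResolution.of (vertexSheaf V i)⟩

variable [Finite Q] [∀ i j : Q, Finite (i ⟶ j)]

/-- `M_a ⊗ V_i ⟶ M_a ⊗ V_i^•` stays exact as `M_a` is locally free, and `V_j^•` consists of
injectives, so the comparison lemma applies. -/
theorem exists_arrow_lift {V : SheafOfModules.{u} (pathSheaf M)} (J : VertexResolutions V)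
    {i j : Q} (a : i ⟶ j) (ha : (M a).IsLocallyFree) :
    ∃ φ : ∀ q, tensorSheaf (M a) (J.obj i q) ⟶ J.obj j q,
      (∀ q, tensorSheafMap (M a) (J.δ i q) ≫ φ (q + 1) = φ q ≫ J.δ j q) ∧
        tensorSheafMap (M a) (J.aug i) ≫ φ 0 = arrowMap V a ≫ J.aug j := by
  have : ∀ q, Injective (J.obj j q) := fun q => (J j).injective q
  have : Mono (J.aug i) := inferInstanceAs (Mono ((J i).ι.f 0))
  have : Mono (tensorSheafMap (M a) (J.aug i)) := mono_tensorSheafMap ha _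
  have hd : ∀ q, tensorSheafMap (M a) (J.δ i q) ≫ tensorSheafMap (M a) (J.δ i (q + 1)) = 0 :=
    fun q => by
      rw [← tensorSheafMap_comp, (J i).complex_d_comp q, tensorSheafMap_zero]
  have hε : tensorSheafMap (M a) (J.aug i) ≫ tensorSheafMap (M a) (J.δ i 0) = 0 := by
    rw [← tensorSheafMap_comp, aug_δ, tensorSheafMap_zero]
  exact exists_chain_lift (fun q => tensorSheafMap (M a) (J.δ i q)) (J.δ j) hd
    (fun q => (J j).complex_d_comp q)
    (fun q => tensorSheafMap_exact ha _ ((J i).exact_succ q) (hd q))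
    (tensorSheafMap (M a) (J.aug i)) (J.aug j) hε (aug_δ J j)
    (tensorSheafMap_exact ha _ (J i).exact₀ hε) (arrowMap V a)

theorem nonempty_arrowLifts (hM : ∀ ⦃i j : Q⦄ (a : i ⟶ j), (M a).IsLocallyFree)
    {V : SheafOfModules.{u} (pathSheaf M)} (J : VertexResolutions V) : Nonempty (ArrowLifts J) := by
  choose φ h h₀ using fun (i j : Q) (a : i ⟶ j) => exists_arrow_lift J a (hM a)
  exact ⟨⟨φ, h, h₀⟩⟩

end Lifts

/-! ### Sections of finite direct sums. -/

section BiproductSections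

variable {X : RingedSpace.{u, u}} {B : Sheaf (Opens.grothendieckTopology X) RingCat.{u}}

theorem secApp_comp {F G H : SheafOfModules.{u} B} (f : F ⟶ G) (g : G ⟶ H) (U : (Opens X)ᵒᵖ)
    (s : F.val.obj U) : secApp (f ≫ g) U s = secApp g U (secApp f U s) := rfl

theorem exists_freeOn {F : SheafOfModules.{u} B} {U : (Opens X)ᵒᵖ} (s : F.val.obj U) :
    ∃ k : freeOn B U.unop ⟶ F, freeOnEquiv k = s :=
  ⟨freeOnEquiv.symm s, freeOnEquiv.apply_symm_apply s⟩

/-- Sections are morphisms out of `freeOn`, so the universal property of the biproduct as a product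
applies directly. -/
theorem biproduct_section_ext {ι : Type*} [Finite ι] {F : ι → SheafOfModules.{u} B}
    {U : (Opens X)ᵒᵖ} {s t : (⨁ F).val.obj U}
    (h : ∀ i, secApp (biproduct.π F i) U s = secApp (biproduct.π F i) U t) : s = t := by
  obtain ⟨s, rfl⟩ := exists_freeOn s
  obtain ⟨t, rfl⟩ := exists_freeOn t
  refine congrArg _ (biproduct.hom_ext _ _ fun i => freeOnEquiv.injective ?_)
  exact h i

theorem exists_biproduct_section {ι : Type*} [Finite ι] {F : ι → SheafOfModules.{u} B}
    {U : (Opens X)ᵒᵖ} (s : ∀ i, (F i).val.obj U) :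
    ∃ t : (⨁ F).val.obj U, ∀ i, secApp (biproduct.π F i) U t = s i := by
  choose k hk using fun i => exists_freeOn (s i)
  refine ⟨freeOnEquiv (U := U.unop) (biproduct.lift k), fun i => ?_⟩
  rw [← hk i, ← biproduct.lift_π k i]
  exact (freeOnEquiv_comp _ _).symm

theorem biprod_section_ext {F G : SheafOfModules.{u} B} {U : (Opens X)ᵒᵖ}
    {s t : (F ⊞ G).val.obj U} (h : secApp biprod.fst U s = secApp biprod.fst U t)
    (h' : secApp biprod.snd U s = secApp biprod.snd U t) : s = t := by
  obtain ⟨s, rfl⟩ := exists_freeOn s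
  obtain ⟨t, rfl⟩ := exists_freeOn t
  exact congrArg _ (biprod.hom_ext _ _ (freeOnEquiv.injective h) (freeOnEquiv.injective h'))

theorem secApp_zero {F G : SheafOfModules.{u} B} (U : (Opens X)ᵒᵖ) (s : F.val.obj U) :
    secApp (0 : F ⟶ G) U s = 0 := rfl

end BiproductSections

/-! ### The map `d` of a twisted `Q`-sheaf, in terms of sections. -/

section RowDiff

set_option linter.unusedSectionVars false

variable {X : RingedSpace.{u, u}} {Q : Type u} [Quiver.{u} Q] {M : ∀ ⦃i j : Q⦄, (i ⟶ j) → OMod X}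
  [Finite Q] [∀ i j : Q, Finite (i ⟶ j)]

/-- The `B`-module `⨁_i Hom(e_i B, L_i)` of a twisted `Q`-sheaf `(L_i)`. -/
noncomputable abbrev vertexSum (T : TwistedQSheaf M) : SheafOfModules.{u} (pathSheaf M) :=
  ⨁ fun i : Q => homSheaf (vertexRight M i) (T.obj i)

/-- The `B`-module `⨁_a Hom(M_a ⊗ e_{ta} B, L_{ha})` of a twisted `Q`-sheaf `(L_i)`. -/
noncomputable abbrev arrowSum (T : TwistedQSheaf M) : SheafOfModules.{u} (pathSheaf M) :=
  ⨁ fun a : Arrows Q => homSheaf (arrowRight M a.2.2) (T.obj a.2.1)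

/-- The morphism `(α_i)_i ↦ (α_{ha} ∘ μ_a - φ_a ∘ (1 ⊗ α_{ta}))_a` of a twisted `Q`-sheaf. -/
noncomputable def rowDiff (T : TwistedQSheaf M) : vertexSum T ⟶ arrowSum T :=
  biproduct.lift fun a : Arrows Q =>
    biproduct.π _ a.2.1 ≫ homMul a.2.2 (T.obj a.2.1) -
      biproduct.π _ a.1 ≫ homTensor (vertexRight M a.1) (T.φ a.2.2)

/-- The components of a section of `⨁_i Hom(e_i B, L_i)`. -/
noncomputable def vertexHoms (T : TwistedQSheaf M) (U : (Opens X)ᵒᵖ) (α : (vertexSum T).val.obj U) :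
    VertexHoms T U :=
  fun i => homVal (biproduct.π (fun i : Q => homSheaf (vertexRight M i) (T.obj i)) i) U α

/-- The components of a section of `⨁_a Hom(M_a ⊗ e_{ta} B, L_{ha})`. -/
noncomputable def arrowHoms (T : TwistedQSheaf M) (U : (Opens X)ᵒᵖ) (β : (arrowSum T).val.obj U) :
    ArrowHoms T U :=
  fun i j a => homVal (biproduct.π (fun a : Arrows Q =>
    homSheaf (arrowRight M a.2.2) (T.obj a.2.1)) ⟨i, j, a⟩) U β

theorem vertexHoms_injective (T : TwistedQSheaf M) (U : (Opens X)ᵒᵖ) :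
    Function.Injective (vertexHoms T U) := fun _ _ h =>
  biproduct_section_ext fun i => congrFun h i

theorem vertexHoms_surjective (T : TwistedQSheaf M) (U : (Opens X)ᵒᵖ) :
    Function.Surjective (vertexHoms T U) := fun α => by
  obtain ⟨t, ht⟩ := exists_biproduct_section
    (F := fun i : Q => homSheaf (vertexRight M i) (T.obj i)) (U := U) α
  exact ⟨t, funext ht⟩

theorem arrowHoms_injective (T : TwistedQSheaf M) (U : (Opens X)ᵒᵖ) :
    Function.Injective (arrowHoms T U) := fun _ _ h =>
  biproduct_section_ext fun a => congrFun (congrFun (congrFun h a.1) a.2.1) a.2.2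

theorem arrowHom_ext {T : TwistedQSheaf M} {U : (Opens X)ᵒᵖ} {β β' : ArrowHoms T U}
    (h : ∀ {i j : Q} (a : i ⟶ j) (W : (Opens X)ᵒᵖ) (f : U ⟶ W) m x,
      (β a).1 W f (tensorMk _ _ W m x) = (β' a).1 W f (tensorMk _ _ W m x)) : β = β' :=
  funext fun _ => funext fun _ => funext fun a => Subtype.ext (funext fun W => funext fun f =>
    tensor_ext fun m x => h a W f m x)

/-- Puts `d` in the form of the arrow equation solved by `exists_vertexHoms`; pure tensors suffice
to determine a section of the target. -/
theorem arrowHoms_rowDiff (T : TwistedQSheaf M) {U : (Opens X)ᵒᵖ} (α : (vertexSum T).val.obj U)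
    {i j : Q} (a : i ⟶ j) (W : (Opens X)ᵒᵖ) (f : U ⟶ W) (m : Sec (M a).val W)
    (x : Sec (vertexPre (leftB M) i) W) :
    (arrowHoms T U (secApp (rowDiff T) U α) a).1 W f (tensorMk _ _ W m x) =
      (vertexHoms T U α j).1 W f (arrowBilin (leftB M) a W m x) -
        T.act a W m ((vertexHoms T U α i).1 W f x) := by
  have h : rowDiff T ≫ biproduct.π (fun a : Arrows Q =>
      homSheaf (arrowRight M a.2.2) (T.obj a.2.1)) ⟨i, j, a⟩ =
      biproduct.π _ j ≫ homMul a (T.obj j) -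
        biproduct.π _ i ≫ homTensor (vertexRight M i) (T.φ a) := biproduct.lift_π _ _
  exact congrArg (fun k => (homVal (F := arrowRight M a) (L := T.obj j) k U α).1 W f
    (tensorMk (M a).val (vertexPre (leftB M) i) W m x)) h

/-- The values `α_i(e_i)` of a section `(α_i)_i` of `⨁_i Hom(e_i B, L_i)`. -/
noncomputable def unitVal (T : TwistedQSheaf M) (i : Q) (U : (Opens X)ᵒᵖ)
    (α : (vertexSum T).val.obj U) : Sec (T.obj i).val U :=
  valAt (biproduct.π (fun i : Q => homSheaf (vertexRight M i) (T.obj i)) i) U α (unitSec M i U)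

theorem unitVal_zero (T : TwistedQSheaf M) (i : Q) (U : (Opens X)ᵒᵖ) :
    unitVal T i U 0 = 0 := by
  rw [unitVal, map_zero]
  rfl

theorem unitVal_res (T : TwistedQSheaf M) (i : Q) {U W : (Opens X)ᵒᵖ} (f : U ⟶ W)
    (α : (vertexSum T).val.obj U) :
    unitVal T i W (modRes (vertexSum T).val f α) = secRes (T.obj i).val f (unitVal T i U α) :=
  ((valAt_res (biproduct.π (fun i : Q => homSheaf (vertexRight M i) (T.obj i)) i) f α
    (unitSec M i U)).trans (congrArg (valAt _ W _) (unitSec_res i f))).symm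

/-- A section of `⨁_i Hom(e_i B, L_i)` is determined by its image in
`⨁_a Hom(M_a ⊗ e_{ta} B, L_{ha})` and its values at the `e_i`. -/
theorem vertexSum_ext {T : TwistedQSheaf M} {U : (Opens X)ᵒᵖ} {α α' : (vertexSum T).val.obj U}
    (h : secApp (rowDiff T) U α = secApp (rowDiff T) U α')
    (h' : ∀ i, unitVal T i U α = unitVal T i U α') : α = α' := by
  refine vertexHoms_injective T U (VertexHoms.eq_of_unit h' fun a W f m x => ?_)
  rw [← arrowHoms_rowDiff, ← arrowHoms_rowDiff, h]

/-- There are sections of `⨁_i Hom(e_i B, L_i)` with any given image in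
`⨁_a Hom(M_a ⊗ e_{ta} B, L_{ha})` and any given values at the `e_i`. -/
theorem exists_vertexSum {T : TwistedQSheaf M} {U : (Opens X)ᵒᵖ} (β : (arrowSum T).val.obj U)
    (s : ∀ i, Sec (T.obj i).val U) :
    ∃ α : (vertexSum T).val.obj U, secApp (rowDiff T) U α = β ∧ ∀ i, unitVal T i U α = s i := by
  obtain ⟨α', h, h'⟩ := exists_vertexHoms T (arrowHoms T U β) s
  obtain ⟨α, rfl⟩ := vertexHoms_surjective T U α'
  refine ⟨α, arrowHoms_injective T U (arrowHom_ext fun a W f m x => ?_), h⟩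
  rw [arrowHoms_rowDiff, h']

/-- The morphism `⨁_i Hom(e_i B, L_i) → ⨁_i Hom(e_i B, L_i')` induced by a morphism of twisted
`Q`-sheaves. -/
noncomputable def vertexSumMap {T T' : TwistedQSheaf M} (f : T ⟶ T') : vertexSum T ⟶ vertexSum T' :=
  biproduct.map fun i => homMap (vertexRight M i) (f.app i)

/-- The morphism `⨁_a Hom(M_a ⊗ e_{ta} B, L_{ha}) → ⨁_a Hom(M_a ⊗ e_{ta} B, L_{ha}')` induced by a
morphism of twisted `Q`-sheaves. -/
noncomputable def arrowSumMap {T T' : TwistedQSheaf M} (f : T ⟶ T') : arrowSum T ⟶ arrowSum T' :=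
  biproduct.map fun a => homMap (arrowRight M a.2.2) (f.app a.2.1)

theorem rowDiff_naturality {T T' : TwistedQSheaf M} (f : T ⟶ T') :
    rowDiff T ≫ arrowSumMap f = vertexSumMap f ≫ rowDiff T' := by
  refine biproduct.hom_ext _ _ fun a => ?_
  simp only [rowDiff, arrowSumMap, vertexSumMap, Category.assoc, biproduct.map_π,
    biproduct.lift_π_assoc, biproduct.lift_π, Preadditive.sub_comp, Preadditive.comp_sub,
    homMul_homMap, homTensor_homMap, biproduct.map_π_assoc, homMap_homTensor, f.comm]

/-- Evaluation at `e_i` turns the induced maps on `⨁ Hom(e_i B, L_i)` into the original maps of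
coefficients, which transfers questions about `δ` to the resolutions `V_i^•`. -/
theorem unitVal_vertexSumMap {T T' : TwistedQSheaf M} (f : T ⟶ T') (i : Q) (U : (Opens X)ᵒᵖ)
    (α : (vertexSum T).val.obj U) :
    unitVal T' i U (secApp (vertexSumMap f) U α) = secMap (f.app i).val U (unitVal T i U α) :=
  congrArg (fun k => valAt (F := vertexRight M i) (L := T'.obj i) k U α (unitSec M i U))
    (biproduct.map_π (fun i => homMap (vertexRight M i) (f.app i)) i)

end RowDiff

/-! ### The decomposition of a `B`-module by the orthogonal idempotents `e_i`. -/

section VertexDecomposition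

variable {X : RingedSpace.{u, u}} {Q : Type u} [Quiver.{u} Q] {M : ∀ ⦃i j : Q⦄, (i ⟶ j) → OMod X}

theorem secVertex_mul_self (i : Q) (U : (Opens X)ᵒᵖ) :
    secVertex M i U * secVertex M i U = secVertex M i U := by
  rw [secVertex, ← map_mul, vertexElt_mul]
  exact congrArg (toSec M U) (congrArg (rowSingle _ _ i) (rowSingle_same i _))

theorem secVertex_mul_of_ne {i j : Q} (h : i ≠ j) (U : (Opens X)ᵒᵖ) :
    secVertex M i U * secVertex M j U = 0 := by
  rw [secVertex, secVertex, ← map_mul, vertexElt_mul, vertexElt, rowSingle_of_ne h, map_zero,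
    map_zero]

theorem sum_secVertex [Fintype Q] (U : (Opens X)ᵒᵖ) : ∑ i : Q, secVertex M i U = 1 := by
  classical
  have h : ∑ i : Q, vertexElt (X.presheaf.obj U) (fun _ _ a => Sec (M a).val U) i = 1 := by
    funext j
    refine Eq.trans (map_sum (rowProj (X.presheaf.obj U) (fun _ _ a => Sec (M a).val U) j) _ _) ?_
    refine (Finset.sum_eq_single j (fun i _ h => rowSingle_of_ne h.symm _)
      (fun h => (h (Finset.mem_univ j)).elim)).trans (rowSingle_same j _)
  rw [← map_one (toSec M U), ← h, map_sum]
  rfl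

/-- Since `∑ e_i = 1`, a section is the sum of its components `e_i v`. -/
theorem eq_of_secVertex_smul [Finite Q] {V : SheafOfModules.{u} (pathSheaf M)} {U : (Opens X)ᵒᵖ}
    {v w : V.val.obj U} (h : ∀ i : Q, secVertex M i U • v = secVertex M i U • w) : v = w := by
  cases nonempty_fintype Q
  rw [← one_smul ((pathSheaf M).obj.obj U) v, ← one_smul ((pathSheaf M).obj.obj U) w,
    ← sum_secVertex, Finset.sum_smul, Finset.sum_smul]
  exact Finset.sum_congr rfl fun i _ => h i

/-- By orthogonality of the idempotents, the sum of the given sections has exactly them as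
components. -/
theorem exists_secVertex_smul [Finite Q] {V : SheafOfModules.{u} (pathSheaf M)} {U : (Opens X)ᵒᵖ}
    (v : ∀ i : Q, Sec (vertexPre V.val i) U) :
    ∃ w : V.val.obj U, ∀ i, secVertex M i U • w = vertexVal (v i) := by
  cases nonempty_fintype Q
  refine ⟨∑ i, vertexVal (v i), fun i => ?_⟩
  rw [Finset.smul_sum]
  refine (Finset.sum_eq_single i (fun j _ h => ?_)
    (fun h => (h (Finset.mem_univ i)).elim)).trans (vertexVal_prop (v i))
  rw [← vertexVal_prop (v j), smul_smul, secVertex_mul_of_ne h.symm, zero_smul]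

end VertexDecomposition

/-! ### Exactness of the total complex. -/

section Resolution

set_option linter.unusedSectionVars false

variable {X : RingedSpace.{u, u}} {Q : Type u} [Quiver.{u} Q] {M : ∀ ⦃i j : Q⦄, (i ⟶ j) → OMod X}

/-- The twisted `Q`-sheaf of a `B`-module. -/
noncomputable def toQSheaf (V : SheafOfModules.{u} (pathSheaf M)) : TwistedQSheaf M :=
  ⟨vertexSheaf V, fun _ _ a => arrowMap V a⟩

theorem toQSheaf_act (V : SheafOfModules.{u} (pathSheaf M)) {i j : Q} (a : i ⟶ j)
    (U : (Opens X)ᵒᵖ) (m : Sec (M a).val U) (v : Sec (vertexPre V.val i) U) :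
    (toQSheaf V).act a U m v = arrowBilin V.val a U m v :=
  congrArg (fun g => secMap g U (tensorMk (M a).val (vertexPre V.val i) U m v))
    (tensorSheafRes_desc (N := M a) (F := vertexSheaf V i) (L := vertexSheaf V j)
      (arrowPre V.val a))

theorem exists_lift_of_exact {S : ShortComplex (OMod X)} (hS : S.Exact) {U : (Opens X)ᵒᵖ}
    (s : Sec S.X₂.val U) (hs : secMap S.g.val U s = 0) (x : X) (hx : x ∈ U.unop) :
    ∃ (W : (Opens X)ᵒᵖ) (f : U ⟶ W), x ∈ W.unop ∧
      ∃ t, secMap S.f.val W t = secRes S.X₂.val f s := by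
  obtain ⟨W, hW, hxW, t, ht⟩ := (exact_iff_locally S).1 hS U.unop s hs x hx
  exact ⟨op W, (homOfLE hW).op, hxW, t, ht⟩

/-- Finiteness of the index set lets one neighbourhood serve all vertices. -/
theorem exists_common_lift_of_exact {ι : Type*} [Finite ι] {S : ι → ShortComplex (OMod X)}
    (hS : ∀ i, (S i).Exact) {U : (Opens X)ᵒᵖ} (s : ∀ i, Sec (S i).X₂.val U)
    (hs : ∀ i, secMap (S i).g.val U (s i) = 0) (x : X) (hx : x ∈ U.unop) :
    ∃ (W : (Opens X)ᵒᵖ) (f : U ⟶ W), x ∈ W.unop ∧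
      ∀ i, ∃ t, secMap (S i).f.val W t = secRes (S i).X₂.val f (s i) := by
  cases nonempty_fintype ι
  obtain ⟨W, f, hxW, h⟩ := exists_common_restriction (Finset.univ : Finset ι) x hx
    (fun i W f => ∃ t, secMap (S i).f.val W t = secRes (S i).X₂.val f (s i))
    (fun i W W' f g ⟨t, ht⟩ => ⟨secRes _ g t, by rw [secRes_comp, ← ht, secMap_res]⟩)
    (fun i _ => exists_lift_of_exact (hS i) (s i) (hs i) x hx)
  exact ⟨W, f, hxW, fun i => h i (Finset.mem_univ i)⟩

theorem exact_of_exists_lift (S : ShortComplex (SheafOfModules.{u} (pathSheaf M)))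
    (h : ∀ (U : (Opens X)ᵒᵖ) (s : S.X₂.val.obj U), secApp S.g U s = 0 → ∀ x ∈ U.unop,
      ∃ (W : (Opens X)ᵒᵖ) (f : U ⟶ W), x ∈ W.unop ∧
        ∃ t, secApp S.f W t = modRes S.X₂.val f s) : S.Exact :=
  (exact_iff_locally S).2 fun U s hs x hx => by
    obtain ⟨W, f, hxW, t, ht⟩ := h (op U) s hs x hx
    exact ⟨W.unop, f.unop.le, hxW, t, ht⟩

variable [Finite Q] [∀ i j : Q, Finite (i ⟶ j)]

/-- The morphism `V → ⨁_i Hom(e_i B, V_i)`, `v ↦ (x ↦ x v)_i`. -/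
noncomputable def epsSum (V : SheafOfModules.{u} (pathSheaf M)) : V ⟶ vertexSum (toQSheaf V) :=
  biproduct.lift fun i : Q => epsMap V i

theorem epsSum_rowDiff (V : SheafOfModules.{u} (pathSheaf M)) :
    epsSum V ≫ rowDiff (toQSheaf V) = 0 := by
  refine biproduct.hom_ext _ _ fun a => ?_
  rw [rowDiff, Category.assoc, biproduct.lift_π, Preadditive.comp_sub, epsSum,
    ← Category.assoc, ← Category.assoc, zero_comp]
  refine (congrArg₂ (fun f g => f ≫ homMul a.2.2 ((toQSheaf V).obj a.2.1) -
    g ≫ homTensor (vertexRight M a.1) ((toQSheaf V).φ a.2.2)) (biproduct.lift_π _ a.2.1)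
      (biproduct.lift_π _ a.1)).trans ?_
  exact sub_eq_zero.2 (epsMap_homMul V a.2.2)

/-- The map `x ↦ x v` takes the value `e_i v` at `e_i`. -/
theorem unitVal_epsSum (V : SheafOfModules.{u} (pathSheaf M)) (i : Q) (U : (Opens X)ᵒᵖ)
    (v : V.val.obj U) :
    vertexVal (V := V.val) (i := i) (unitVal (toQSheaf V) i U (secApp (epsSum V) U v)) =
      secVertex M i U • v := by
  have h : epsSum V ≫ biproduct.π (fun i : Q => homSheaf (vertexRight M i) ((toQSheaf V).obj i)) i =
    epsMap V i := biproduct.lift_π _ _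
  refine (congrArg (fun k : V ⟶ homSheaf (vertexRight M i) (vertexSheaf V i) =>
    vertexVal (V := V.val) (i := i) (valAt k U v (unitSec M i U))) h).trans ?_
  exact congrArg (fun w : V.val.obj U => secVertex M i U • w)
    (ConcreteCategory.congr_hom (V.val.presheaf.map_id U) v)

theorem epsSum_injective (V : SheafOfModules.{u} (pathSheaf M)) (U : (Opens X)ᵒᵖ) :
    Function.Injective (secApp (epsSum V) U) := fun v w h =>
  eq_of_secVertex_smul fun i => by rw [← unitVal_epsSum, ← unitVal_epsSum, h]

/-- Assemble `v` from the values `α_i(e_i)`. Its image and `α` both lie in the kernel of `d` and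
agree at every `e_i`, hence coincide; no shrinking is needed. -/
theorem exists_epsSum_eq {V : SheafOfModules.{u} (pathSheaf M)} {U : (Opens X)ᵒᵖ}
    (α : (vertexSum (toQSheaf V)).val.obj U) (hα : secApp (rowDiff (toQSheaf V)) U α = 0) :
    ∃ v, secApp (epsSum V) U v = α := by
  obtain ⟨v, hv⟩ := exists_secVertex_smul (V := V) fun i => unitVal (toQSheaf V) i U α
  refine ⟨v, vertexSum_ext (Eq.trans ?_ hα.symm) fun i => vertexVal_injective (V := V.val) (i := i)
    ((unitVal_epsSum V i U v).trans (hv i))⟩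
  rw [← secApp_comp, epsSum_rowDiff, secApp_zero]

variable {V : SheafOfModules.{u} (pathSheaf M)} (J : VertexResolutions V) (Φ : ArrowLifts J)

/-- The twisted `Q`-sheaf `(V_i^q)_i` with the morphisms `φ_a^q`. -/
noncomputable def level (q : ℕ) : TwistedQSheaf M := ⟨fun i => J.obj i q, fun _ _ a => Φ.φ a q⟩

/-- The differential `δ`, as a morphism of twisted `Q`-sheaves. -/
noncomputable def levelδ (q : ℕ) : level J Φ q ⟶ level J Φ (q + 1) :=
  TwistedQSheaf.Hom.mk (fun i => J.δ i q) fun _ _ a => (Φ.comm a q).symm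

/-- The augmentation `V_i → V_i^0`, as a morphism of twisted `Q`-sheaves. -/
noncomputable def levelAug : toQSheaf V ⟶ level J Φ 0 :=
  TwistedQSheaf.Hom.mk (fun i => J.aug i) fun _ _ a => (Φ.comm_aug a).symm

theorem epsBar_eq : epsBar J = epsSum V ≫ vertexSumMap (levelAug J Φ) := by
  refine biproduct.hom_ext _ _ fun i => Eq.trans (biproduct.lift_π _ i) (Eq.symm ?_)
  refine (Category.assoc _ _ _).trans ((congrArg (fun k => epsSum V ≫ k) (biproduct.map_π
    (fun i => homMap (vertexRight M i) ((levelAug J Φ).app i)) i)).trans ?_)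
  exact (Category.assoc _ _ _).symm.trans
    (congrArg (fun k => k ≫ homMap (vertexRight M i) (J.aug i)) (biproduct.lift_π _ i))

theorem unitVal_dVert0 (q : ℕ) (i : Q) (U : (Opens X)ᵒᵖ) (α : (column0 J q).val.obj U) :
    unitVal (level J Φ (q + 1)) i U (secApp (dVert0 J q) U α) =
      secMap (J.δ i q).val U (unitVal (level J Φ q) i U α) :=
  unitVal_vertexSumMap (levelδ J Φ q) i U α

/-- The sign `(-1)^q` affects neither injectivity nor solvability, so the facts about `rowDiff`
carry over to `dHor`. -/
theorem dHor_eq_or (q : ℕ) :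
    dHor J Φ q = (rowDiff (level J Φ q) : column0 J q ⟶ column1 J q) ∨
      dHor J Φ q = (-rowDiff (level J Φ q) : column0 J q ⟶ column1 J q) := by
  rcases neg_one_pow_eq_or ℤ q with h | h
  · left
    rw [dHor, h, one_smul]
    rfl
  · right
    rw [dHor, h, neg_smul, one_smul]
    rfl

theorem column0_ext {q : ℕ} {U : (Opens X)ᵒᵖ} {α α' : (column0 J q).val.obj U}
    (h : secApp (dHor J Φ q) U α = secApp (dHor J Φ q) U α')
    (h' : ∀ i, unitVal (level J Φ q) i U α = unitVal (level J Φ q) i U α') : α = α' := by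
  refine vertexSum_ext (T := level J Φ q) ?_ h'
  cases dHor_eq_or J Φ q with
  | inl e => rw [e] at h; exact h
  | inr e => rw [e] at h; exact neg_injective h

theorem exists_column0 {q : ℕ} {U : (Opens X)ᵒᵖ} (β : (column1 J q).val.obj U)
    (s : ∀ i, Sec (J.obj i q).val U) :
    ∃ α, secApp (dHor J Φ q) U α = β ∧ ∀ i, unitVal (level J Φ q) i U α = s i := by
  cases dHor_eq_or J Φ q with
  | inl e => rw [e]; exact exists_vertexSum (T := level J Φ q) β s
  | inr e =>
    rw [e]
    obtain ⟨α, h, h'⟩ := exists_vertexSum (T := level J Φ q) (-β) s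
    exact ⟨α, (congrArg Neg.neg h).trans (neg_neg β), h'⟩

/-- The core of the exactness proof: for a cocycle `(α, β)`, the sections `α_i(e_i)` of `V_i^{q+1}`
are `δ`-closed, hence locally `δ t_i`. The family `α'` with horizontal image `β` and values `t_i`
bounds the cocycle. -/
theorem exists_column0_lift {q : ℕ} {U : (Opens X)ᵒᵖ} (α : (column0 J (q + 1)).val.obj U)
    (β : (column1 J q).val.obj U) (hα : secApp (dVert0 J (q + 1)) U α = 0)
    (hβ : secApp (dHor J Φ (q + 1)) U α + secApp (dVert1 J q) U β = 0) (x : X)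
    (hx : x ∈ U.unop) :
    ∃ (W : (Opens X)ᵒᵖ) (f : U ⟶ W), x ∈ W.unop ∧ ∃ α',
      secApp (dVert0 J q) W α' = modRes (column0 J (q + 1)).val f α ∧
        secApp (dHor J Φ q) W α' = modRes (column1 J q).val f β := by
  obtain ⟨W, f, hxW, h⟩ := exists_common_lift_of_exact (fun i => (J i).exact_succ q)
    (fun i => unitVal (level J Φ (q + 1)) i U α) (fun i => by
      refine (unitVal_dVert0 J Φ (q + 1) i U α).symm.trans ?_
      rw [hα]
      exact unitVal_zero (level J Φ (q + 2)) i U) x hx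
  choose t ht using h
  obtain ⟨α', h₁, h₂⟩ := exists_column0 J Φ (modRes (column1 J q).val f β) t
  refine ⟨W, f, hxW, α', column0_ext J Φ ?_ fun i => ?_, h₁⟩
  -- Writing `h` for `dHor`: `h δ α' = -δ h α' = -δ β = h α`, by anticommutativity and then the
  -- cocycle condition.
  · have h₃ : secApp (dHor J Φ q ≫ dVert1 J q) W α' =
      secApp (-(dVert0 J q ≫ dHor J Φ (q + 1))) W α' := by rw [dHor_dVert]
    have h₄ : secApp (dVert1 J q) W (modRes (column1 J q).val f β) =
      -secApp (dHor J Φ (q + 1)) W (secApp (dVert0 J q) W α') := h₁ ▸ h₃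
    rw [secApp_res, ← neg_eq_iff_add_eq_zero.2 hβ] at h₄
    have h₅ := secApp_res (dHor J Φ (q + 1)) f α
    rw [h₅, ← neg_inj, ← h₄, map_neg]
  · refine (unitVal_dVert0 J Φ q i W α').trans ?_
    rw [h₂]
    exact (ht i).trans (unitVal_res (level J Φ (q + 1)) i f α).symm

/-- Describes the differential on the first-column part of `totalX` uniformly in `n`, hiding that
degree `0` has no second-column summand. -/
theorem exists_comp_totalD (n : ℕ) : ∃ k : column0 J n ⟶ totalX J n,
    k ≫ totalD J Φ n =
      (biprod.lift (dVert0 J n) (dHor J Φ n) : column0 J n ⟶ column0 J (n + 1) ⊞ column1 J n) := by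
  cases n with
  | zero => exact ⟨𝟙 (column0 J 0), Category.id_comp _⟩
  | succ n =>
    refine ⟨(biprod.inl : column0 J (n + 1) ⟶ column0 J (n + 1) ⊞ column1 J n), ?_⟩
    change biprod.inl ≫ biprod.lift (biprod.fst ≫ dVert0 J (n + 1))
      (biprod.fst ≫ dHor J Φ (n + 1) + biprod.snd ≫ dVert1 J n) = _
    refine biprod.hom_ext _ _ ?_ ?_ <;> simp

/-- The local primitive can be taken in the first column alone, because the horizontal map there
already hits every second-column section. -/
theorem totalD_exact (n : ℕ) :
    (ShortComplex.mk (totalD J Φ n) (totalD J Φ (n + 1)) (totalD_comp J Φ n)).Exact := by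
  refine exact_of_exists_lift _ fun U (s : (column0 J (n + 1) ⊞ column1 J n).val.obj U) hs x hx => ?_
  have k₁ : totalD J Φ (n + 1) ≫ (biprod.fst : column0 J (n + 2) ⊞ column1 J (n + 1) ⟶ _) =
    (biprod.fst ≫ dVert0 J (n + 1) : column0 J (n + 1) ⊞ column1 J n ⟶ _) := biprod.lift_fst _ _
  have k₂ : totalD J Φ (n + 1) ≫ (biprod.snd : column0 J (n + 2) ⊞ column1 J (n + 1) ⟶ _) =
    (biprod.fst ≫ dHor J Φ (n + 1) + biprod.snd ≫ dVert1 J n :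
      column0 J (n + 1) ⊞ column1 J n ⟶ _) := biprod.lift_snd _ _
  have h₁ : secApp (dVert0 J (n + 1)) U (secApp biprod.fst U s) = 0 :=
    (congrArg (fun k : column0 J (n + 1) ⊞ column1 J n ⟶ _ => secApp k U s) k₁).symm.trans
      ((congrArg (secApp (biprod.fst : column0 J (n + 2) ⊞ column1 J (n + 1) ⟶ _) U) hs).trans
        (map_zero _))
  have h₂ : secApp (dHor J Φ (n + 1)) U (secApp biprod.fst U s) +
      secApp (dVert1 J n) U (secApp biprod.snd U s) = 0 :=
    (congrArg (fun k : column0 J (n + 1) ⊞ column1 J n ⟶ _ => secApp k U s) k₂).symm.trans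
      ((congrArg (secApp (biprod.snd : column0 J (n + 2) ⊞ column1 J (n + 1) ⟶ _) U) hs).trans
        (map_zero _))
  obtain ⟨W, f, hxW, α, hα, hα'⟩ := exists_column0_lift J Φ _ _ h₁ h₂ x hx
  obtain ⟨k, hk⟩ := exists_comp_totalD J Φ n
  refine ⟨W, f, hxW, secApp k W α, ?_⟩
  refine (congrArg (fun k : column0 J n ⟶ column0 J (n + 1) ⊞ column1 J n =>
    secApp k W α) hk).trans (biprod_section_ext ?_ ?_)
  · refine (congrArg (fun k : column0 J n ⟶ _ => secApp k W α) (biprod.lift_fst _ _)).trans ?_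
    exact hα.trans (secApp_res biprod.fst f s).symm
  · refine (congrArg (fun k : column0 J n ⟶ _ => secApp k W α) (biprod.lift_snd _ _)).trans ?_
    exact hα'.trans (secApp_res biprod.snd f s).symm

theorem unitVal_epsBar (i : Q) (U : (Opens X)ᵒᵖ) (v : V.val.obj U) :
    unitVal (level J Φ 0) i U (secApp (epsBar J) U v) =
      secMap (J.aug i).val U (unitVal (toQSheaf V) i U (secApp (epsSum V) U v)) :=
  (congrArg (fun k : V ⟶ vertexSum (level J Φ 0) => unitVal (level J Φ 0) i U (secApp k U v))
    (epsBar_eq J Φ)).trans (unitVal_vertexSumMap (levelAug J Φ) i U _)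

theorem mono_aug (i : Q) : Mono (J.aug i) := inferInstanceAs (Mono ((J i).ι.f 0))

/-- The value of `epsBar` at `v`, evaluated at `e_i`, is the image of `e_i v` under the mono `V_i ⟶
V_i^0`, so all components of `v` are determined. -/
theorem mono_epsBar (Ψ : ArrowLifts J) : Mono (epsBar J) := by
  refine mono_of_injective _ fun U v w (h : secApp (epsBar J) U v = secApp (epsBar J) U w) => ?_
  refine eq_of_secVertex_smul fun i => ?_
  have := mono_aug J i
  have h₁ := (unitVal_epsBar J Ψ i U v).symm.trans
    ((congrArg (unitVal (level J Ψ 0) i U) h).trans (unitVal_epsBar J Ψ i U w))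
  exact (unitVal_epsSum V i U v).symm.trans ((congrArg (vertexVal (V := V.val) (i := i))
    (injective_of_mono (J.aug i) U h₁)).trans (unitVal_epsSum V i U w))

/-- A degree-zero cocycle `α` has `δ α_i(e_i) = 0`, so locally `α_i(e_i)` comes from a section of
`V_i`. The section `v` of `V` with these components maps to `α`, both having zero horizontal image.
-/
theorem epsBar_exact :
    (ShortComplex.mk (epsBar J) (totalD J Φ 0) (epsBar_comp J Φ)).Exact := by
  refine exact_of_exists_lift _ fun U (α : (column0 J 0).val.obj U) hs x hx => ?_
  have k₁ : totalD J Φ 0 ≫ (biprod.fst : column0 J 1 ⊞ column1 J 0 ⟶ _) =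
    (dVert0 J 0 : column0 J 0 ⟶ _) := biprod.lift_fst _ _
  have k₂ : totalD J Φ 0 ≫ (biprod.snd : column0 J 1 ⊞ column1 J 0 ⟶ _) =
    (dHor J Φ 0 : column0 J 0 ⟶ _) := biprod.lift_snd _ _
  have h₁ : secApp (dVert0 J 0) U α = 0 :=
    (congrArg (fun k : column0 J 0 ⟶ _ => secApp k U α) k₁).symm.trans
      ((congrArg (secApp (biprod.fst : column0 J 1 ⊞ column1 J 0 ⟶ _) U) hs).trans (map_zero _))
  have h₂ : secApp (dHor J Φ 0) U α = 0 :=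
    (congrArg (fun k : column0 J 0 ⟶ _ => secApp k U α) k₂).symm.trans
      ((congrArg (secApp (biprod.snd : column0 J 1 ⊞ column1 J 0 ⟶ _) U) hs).trans (map_zero _))
  obtain ⟨W, f, hxW, h⟩ := exists_common_lift_of_exact (fun i => (J i).exact₀)
    (fun i => unitVal (level J Φ 0) i U α) (fun i => by
      refine (unitVal_dVert0 J Φ 0 i U α).symm.trans ?_
      rw [h₁]
      exact unitVal_zero (level J Φ 1) i U) x hx
  choose t ht using h
  obtain ⟨v, hv⟩ := exists_secVertex_smul (V := V) t
  refine ⟨W, f, hxW, v, column0_ext J Φ ?_ fun i => ?_⟩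
  · have h₃ := secApp_res (dHor J Φ 0) f α
    rw [h₂, map_zero] at h₃
    refine Eq.trans ?_ h₃.symm
    have h₄ : epsBar J ≫ dHor J Φ 0 = 0 := by
      rw [dHor, Preadditive.comp_zsmul, epsBar_rowMapD, smul_zero]
    exact congrArg (fun k : V ⟶ _ => secApp k W v) h₄
  · refine (unitVal_epsBar J Φ i W v).trans ?_
    have h₅ : unitVal (toQSheaf V) i W (secApp (epsSum V) W v) = t i :=
      vertexVal_injective (V := V.val) (i := i) ((unitVal_epsSum V i W v).trans (hv i))
    rw [h₅]
    exact (ht i).trans (unitVal_res (level J Φ 0) i f α).symm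

theorem totalComplex_d (n : ℕ) : (totalComplex J Φ).d n (n + 1) = totalD J Φ n :=
  CochainComplex.of_d (totalX J) (totalD J Φ) n

theorem totalComplex_exact_zero (w : epsBar J ≫ (totalComplex J Φ).d 0 1 = 0) :
    (ShortComplex.mk (epsBar J) ((totalComplex J Φ).d 0 1) w).Exact :=
  exact_congr rfl (totalComplex_d J Φ 0) fun _ => epsBar_exact J Φ

theorem totalComplex_exact_succ (n : ℕ) : (ShortComplex.mk _ _
    ((totalComplex J Φ).d_comp_d n (n + 1) (n + 2))).Exact :=
  exact_congr (totalComplex_d J Φ n) (totalComplex_d J Φ (n + 1)) fun _ => totalD_exact J Φ n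

theorem quasiIso_augmentation : QuasiIso (augmentation J Φ) := by
  refine @quasiIso_fromSingle₀ _ _ _ V (totalComplex J Φ) ⟨epsBar J, ?_⟩ (mono_epsBar J Φ)
    (totalComplex_exact_zero J Φ _) (totalComplex_exact_succ J Φ)

end Resolution

/-! ### The equivalence between `B`-modules and twisted `Q`-sheaves. -/

section Equivalence

variable {X : RingedSpace.{u, u}} {Q : Type u} [Quiver.{u} Q] {M : ∀ ⦃i j : Q⦄, (i ⟶ j) → OMod X}

theorem tensorSheaf_hom_ext {N F L : OMod X} {g g' : tensorSheaf N F ⟶ L}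
    (h : ∀ (U : (Opens X)ᵒᵖ) (n : Sec N.val U) (x : Sec F.val U),
      secMap (tensorSheafRes g) U (tensorMk N.val F.val U n x) =
        secMap (tensorSheafRes g') U (tensorMk N.val F.val U n x)) : g = g' := by
  refine (PresheafOfModules.sheafificationHomEquiv (𝟙 (strSheaf X).obj)).injective ?_
  refine PresheafOfModules.hom_ext fun U => ModuleCat.hom_ext ?_
  exact tensor_ext (P := Sec L.val U) (f := secMap (tensorSheafRes g) U)
    (g := secMap (tensorSheafRes g') U) (h U)

theorem secMap_tensorSheafRes_comp {N F L L' : OMod X} (g : tensorSheaf N F ⟶ L) (f : L ⟶ L')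
    (U : (Opens X)ᵒᵖ) (x : Sec (tensorPre N.val F.val) U) :
    secMap (tensorSheafRes (g ≫ f)) U x = secMap f.val U (secMap (tensorSheafRes g) U x) := by
  rw [tensorSheafRes_comp]
  rfl

theorem secMap_tensorSheafRes_map_comp {N F F' L : OMod X} (f : F ⟶ F') (g : tensorSheaf N F' ⟶ L)
    (U : (Opens X)ᵒᵖ) (n : Sec N.val U) (x : Sec F.val U) :
    secMap (tensorSheafRes (tensorSheafMap N f ≫ g)) U (tensorMk N.val F.val U n x) =
      secMap (tensorSheafRes g) U (tensorMk N.val F'.val U n (secMap f.val U x)) := by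
  rw [tensorSheafRes_map_comp]
  rfl

theorem vertexMap_arrowBilin {V W : SheafOfModules.{u} (pathSheaf M)} (k : V ⟶ W) {i j : Q}
    (a : i ⟶ j) (U : (Opens X)ᵒᵖ) (m : Sec (M a).val U) (v : Sec (vertexPre V.val i) U) :
    secMap (vertexMap k j).val U (arrowBilin V.val a U m v) =
      arrowBilin W.val a U m (secMap (vertexMap k i).val U v) :=
  vertexVal_injective (secApp_smul k U (secArrow M a U m) (vertexVal v))

theorem arrowMap_naturality {V W : SheafOfModules.{u} (pathSheaf M)} (k : V ⟶ W) {i j : Q}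
    (a : i ⟶ j) :
    arrowMap V a ≫ vertexMap k j = tensorSheafMap (M a) (vertexMap k i) ≫ arrowMap W a :=
  tensorSheaf_hom_ext fun U m v => by
    rw [secMap_tensorSheafRes_comp, secMap_tensorSheafRes_map_comp]
    exact (congrArg (secMap (vertexMap k j).val U) (toQSheaf_act V a U m v)).trans
      ((vertexMap_arrowBilin k a U m v).trans
        (toQSheaf_act W a U m (secMap (vertexMap k i).val U v)).symm)

variable (M) in
/-- The functor from `B`-modules to twisted `Q`-sheaves. -/
noncomputable def toQSheafFunctor : SheafOfModules.{u} (pathSheaf M) ⥤ TwistedQSheaf M where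
  obj V := toQSheaf V
  map k := TwistedQSheaf.Hom.mk (vertexMap k) fun _ _ a => arrowMap_naturality k a
  map_id _ := TwistedQSheaf.Hom.ext (funext fun _ => rfl)
  map_comp _ _ := TwistedQSheaf.Hom.ext (funext fun _ => rfl)

theorem inv_comm {T T' : TwistedQSheaf M} (f : ∀ i, T.obj i ⟶ T'.obj i) (hf : ∀ i, IsIso (f i))
    {i j : Q} (a : i ⟶ j) (comm : T.φ a ≫ f j = tensorSheafMap (M a) (f i) ≫ T'.φ a) :
    T'.φ a ≫ inv (f j) = tensorSheafMap (M a) (inv (f i)) ≫ T.φ a := by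
  rw [← cancel_mono (f j), Category.assoc, Category.assoc, IsIso.inv_hom_id, Category.comp_id,
    comm, ← Category.assoc, ← tensorSheafMap_comp, IsIso.inv_hom_id, tensorSheafMap_id,
    Category.id_comp]

/-- An isomorphism of twisted `Q`-sheaves from isomorphisms of the components. -/
noncomputable def isoMk {T T' : TwistedQSheaf M} (f : ∀ i, T.obj i ⟶ T'.obj i)
    (hf : ∀ i, IsIso (f i))
    (comm : ∀ ⦃i j : Q⦄ (a : i ⟶ j), T.φ a ≫ f j = tensorSheafMap (M a) (f i) ≫ T'.φ a) :
    T ≅ T' where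
  hom := TwistedQSheaf.Hom.mk f comm
  inv := TwistedQSheaf.Hom.mk (fun i => inv (f i)) fun _ _ a => inv_comm f hf a (comm a)
  hom_inv_id := TwistedQSheaf.Hom.ext (funext fun i => IsIso.hom_inv_id (f i))
  inv_hom_id := TwistedQSheaf.Hom.ext (funext fun i => IsIso.inv_hom_id (f i))

variable [Finite Q]

/-- A morphism is determined by its restrictions to the `e_i V`, since `e_i k(v) = k(e_i v)`. -/
instance faithful_toQSheafFunctor : (toQSheafFunctor M).Faithful where
  map_injective {V W} k k' h := by
    refine secApp_ext fun U v => eq_of_secVertex_smul fun i => ?_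
    have hi : vertexMap k i = vertexMap k' i := congrFun (congrArg TwistedQSheaf.Hom.app h) i
    have hv : IsAtVertex V.val i (secVertex M i U • v) := by
      rw [IsAtVertex, smul_smul, secVertex_mul_self]
    have h₁ := congrArg (fun k : vertexSheaf V i ⟶ vertexSheaf W i =>
      vertexVal (V := W.val) (i := i) (secMap k.val U (vertexMk _ hv))) hi
    exact (secApp_smul k U _ v).symm.trans (Eq.trans h₁ (secApp_smul k' U _ v))

variable [∀ i j : Q, Finite (i ⟶ j)]

theorem epsSum_exact (V : SheafOfModules.{u} (pathSheaf M)) :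
    (ShortComplex.mk (epsSum V) (rowDiff (toQSheaf V)) (epsSum_rowDiff V)).Exact :=
  exact_of_exists_lift _ fun U s hs x hx => by
    obtain ⟨v, hv⟩ := exists_epsSum_eq s hs
    exact ⟨U, 𝟙 U, hx, v, hv.trans
      (ConcreteCategory.congr_hom ((vertexSum (toQSheaf V)).val.presheaf.map_id U) s).symm⟩

instance mono_epsSum (V : SheafOfModules.{u} (pathSheaf M)) : Mono (epsSum V) :=
  mono_of_injective _ fun U => epsSum_injective V U

theorem unitVal_epsSum_of_isAtVertex (V : SheafOfModules.{u} (pathSheaf M)) (i : Q)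
    (U : (Opens X)ᵒᵖ) (v : Sec (vertexPre V.val i) U) :
    unitVal (toQSheaf V) i U (secApp (epsSum V) U (vertexVal v)) = v :=
  vertexVal_injective (V := V.val) (i := i)
    ((unitVal_epsSum V i U (vertexVal v)).trans (vertexVal_prop v))

/-- Evaluating both sides of the hypothesis at `e_i` on sections of `V_i` recovers the component at
`i`. -/
theorem vertexMap_eq_of_epsSum {V W : SheafOfModules.{u} (pathSheaf M)} {k : V ⟶ W}
    {f : toQSheaf V ⟶ toQSheaf W} (h : k ≫ epsSum W = epsSum V ≫ vertexSumMap f) (i : Q) :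
    vertexMap k i = f.app i := by
  refine SheafOfModules.hom_ext (PresheafOfModules.hom_ext fun U => ModuleCat.hom_ext
    (LinearMap.ext fun v : Sec (vertexPre V.val i) U => ?_))
  refine (unitVal_epsSum_of_isAtVertex W i U (secMap (vertexMap k i).val U v)).symm.trans ?_
  refine (congrArg (fun k : V ⟶ _ => unitVal (toQSheaf W) i U (secApp k U (vertexVal v)))
    h).trans ?_
  refine (unitVal_vertexSumMap f i U _).trans ?_
  exact congrArg (secMap (f.app i).val U) (unitVal_epsSum_of_isAtVertex V i U v)

theorem epsSum_vertexSumMap_rowDiff {V W : SheafOfModules.{u} (pathSheaf M)}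
    (f : toQSheaf V ⟶ toQSheaf W) :
    (epsSum V ≫ vertexSumMap f) ≫ rowDiff (toQSheaf W) = 0 := by
  rw [Category.assoc, ← rowDiff_naturality, ← Category.assoc, epsSum_rowDiff, zero_comp]

/-- `W` is the kernel of `d` on `⨁ Hom(e_i B, W_i)`. A morphism `f` of twisted sheaves induces a map
of these sums commuting with `d`, so the image of `V` lands in that kernel and lifts to `W`. -/
instance full_toQSheafFunctor : (toQSheafFunctor M).Full where
  map_surjective {V W} f := by
    have hS := epsSum_exact W
    have w := epsSum_vertexSumMap_rowDiff (V := V) (W := W) f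
    exact ⟨hS.lift _ w, TwistedQSheaf.Hom.ext (funext fun i =>
      vertexMap_eq_of_epsSum (hS.lift_f _ w) i)⟩

/-! ### Essential surjectivity: recovering a twisted `Q`-sheaf from the kernel of `d`. -/

section EssSurj

set_option linter.unusedSectionVars false

variable (T : TwistedQSheaf M)

theorem unitVal_smul (i : Q) {U : (Opens X)ᵒᵖ} (b : (pathSheaf M).obj.obj U)
    (α : (vertexSum T).val.obj U) :
    unitVal T i U (b • α) = (vertexHoms T U α i).1 U (𝟙 U) (rightMul i b (unitSec M i U)) :=
  valAt_smul (biproduct.π (fun i : Q => homSheaf (vertexRight M i) (T.obj i)) i) U b α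
    (unitSec M i U)

theorem unitVal_secVertex_smul (i : Q) {U : (Opens X)ᵒᵖ} (α : (vertexSum T).val.obj U) :
    unitVal T i U (secVertex M i U • α) = unitVal T i U α :=
  (unitVal_smul T i _ α).trans (congrArg ((vertexHoms T U α i).1 U (𝟙 U))
    (ringVal_injective (secVertex_mul_self i U)))

theorem unitVal_secVertex_smul_of_ne {i j : Q} (h : i ≠ j) {U : (Opens X)ᵒᵖ}
    (α : (vertexSum T).val.obj U) : unitVal T i U (secVertex M j U • α) = 0 :=
  (unitVal_smul T i _ α).trans ((congrArg ((vertexHoms T U α i).1 U (𝟙 U))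
    (ringVal_injective (secVertex_mul_of_ne h U))).trans (map_zero _))

/-- At `e_j`, the section `m α` takes the value `α_j(e_j m) = α_j(m e_i)`, and vanishing of `d α`
rewrites this as `φ_a(m ⊗ α_i(e_i))`. -/
theorem unitVal_secArrow_smul {i j : Q} (a : i ⟶ j) {U : (Opens X)ᵒᵖ} (m : Sec (M a).val U)
    (α : (vertexSum T).val.obj U) (hα : secApp (rowDiff T) U α = 0) :
    unitVal T j U (secArrow M a U m • α) = T.act a U m (unitVal T i U α) := by
  refine (unitVal_smul T j _ α).trans ?_
  have h₁ : rightMul j (secArrow M a U m) (unitSec M j U) =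
      arrowBilin (leftB M) a U m (unitSec M i U) := by
    refine ringVal_injective ((secVertex_mul_arrow a U m).trans ?_)
    change secArrow M a U m = secArrow M a U m * secVertex M i U
    rw [secArrow, secVertex, ← map_mul, arrowElt_mul, vertexElt, rowSingle_same, arrowAct_rowOf]
    rfl
  have h₂ := arrowHoms_rowDiff T α a U (𝟙 U) m (unitSec M i U)
  rw [hα] at h₂
  rw [h₁]
  refine sub_eq_zero.1 (h₂.symm.trans ?_)
  rw [arrowHoms, map_zero]
  rfl

/-- The kernel of `⨁_i Hom(e_i B, L_i) → ⨁_a Hom(M_a ⊗ e_{ta} B, L_{ha})`, a `B`-module whose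
twisted `Q`-sheaf is isomorphic to `(L_i)`. -/
noncomputable abbrev kernelModule : SheafOfModules.{u} (pathSheaf M) := kernel (rowDiff T)

theorem rowDiff_kernel_ι {U : (Opens X)ᵒᵖ} (κ : (kernelModule T).val.obj U) :
    secApp (rowDiff T) U (secApp (kernel.ι (rowDiff T)) U κ) = 0 :=
  congrArg (fun k : kernelModule T ⟶ arrowSum T => secApp k U κ) (kernel.condition (rowDiff T))

/-- The morphism from the `i`-th component of the kernel to `L_i`, `(α_i) ↦ α_i(e_i)`. -/
noncomputable def kernelEval (i : Q) : vertexSheaf (kernelModule T) i ⟶ T.obj i :=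
  evalUnit (kernel.ι (rowDiff T) ≫ biproduct.π _ i)

theorem kernelEval_apply (i : Q) (U : (Opens X)ᵒᵖ)
    (κ : Sec (vertexPre (kernelModule T).val i) U) :
    secMap (kernelEval T i).val U κ =
      unitVal T i U (secApp (kernel.ι (rowDiff T)) U (vertexVal κ)) := rfl

/-- A section of `e_i` times the kernel has zero value at `e_j` for `j ≠ i`, because `e_j e_i = 0`.
If its value at `e_i` also vanishes, it is zero by `vertexSum_ext`. -/
theorem mono_kernelEval (i : Q) : Mono (kernelEval T i) := by
  refine mono_of_injective _ fun U => (injective_iff_map_eq_zero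
    (secMap (kernelEval T i).val U)).2 fun κ hκ => ?_
  let α := secApp (kernel.ι (rowDiff T)) U (vertexVal (V := (kernelModule T).val) (i := i) κ)
  have hα : secVertex M i U • α = α :=
    (secApp_smul _ _ _ _).symm.trans (congrArg _ (vertexVal_prop κ))
  have h0 : α = 0 := by
    refine vertexSum_ext ((rowDiff_kernel_ι T _).trans (map_zero _).symm) fun j => ?_
    rw [unitVal_zero]
    by_cases h : j = i
    · subst h
      exact hκ
    · rw [← hα]
      exact unitVal_secVertex_smul_of_ne T h α
  exact vertexVal_injective (V := (kernelModule T).val) (i := i)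
    (injective_of_mono (kernel.ι (rowDiff T)) U (h0.trans (map_zero _).symm))

/-- Solve `d α = 0` with value `t` at `e_i` and `0` at the other vertices; by uniqueness `e_i α =
α`, so `α` lies in the component at `i`. -/
theorem kernelEval_surjective (i : Q) (U : (Opens X)ᵒᵖ) :
    Function.Surjective (secMap (kernelEval T i).val U) := fun t => by
  classical
  obtain ⟨α, hα, h⟩ := exists_vertexSum (T := T) (U := U) 0
    (Function.update (fun j => (0 : Sec (T.obj j).val U)) i t)
  obtain ⟨κ, hκ⟩ := exists_lift_kernel (rowDiff T) α hα
  have hiα : secVertex M i U • α = α := by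
    refine vertexSum_ext ?_ fun j => ?_
    · rw [secApp_smul, hα, smul_zero]
    · by_cases hj : j = i
      · subst hj
        exact unitVal_secVertex_smul T j α
      · rw [unitVal_secVertex_smul_of_ne T hj, h, Function.update_of_ne hj]
  have hiκ : IsAtVertex (kernelModule T).val i κ := by
    refine injective_of_mono (kernel.ι (rowDiff T)) U ?_
    refine (secApp_smul (kernel.ι (rowDiff T)) U _ κ).trans ?_
    exact (congrArg (fun α => secVertex M i U • α) hκ).trans (hiα.trans hκ.symm)
  refine ⟨vertexMk κ hiκ, (kernelEval_apply T i U _).trans ?_⟩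
  refine (congrArg (unitVal T i U) hκ).trans ((h i).trans ?_)
  exact Function.update_self i t (fun j => (0 : Sec (T.obj j).val U))

theorem epi_kernelEval (i : Q) : Epi (kernelEval T i) :=
  epi_of_isLocallySurjective _ (Presheaf.isLocallySurjective_of_surjective _ _ fun U =>
    kernelEval_surjective T i U)

theorem isIso_kernelEval (i : Q) : IsIso (kernelEval T i) :=
  have := mono_kernelEval T i
  have := epi_kernelEval T i
  isIso_of_mono_of_epi _

/-- On the kernel of `d`, acting by an arrow corresponds under evaluation to `T.φ a`. -/
theorem kernelEval_comm {i j : Q} (a : i ⟶ j) :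
    arrowMap (kernelModule T) a ≫ kernelEval T j =
      tensorSheafMap (M a) (kernelEval T i) ≫ T.φ a :=
  tensorSheaf_hom_ext fun U m κ => by
    rw [secMap_tensorSheafRes_comp, secMap_tensorSheafRes_map_comp]
    refine (congrArg (secMap (kernelEval T j).val U)
      (toQSheaf_act (kernelModule T) a U m κ)).trans ?_
    refine (congrArg (unitVal T j U) (secApp_smul (kernel.ι (rowDiff T)) U (secArrow M a U m)
      (vertexVal (V := (kernelModule T).val) (i := i) κ))).trans ?_
    exact unitVal_secArrow_smul T a m _ (rowDiff_kernel_ι T _)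

/-- The twisted `Q`-sheaf of the kernel is isomorphic to `(L_i)`. -/
noncomputable def kernelIso : toQSheaf (kernelModule T) ≅ T :=
  isoMk (kernelEval T) (isIso_kernelEval T) fun _ _ a => kernelEval_comm T a

end EssSurj

instance essSurj_toQSheafFunctor : (toQSheafFunctor M).EssSurj where
  mem_essImage T := ⟨kernelModule T, ⟨kernelIso T⟩⟩

instance isEquivalence_toQSheafFunctor : (toQSheafFunctor M).IsEquivalence where

theorem enoughInjectives_twistedQSheaf : EnoughInjectives (TwistedQSheaf M) :=
  EnoughInjectives.of_equivalence (toQSheafFunctor M).inv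

end Equivalence

end TwistedQuiver

theorem proposition3p7 {X : RingedSpace.{u, u}} {Q : Type u} [Quiver.{u} Q] [Finite Q]
    [∀ i j : Q, Finite (i ⟶ j)] (M : ∀ ⦃i j : Q⦄, (i ⟶ j) → TwistedQuiver.OMod X)
    (hM : ∀ ⦃i j : Q⦄ (a : i ⟶ j), (M a).IsLocallyFree) :
    (∀ V : SheafOfModules.{u} (TwistedQuiver.pathSheaf M),
      Nonempty (TwistedQuiver.VertexResolutions V) ∧
      ∀ J : TwistedQuiver.VertexResolutions V,
        Nonempty (TwistedQuiver.ArrowLifts J) ∧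
        ∀ Φ : TwistedQuiver.ArrowLifts J,
          (∀ n : ℕ, Injective ((TwistedQuiver.totalComplex J Φ).X n)) ∧
          QuasiIso (TwistedQuiver.augmentation J Φ)) ∧
    EnoughInjectives (SheafOfModules.{u} (TwistedQuiver.pathSheaf M)) ∧
    EnoughInjectives (TwistedQuiver.TwistedQSheaf M) :=
  ⟨fun V => ⟨TwistedQuiver.nonempty_vertexResolutions V, fun J =>
    ⟨TwistedQuiver.nonempty_arrowLifts hM J, fun Φ =>
      ⟨fun n => TwistedQuiver.injective_totalX hM J n,
        TwistedQuiver.quasiIso_augmentation J Φ⟩⟩⟩,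
    -- The instance comes from `isGrothendieckAbelian_sheafOfModules` applied to `B`.
    inferInstance, TwistedQuiver.enoughInjectives_twistedQSheaf⟩
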